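/- **Setting.** Let $d\ge 2$, let $\Omega\subseteq\mathbb R^d$ be open, bounded, connected and polyhedral with Lipschitz boundary, and let $\mathcal M$ be a finite face-to-face simplicial mesh of $\Omega$ with more than one element: $\overline\Omega=\bigcup_{K\in\mathcal M}K$ with $d$-simplices $K$, and any two elements intersect in the (possibly empty) simplex spanned by their common vertices. The shape coefficient is $\gamma_{\mathcal M}=\max_{K\in\mathcal M}h_K/\rho_K$, where $h_K$ is the diameter of $K$ and $\rho_K$ the diameter of its largest inscribed ball. A $(d-1)$-dimensional face $F$ of $\mathcal M$ is a boundary face if $F\subseteq\partial\Omega$, and an interior face otherwise; the set of interior faces is $\mathcal F^i$. Let $H^1(\mathcal M)$ be the space of $w\in L^2(\Omega)$ with $w_{|K}\in H^1(K)$ for all $K\in\mathcal M$, let $\nabla_{\mathcal M}$ be the piecewise weak gradient, $a_{\mathcal M}(w_1,w_2)=\int_\Omega\nabla_{\mathcal M}w_1\cdot\nabla_{\mathcal M}w_2$, and $\|w\|=\|\nabla_{\mathcal M}w\|_{L^2(\Omega)}$. Put $V=H^1_0(\Omega)$ and let $$S=\Big\{s\in L^2(\Omega): s_{|K}\in\mathbb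 P_1(K)\ \forall K\in\mathcal M,\ \int_F[\![s]\!]_F=0\ \text{for every face }F\Big\}$$ be the Crouzeix–Raviart space, where $[\![s]\!]_F$ is the difference of the values from the two elements that share $F$ and, for a boundary face, the value from within $\Omega$. **Smoothing operator.** For a vertex $z$ let $\Phi_z$ be its hat function, i.e. the continuous piecewise affine function with $\Phi_z(y)=\delta_{zy}$ for all vertices $y$ of $\mathcal M$. For every vertex $z\in\Omega$ fix any element $K_z\in\mathcal M$ that contains $z$, and set $A_1\sigma=\sum_{z\in\Omega}\sigma_{|K_z}(z)\,\Phi_z$. For $F\in\mathcal F^i$ let $\Phi_F=\prod_{z}\Phi_z$, the product over the vertices $z$ of $F$, let $\bar\Phi_F=\Phi_F/\int_F\Phi_F$, and set $B\sigma=\sum_{F\in\mathcal F^i}\big(\int_F\sigma\big)\bar\Phi_F$. Finally let $E_1\sigma=A_1\sigma+B(\sigma-A_1\sigma)$ for $\sigma\in S$. **Theorem (quasi-optimality of $M_{CR}$).** There is a function $C_{d,\gamma}$ of $d$ and $\gamma$ only, nondecreasing in $\gamma$, such that in every such setting, with any choice of the elements $K_z$, the following holds. One has $V+S\subseteq H^1(\mathcal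 M)$, and $a_{\mathcal M}$ is a scalar product on $V+S$. The space $S$ is finite-dimensional, $a_{\mathcal M}$ is nondegenerate on $S\times S$, and $E_1$ is a linear operator from $S$ to $V$. Hence the new Crouzeix–Raviart method $M_{CR}=(S,a_{\mathcal M|S\times S},E_1)$ for the Poisson problem $-\Delta u=f$ in $\Omega$, $u=0$ on $\partial\Omega$, which maps $f\in V'$ to the solution $U=M_{CR}f\in S$ of $$a_{\mathcal M}(U,\sigma)=\langle f,E_1\sigma\rangle\qquad\forall\sigma\in S,$$ is well-defined. It is a nonconforming Galerkin method, i.e. its bilinear form coincides with $\int_\Omega\nabla u\cdot\nabla v$ on $S\cap V$ and $E_1\sigma=\sigma$ for all $\sigma\in S\cap V$. It is quasi-optimal with respect to $\|\nabla_{\mathcal M}\cdot\|$: there is a constant $C\ge1$ such that, for all $u\in V$ and with $U=M_{CR}f$ for the load $f=\int_\Omega\nabla u\cdot\nabla(\cdot)$, $$\|\nabla_{\mathcal M}(u-U)\|_{L^2(\Omega)}\le C\inf_{s\in S}\|\nabla_{\mathcal M}(u-s)\|_{L^2(\Omega)} ,$$ and the smallest such constant satisfies $C_{\mathrm{qopt}}\le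 C_{d,\gamma_{\mathcal M}}$. -/

import Mathlib

open MeasureTheory Set
open scoped ContDiff

namespace CRMethod

noncomputable section

/-! ### Nonconforming methods for symmetric elliptic problems

`W` is the ambient space, `V ⊆ W` the space of the continuous problem, `S ⊆ W` the discrete space,
and `a` a bilinear form on `W` whose restriction to `V + S` is the extended scalar product. -/

section Abstract

variable {W : Type*} [AddCommGroup W] [Module ℝ W]

/-- `a` restricted to the subspace `U` is a scalar product. -/
structure IsScalarProductOn (a : W →ₗ[ℝ] W →ₗ[ℝ] ℝ) (U : Submodule ℝ W) : Prop where
  symm : ∀ u ∈ U, ∀ v ∈ U, a u v = a v u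
  pos : ∀ u ∈ U, u ≠ 0 → 0 < a u u

/-- The (extended) energy norm induced by `a`. -/
def energyNorm (a : W →ₗ[ℝ] W →ₗ[ℝ] ℝ) (w : W) : ℝ := Real.sqrt (a w w)

/-- A nonconforming method, i.e. a triplet `(S, b, E)` of a finite-dimensional space `S`, a
nondegenerate bilinear form `b` on `S` and a linear smoothing operator `E : S → V`. -/
structure NonconformingMethod (V S : Submodule ℝ W) where
  finDim : FiniteDimensional ℝ S
  b : S →ₗ[ℝ] S →ₗ[ℝ] ℝ
  nondeg : ∀ s : S, (∀ σ : S, b s σ = 0) → s = 0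
  E : S →ₗ[ℝ] V

namespace NonconformingMethod

variable {V S : Submodule ℝ W} (N : NonconformingMethod V S)

/-- The map `s ↦ b(s, ·)` from `S` to its dual, which is invertible. -/
def bEquiv : S ≃ₗ[ℝ] Module.Dual ℝ S :=
  haveI := N.finDim
  LinearMap.linearEquivOfInjective N.b
    ((injective_iff_map_eq_zero N.b).2 fun s hs => N.nondeg s fun σ => by rw [hs]; rfl)
    Subspace.dual_finrank_eq.symm

/-- The solution operator `ℓ ↦ Mℓ` of the discrete problem: `Mℓ ∈ S` is the solution of
`b(Mℓ, σ) = ⟨ℓ, Eσ⟩` for all `σ ∈ S` (see `app_spec`). It is defined for every linear functional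
on `V`, in particular for all those that are bounded in the energy norm. -/
def app : Module.Dual ℝ V →ₗ[ℝ] S := N.bEquiv.symm.toLinearMap ∘ₗ N.E.dualMap

theorem app_spec (l : Module.Dual ℝ V) (σ : S) : N.b (N.app l) σ = l (N.E σ) := by
  have h : N.bEquiv (N.app l) = N.E.dualMap l := by simp [app]
  have h2 : N.bEquiv (N.app l) = N.b (N.app l) := by
    simp [bEquiv]
  rw [← h2, h]; rfl

/-- The approximation operator: `u` is mapped to the discrete solution for the load `a(u, ·)`,
that is for the load for which `u` is the exact solution. -/
def approx (a : W →ₗ[ℝ] W →ₗ[ℝ] ℝ) (u : V) : S := N.app (a (u : W) ∘ₗ V.subtype)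

/-- `N` is a nonconforming Galerkin method: on the conforming part `S ∩ V` of the discrete space
the form `b` is the restriction of `a` and the smoothing operator is the identity. -/
def IsGalerkin (a : W →ₗ[ℝ] W →ₗ[ℝ] ℝ) : Prop :=
  (∀ s σ : S, (s : W) ∈ V → (σ : W) ∈ V → N.b s σ = a s σ) ∧
    ∀ σ : S, (σ : W) ∈ V → ((N.E σ : V) : W) = σ

/-- The constants `C ≥ 1` for which the errors of `N` are bounded by `C` times the best error. -/
def qoptConstants (a : W →ₗ[ℝ] W →ₗ[ℝ] ℝ) : Set ℝ :=
  {C | 1 ≤ C ∧ ∀ u : V, energyNorm a ((u : W) - (N.approx a u : W)) ≤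
    C * ⨅ s : S, energyNorm a ((u : W) - (s : W))}

def IsQuasiOptimal (a : W →ₗ[ℝ] W →ₗ[ℝ] ℝ) : Prop := (N.qoptConstants a).Nonempty

/-- The quasi-optimality constant. -/
def Cqopt (a : W →ₗ[ℝ] W →ₗ[ℝ] ℝ) : ℝ := sInf (N.qoptConstants a)

end NonconformingMethod

end Abstract

/-! ### Domains and meshes -/

abbrev Pt (d : ℕ) : Type := EuclideanSpace ℝ (Fin d)

variable {d : ℕ}

/-- Every boundary point has a neighbourhood in which, after a rotation of the coordinates that
makes `e` the last coordinate direction, `Ω` is the set of points above the graph of a Lipschitz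
function of the remaining coordinates. -/
def HasLipschitzBoundary (Ω : Set (Pt d)) : Prop :=
  ∀ x ∈ frontier Ω, ∃ e : Pt d, ‖e‖ = 1 ∧ ∃ (L : NNReal) (g : Pt d → ℝ), LipschitzWith L g ∧
    ∃ r > 0, ∀ y ∈ Metric.ball x r, y ∈ Ω ↔ g (y - inner ℝ e y • e) < inner ℝ e y

/-- Open, bounded, connected with Lipschitz boundary. (Polyhedrality follows from the existence
of a mesh.) -/
structure IsLipschitzDomain (Ω : Set (Pt d)) : Prop where
  isOpen : IsOpen Ω
  isBounded : Bornology.IsBounded Ω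
  isConnected : IsConnected Ω
  lipschitz : HasLipschitzBoundary Ω

/-- The simplex with the given vertices. -/
abbrev hull (C : Finset (Pt d)) : Set (Pt d) := convexHull ℝ (C : Set (Pt d))

/-- A face-to-face simplicial mesh of `Ω`. A simplex is represented by its set of vertices. Two
elements meet in the simplex spanned by their common vertices (which is empty if there are none). -/
structure Mesh (Ω : Set (Pt d)) where
  elems : Finset (Finset (Pt d))
  card_eq : ∀ K ∈ elems, K.card = d + 1
  indep : ∀ K ∈ elems, AffineIndependent ℝ ((↑) : K → Pt d)
  cover : closure Ω = ⋃ K ∈ elems, hull K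
  inter : ∀ K ∈ elems, ∀ K' ∈ elems,
    hull K ∩ hull K' = convexHull ℝ ((K : Set (Pt d)) ∩ (K' : Set (Pt d)))

/-- The diameter of the largest ball inscribed in the `d`-simplex `K`. -/
def inDiam (K : Finset (Pt d)) : ℝ :=
  2 * sSup {r : ℝ | 0 ≤ r ∧ ∃ c : Pt d, Metric.closedBall c r ⊆ hull K}

/-- The shape coefficient of a `d`-simplex. -/
def shapeCoeff (K : Finset (Pt d)) : ℝ := Metric.diam (hull K) / inDiam K

/-- The integral over the `(d-1)`-simplex `F` with respect to the `(d-1)`-dimensional Hausdorff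
measure. -/
def faceIntegral (F : Finset (Pt d)) (f : Pt d → ℝ) : ℝ :=
  ∫ x in hull F, f x ∂(Measure.euclideanHausdorffMeasure (d - 1))

namespace Mesh

variable {Ω : Set (Pt d)} (M : Mesh Ω)

/-- The shape coefficient of the mesh: the maximum of those of its elements. -/
def shape : ℝ := ⨆ K : M.elems, shapeCoeff (K : Finset (Pt d))

open Classical in
/-- The `(d-1)`-dimensional faces of the mesh, represented by their vertices. -/
def faces : Finset (Finset (Pt d)) := M.elems.biUnion fun K => K.powersetCard d

/-- A boundary face is one that is contained in the boundary of `Ω`. -/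
def IsBoundaryFace (_M : Mesh Ω) (F : Finset (Pt d)) : Prop := hull F ⊆ frontier Ω

open Classical in
def interiorFaces : Finset (Finset (Pt d)) := M.faces.filter fun F => ¬ M.IsBoundaryFace F

open Classical in
/-- The vertices of the mesh that lie in `Ω`. -/
def interiorVertices : Finset (Pt d) := (M.elems.biUnion id).filter fun z => z ∈ Ω

end Mesh

/-! ### Function spaces -/

abbrev L2 (Ω : Set (Pt d)) : Type := ↥(Lp ℝ 2 (volume.restrict Ω))

abbrev L2Vec (Ω : Set (Pt d)) : Type := ↥(Lp (Pt d) 2 (volume.restrict Ω))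

/-- Smooth functions with compact support in `U`. -/
structure IsTest (U : Set (Pt d)) (φ : Pt d → ℝ) : Prop where
  contDiff : ContDiff ℝ ∞ φ
  compact : HasCompactSupport φ
  subset : tsupport φ ⊆ U

/-- The pairs `(φ, ∇φ)` with a test function `φ`, as elements of `L² × L²`. -/
def testGraph (Ω : Set (Pt d)) : Submodule ℝ (L2 Ω × L2Vec Ω) where
  carrier := {q | ∃ φ : Pt d → ℝ, IsTest Ω φ ∧
    q.1 =ᵐ[volume.restrict Ω] φ ∧ q.2 =ᵐ[volume.restrict Ω] gradient φ}
  zero_mem' := by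
    refine ⟨0, ⟨contDiff_const, HasCompactSupport.zero, by simp [tsupport]⟩, Lp.coeFn_zero _ _ _, ?_⟩
    filter_upwards [Lp.coeFn_zero (Pt d) 2 (volume.restrict Ω)] with x hx
    simp only [Prod.snd_zero, hx]
    exact (gradient_fun_const x (0 : ℝ)).symm
  add_mem' := by
    rintro p q ⟨φ, hφ, h1, h2⟩ ⟨ψ, hψ, h3, h4⟩
    refine ⟨φ + ψ, ⟨hφ.contDiff.add hψ.contDiff, hφ.compact.add hψ.compact,
      (tsupport_add φ ψ).trans (union_subset hφ.subset hψ.subset)⟩, ?_, ?_⟩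
    · exact (Lp.coeFn_add _ _).trans (h1.add h3)
    · filter_upwards [Lp.coeFn_add p.2 q.2, h2, h4] with x hx h2 h4
      rw [Prod.snd_add, hx, Pi.add_apply, h2, h4]
      simp only [gradient]
      rw [fderiv_add (hφ.contDiff.differentiable (by simp) x)
        (hψ.contDiff.differentiable (by simp) x), map_add]
  smul_mem' := by
    rintro c p ⟨φ, hφ, h1, h2⟩
    refine ⟨c • φ, ⟨hφ.contDiff.const_smul c, hφ.compact.smul_left, 
      (closure_mono (Function.support_const_smul_subset c φ)).trans hφ.subset⟩, ?_, ?_⟩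
    · exact (Lp.coeFn_smul _ _).trans (h1.const_smul c)
    · filter_upwards [Lp.coeFn_smul c p.2, h2] with x hx h2
      rw [Prod.smul_snd, hx, Pi.smul_apply, h2]
      simp only [gradient]
      rw [fderiv_const_smul (hφ.contDiff.differentiable (by simp) x)]
      simp

/-- `H¹₀(Ω)`, the closure of the test functions in the `H¹`-norm: `u` is an element if and only if
there are test functions that converge to `u` in `L²` and whose gradients converge in `L²`. -/
def H10 (Ω : Set (Pt d)) : Submodule ℝ (L2 Ω) :=
  (testGraph Ω).topologicalClosure.map (LinearMap.fst ℝ (L2 Ω) (L2Vec Ω))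

/-- `G` is a weak gradient of `w` on the open subset `U` of `Ω`. -/
def HasWeakGradOn {Ω : Set (Pt d)} (U : Set (Pt d)) (w : L2 Ω) (G : L2Vec Ω) : Prop :=
  ∀ φ : Pt d → ℝ, IsTest U φ → ∀ v : Pt d,
    ∫ x in Ω, w x * fderiv ℝ φ x v = - ∫ x in Ω, inner ℝ (G x) v * φ x

theorem IsTest.memLp {U : Set (Pt d)} {φ : Pt d → ℝ} (h : IsTest U φ) (μ : Measure (Pt d))
    [IsFiniteMeasureOnCompacts μ] : MemLp φ 2 μ :=
  h.contDiff.continuous.memLp_of_hasCompactSupport h.compact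

theorem IsTest.memLp_fderiv {U : Set (Pt d)} {φ : Pt d → ℝ} (h : IsTest U φ)
    (μ : Measure (Pt d)) [IsFiniteMeasureOnCompacts μ] (v : Pt d) :
    MemLp (fun x => fderiv ℝ φ x v) 2 μ := by
  refine Continuous.memLp_of_hasCompactSupport ?_ (h.compact.fderiv_apply ℝ v)
  exact (h.contDiff.continuous_fderiv (by simp)).clm_apply continuous_const

theorem integrable_mul_test {Ω : Set (Pt d)} (w : L2 Ω) {f : Pt d → ℝ}
    (hf : MemLp f 2 (volume.restrict Ω)) :
    Integrable (fun x => w x * f x) (volume.restrict Ω) :=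
  (Lp.memLp w).integrable_mul hf

theorem integrable_inner_test {Ω : Set (Pt d)} (G : L2Vec Ω) (v : Pt d) {f : Pt d → ℝ}
    (hf : MemLp f 2 (volume.restrict Ω)) :
    Integrable (fun x => inner ℝ (G x) v * f x) (volume.restrict Ω) :=
  ((Lp.memLp G).inner_const v).integrable_mul hf

namespace Mesh

variable {Ω : Set (Pt d)} (M : Mesh Ω)

/-- The pairs `(w, G)` such that `G` is, on every element of the mesh, a weak gradient of `w`. -/
def brokenGraph : Submodule ℝ (L2 Ω × L2Vec Ω) where
  carrier := {q | ∀ K ∈ M.elems, HasWeakGradOn (interior (hull K)) q.1 q.2}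
  zero_mem' := by
    intro K _ φ hφ v
    have h1 : ∫ x in Ω, (0 : L2 Ω) x * fderiv ℝ φ x v = 0 := by
      refine integral_eq_zero_of_ae ?_
      filter_upwards [Lp.coeFn_zero ℝ 2 (volume.restrict Ω)] with x hx
      rw [hx]; simp
    have h2 : ∫ x in Ω, inner ℝ ((0 : L2Vec Ω) x) v * φ x = 0 := by
      refine integral_eq_zero_of_ae ?_
      filter_upwards [Lp.coeFn_zero (Pt d) 2 (volume.restrict Ω)] with x hx
      rw [hx]; simp
    simp only [Prod.fst_zero, Prod.snd_zero, h1, h2, neg_zero]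
  add_mem' := by
    rintro p q hp hq K hK φ hφ v
    have h1 : ∫ x in Ω, (p.1 + q.1 : L2 Ω) x * fderiv ℝ φ x v =
        (∫ x in Ω, p.1 x * fderiv ℝ φ x v) + ∫ x in Ω, q.1 x * fderiv ℝ φ x v := by
      rw [← integral_add (integrable_mul_test _ (hφ.memLp_fderiv _ v))
        (integrable_mul_test _ (hφ.memLp_fderiv _ v))]
      refine integral_congr_ae ?_
      filter_upwards [Lp.coeFn_add p.1 q.1] with x hx
      rw [hx, Pi.add_apply, add_mul]
    have h2 : ∫ x in Ω, inner ℝ ((p.2 + q.2 : L2Vec Ω) x) v * φ x =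
        (∫ x in Ω, inner ℝ (p.2 x) v * φ x) + ∫ x in Ω, inner ℝ (q.2 x) v * φ x := by
      rw [← integral_add (integrable_inner_test _ v (hφ.memLp _))
        (integrable_inner_test _ v (hφ.memLp _))]
      refine integral_congr_ae ?_
      filter_upwards [Lp.coeFn_add p.2 q.2] with x hx
      rw [hx, Pi.add_apply, inner_add_left, add_mul]
    rw [Prod.fst_add, Prod.snd_add, h1, h2, hp K hK φ hφ v, hq K hK φ hφ v, neg_add]
  smul_mem' := by
    rintro c p hp K hK φ hφ v
    have h1 : ∫ x in Ω, (c • p.1 : L2 Ω) x * fderiv ℝ φ x v =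
        c * ∫ x in Ω, p.1 x * fderiv ℝ φ x v := by
      rw [← integral_const_mul]
      refine integral_congr_ae ?_
      filter_upwards [Lp.coeFn_smul c p.1] with x hx
      rw [hx, Pi.smul_apply, smul_eq_mul, mul_assoc]
    have h2 : ∫ x in Ω, inner ℝ ((c • p.2 : L2Vec Ω) x) v * φ x =
        c * ∫ x in Ω, inner ℝ (p.2 x) v * φ x := by
      rw [← integral_const_mul]
      refine integral_congr_ae ?_
      filter_upwards [Lp.coeFn_smul c p.2] with x hx
      rw [hx, Pi.smul_apply, real_inner_smul_left, mul_assoc]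
    rw [Prod.smul_fst, Prod.smul_snd, h1, h2, hp K hK φ hφ v, mul_neg]

/-- The broken weak gradient is unique. -/
theorem brokenGraph_unique (q : L2 Ω × L2Vec Ω) (hq : q ∈ M.brokenGraph) (h0 : q.1 = 0) :
    q.2 = 0 := by
  have key : ∀ K ∈ M.elems, ∀ᵐ x ∂(volume.restrict Ω), x ∈ interior (hull K) → q.2 x = 0 := by
    intro K hK
    refine isOpen_interior.ae_eq_zero_of_integral_contDiff_smul_eq_zero
      (LocallyIntegrable.locallyIntegrableOn (fun x => ?_) _) ?_
    · refine ⟨Metric.closedBall x 1, Metric.closedBall_mem_nhds x one_pos, ?_⟩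
      have : IsFiniteMeasure ((volume.restrict Ω).restrict (Metric.closedBall x 1)) :=
        ⟨by rw [Measure.restrict_apply_univ]; exact (isCompact_closedBall x 1).measure_lt_top⟩
      exact ((Lp.memLp q.2).restrict _).integrable (by norm_num)
    intro φ h1 h2 h3
    have hφ : IsTest (interior (hull K)) φ := ⟨h1, h2, h3⟩
    have hint : Integrable (fun x => φ x • q.2 x) (volume.restrict Ω) :=
      memLp_one_iff_integrable.1 ((Lp.memLp q.2).smul (hφ.memLp _))
    refine ext_inner_right ℝ fun v => ?_
    rw [inner_zero_left, real_inner_comm, ← integral_inner hint]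
    have h := hq K hK φ hφ v
    have h' : ∫ x in Ω, q.1 x * fderiv ℝ φ x v = 0 := by
      refine integral_eq_zero_of_ae ?_
      filter_upwards [Lp.coeFn_zero ℝ 2 (volume.restrict Ω)] with x hx
      rw [h0, hx]; simp
    rw [h', eq_comm, neg_eq_zero] at h
    rw [← h]
    refine integral_congr_ae (Filter.Eventually.of_forall fun x => ?_)
    simp only [real_inner_smul_right, real_inner_comm]
    ring
  have hnull : ∀ᵐ x ∂(volume.restrict Ω), ∀ K ∈ M.elems, x ∉ frontier (hull K) := by
    refine (Finset.eventually_all M.elems).2 fun K _ => ?_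
    exact ae_restrict_of_ae (measure_eq_zero_iff_ae_notMem.1
      ((convex_convexHull ℝ _).addHaar_frontier volume))
  have hmem : ∀ᵐ x ∂(volume.restrict Ω), ∃ K ∈ M.elems, x ∈ hull K := by
    have hc : ∀ x ∈ Ω, ∃ K ∈ M.elems, x ∈ hull K := fun x hx => by
      have := M.cover ▸ subset_closure hx
      simpa using this
    by_cases hΩ : MeasurableSet (closure Ω)
    · have : ∀ᵐ x ∂(volume.restrict (closure Ω)), x ∈ closure Ω := ae_restrict_mem hΩ
      filter_upwards [ae_restrict_of_ae_restrict_of_subset subset_closure this] with x hx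
      have := M.cover ▸ hx
      simpa using this
    · exact absurd isClosed_closure.measurableSet hΩ
  rw [Lp.eq_zero_iff_ae_eq_zero]
  filter_upwards [(Finset.eventually_all M.elems).2 key, hnull, hmem] with x h1 h2 ⟨K, hK, hx⟩
  refine h1 K hK ?_
  by_contra hne
  exact h2 K hK ⟨subset_closure hx, hne⟩

/-- The broken gradient, a linear operator on the subspace `H¹(M)` of `L²(Ω)`. -/
def brokenGrad : L2 Ω →ₗ.[ℝ] L2Vec Ω := M.brokenGraph.toLinearPMap

/-- `H¹(M)`, the space of piecewise `H¹` functions. -/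
abbrev brokenH1 : Submodule ℝ (L2 Ω) := M.brokenGrad.domain

/-- The bilinear form `(w₁, w₂) ↦ ∫ ∇_M w₁ · ∇_M w₂` on `H¹(M)`. -/
def form : M.brokenH1 →ₗ[ℝ] M.brokenH1 →ₗ[ℝ] ℝ :=
  (innerₗ (L2Vec Ω)).compl₁₂ M.brokenGrad.toFun M.brokenGrad.toFun

/-- `s` agrees on the element `K` with the affine function `p`. -/
def AgreesOn (_M : Mesh Ω) (s : Pt d → ℝ) (K : Finset (Pt d)) (p : Pt d →ᵃ[ℝ] ℝ) : Prop :=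
  ∀ᵐ x ∂(volume.restrict Ω), x ∈ hull K → s x = p x

/-- `p` is a family of affine functions, one on each element, whose jumps have mean value zero on
every face. On a boundary face the jump is the value from within `Ω`. -/
def JumpsVanish (p : Finset (Pt d) → Pt d →ᵃ[ℝ] ℝ) : Prop :=
  ∀ F ∈ M.faces,
    (¬ M.IsBoundaryFace F → ∀ K ∈ M.elems, ∀ K' ∈ M.elems, F ⊆ K → F ⊆ K' →
      faceIntegral F (fun x => p K x - p K' x) = 0) ∧
    (M.IsBoundaryFace F → ∀ K ∈ M.elems, F ⊆ K → faceIntegral F (p K) = 0)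

end Mesh

theorem measure_face_lt_top {F : Finset (Pt d)} (hF : F.card = d)
    (hi : AffineIndependent ℝ ((↑) : F → Pt d)) :
    (Measure.euclideanHausdorffMeasure (d - 1) : Measure (Pt d)) (hull F) < ⊤ := by
  rcases F.eq_empty_or_nonempty with rfl | hne
  · simp [hull]
  obtain ⟨z, hz⟩ := hne
  set A := affineSpan ℝ (F : Set (Pt d)) with hA
  have hzA : z ∈ A := subset_affineSpan ℝ _ hz
  have : Nonempty A := ⟨⟨z, hzA⟩⟩
  have hdim : Module.finrank ℝ A.direction = d - 1 := by
    rw [hA, direction_affineSpan]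
    have h := hi.finrank_vectorSpan (n := d - 1)
      (by rw [Fintype.card_coe, hF]; have := Finset.card_pos.2 ⟨z, hz⟩; omega)
    rw [← h]
    congr 2 <;> simp
  have hsub : hull F ⊆ (A : Set (Pt d)) := convexHull_subset_affineSpan _
  have him : hull F = Subtype.val '' ((Subtype.val : A → Pt d) ⁻¹' hull F) := by
    rw [image_preimage_eq_inter_range, Subtype.range_coe]
    exact (inter_eq_left.2 hsub).symm
  have hcpt : IsCompact ((Subtype.val : A → Pt d) ⁻¹' hull F) := by
    rw [Subtype.isCompact_iff, ← him]
    exact F.finite_toSet.isCompact_convexHull ℝ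
  rw [him, AffineSubspace.euclideanHausdorffMeasure_coe_image, ← hdim,
    EuclideanGeometry.euclideanHausdorffMeasure_eq (⟨z, hzA⟩ : A),
    Measure.map_apply (IsometryEquiv.continuous _).measurable hcpt.measurableSet]
  have := (IsometryEquiv.vaddConst (⟨z, hzA⟩ : A)).symm.toHomeomorph.isCompact_image.2 hcpt
  rw [← IsometryEquiv.image_symm]
  exact this.measure_lt_top

theorem integrableOn_face {F : Finset (Pt d)} (hF : F.card = d)
    (hi : AffineIndependent ℝ ((↑) : F → Pt d)) {f : Pt d → ℝ} (hf : Continuous f) :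
    IntegrableOn f (hull F) (Measure.euclideanHausdorffMeasure (d - 1)) := by
  have hc : IsCompact (hull F) := F.finite_toSet.isCompact_convexHull ℝ
  exact hf.continuousOn.integrableOn_of_subset_isCompact hc hc.measurableSet subset_rfl
    (measure_face_lt_top hF hi).ne

namespace Mesh

variable {Ω : Set (Pt d)} (M : Mesh Ω)

theorem integrableOn_of_mem_faces {F : Finset (Pt d)} (hF : F ∈ M.faces) {f : Pt d → ℝ}
    (hf : Continuous f) :
    IntegrableOn f (hull F) (Measure.euclideanHausdorffMeasure (d - 1)) := by
  classical
  obtain ⟨K, hK, hFK⟩ := Finset.mem_biUnion.1 hF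
  obtain ⟨h1, h2⟩ := Finset.mem_powersetCard.1 hFK
  exact integrableOn_face h2 ((M.indep K hK).mono h1) hf

/-- The Crouzeix-Raviart space: the piecewise affine functions in `L²(Ω)` whose jumps have mean
value zero on all faces. -/
def crSpace : Submodule ℝ (L2 Ω) where
  carrier := {s | ∃ p : Finset (Pt d) → Pt d →ᵃ[ℝ] ℝ,
    (∀ K ∈ M.elems, M.AgreesOn s K (p K)) ∧ M.JumpsVanish p}
  zero_mem' := by
    refine ⟨0, fun K _ => ?_, fun F _ => ⟨?_, ?_⟩⟩
    · filter_upwards [Lp.coeFn_zero ℝ 2 (volume.restrict Ω)] with x hx _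
      rw [hx]; simp
    · intros; simp [faceIntegral]
    · intros; simp [faceIntegral]
  add_mem' := by
    rintro s t ⟨p, hp, hp'⟩ ⟨q, hq, hq'⟩
    have hc : ∀ f : Pt d →ᵃ[ℝ] ℝ, Continuous f := fun f => f.continuous_of_finiteDimensional
    refine ⟨p + q, fun K hK => ?_, fun F hF => ⟨fun hb K hK K' hK' hFK hFK' => ?_,
      fun hb K hK hFK => ?_⟩⟩
    · filter_upwards [Lp.coeFn_add s t, hp K hK, hq K hK] with x hx h1 h2 hxK
      rw [hx, Pi.add_apply, h1 hxK, h2 hxK]; rfl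
    · have h1 := (hp' F hF).1 hb K hK K' hK' hFK hFK'
      have h2 := (hq' F hF).1 hb K hK K' hK' hFK hFK'
      simp only [faceIntegral] at h1 h2 ⊢
      rw [← add_zero (0 : ℝ)]
      nth_rewrite 1 [← h1]
      rw [← h2, ← integral_add
        (M.integrableOn_of_mem_faces hF (f := fun x => p K x - p K' x) ((hc _).sub (hc _)))
        (M.integrableOn_of_mem_faces hF (f := fun x => q K x - q K' x) ((hc _).sub (hc _)))]
      congr 1
      ext x
      simp
      ring
    · have h1 := (hp' F hF).2 hb K hK hFK
      have h2 := (hq' F hF).2 hb K hK hFK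
      simp only [faceIntegral] at h1 h2 ⊢
      rw [← add_zero (0 : ℝ)]
      nth_rewrite 1 [← h1]
      rw [← h2, ← integral_add (M.integrableOn_of_mem_faces hF (hc (p K)))
        (M.integrableOn_of_mem_faces hF (hc (q K)))]
      rfl
  smul_mem' := by
    rintro c s ⟨p, hp, hp'⟩
    refine ⟨c • p, fun K hK => ?_, fun F hF => ⟨fun hb K hK K' hK' hFK hFK' => ?_,
      fun hb K hK hFK => ?_⟩⟩
    · filter_upwards [Lp.coeFn_smul c s, hp K hK] with x hx h1 hxK
      rw [hx, Pi.smul_apply, h1 hxK]; rfl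
    · have h1 := (hp' F hF).1 hb K hK K' hK' hFK hFK'
      simp only [faceIntegral] at h1 ⊢
      simp only [Pi.smul_apply, AffineMap.coe_smul, smul_eq_mul, ← mul_sub]
      rw [integral_const_mul, h1, mul_zero]
    · have h1 := (hp' F hF).2 hb K hK hFK
      simp only [faceIntegral] at h1 ⊢
      simp only [Pi.smul_apply, AffineMap.coe_smul, smul_eq_mul]
      rw [integral_const_mul, h1, mul_zero]

/-- `H¹₀(Ω)` as a subspace of `H¹(M)`. -/
def V : Submodule ℝ M.brokenH1 := (H10 Ω).comap M.brokenH1.subtype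

/-- The Crouzeix-Raviart space as a subspace of `H¹(M)`. -/
def S : Submodule ℝ M.brokenH1 := M.crSpace.comap M.brokenH1.subtype

/-! ### The smoothing operator -/

/-- The affine function with which `s` agrees on the element `K`. -/
def piece (s : Pt d → ℝ) (K : Finset (Pt d)) : Pt d →ᵃ[ℝ] ℝ :=
  open Classical in if h : ∃ p, M.AgreesOn s K p then h.choose else 0

end Mesh

/-- The barycentric coordinate of the `d`-simplex `K` associated with the vertex `z`: the affine
function with value `1` in `z` and `0` in the other vertices. It is `0` if `z` is not a vertex. -/
def bary (K : Finset (Pt d)) (z : Pt d) : Pt d →ᵃ[ℝ] ℝ :=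
  open Classical in
  if h : ∃ f : Pt d →ᵃ[ℝ] ℝ, ∀ y ∈ K, f y = if y = z then 1 else 0 then h.choose else 0

namespace Mesh

variable {Ω : Set (Pt d)} (M : Mesh Ω)

/-- The hat function of the vertex `z`: the continuous piecewise affine function with value `1` in
`z` and `0` in all other vertices. In a point that belongs to several elements the value does not
depend on the element chosen. -/
def hat (z x : Pt d) : ℝ :=
  open Classical in if h : ∃ K ∈ M.elems, x ∈ hull K then bary h.choose z x else 0

/-- The face bubble: the product of the hat functions of the vertices of `F`. -/
def bubble (F : Finset (Pt d)) (x : Pt d) : ℝ := ∏ z ∈ F, M.hat z x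

/-- The face bubble normalized to have integral `1` over `F`. -/
def normBubble (F : Finset (Pt d)) (x : Pt d) : ℝ :=
  (faceIntegral F (M.bubble F))⁻¹ * M.bubble F x

/-- The integral over `F` of a piecewise affine function, taken from one of the elements that
contain `F`. For a Crouzeix-Raviart function it does not depend on the element chosen. -/
def faceMoment (s : Pt d → ℝ) (F : Finset (Pt d)) : ℝ :=
  open Classical in
  if h : ∃ K ∈ M.elems, F ⊆ K then faceIntegral F (M.piece s h.choose) else 0

/-- Admissible choices of an element `Kz z` that contains `z`, for the interior vertices `z`. -/
def IsNodeChoice (Kz : Pt d → Finset (Pt d)) : Prop :=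
  ∀ z ∈ M.interiorVertices, Kz z ∈ M.elems ∧ z ∈ hull (Kz z)

/-- Simplified nodal averaging `A₁`. -/
def avg (Kz : Pt d → Finset (Pt d)) (s : Pt d → ℝ) (x : Pt d) : ℝ :=
  ∑ z ∈ M.interiorVertices, M.piece s (Kz z) z * M.hat z x

/-- The bubble operator `B`. -/
def bubbleOp (s : Pt d → ℝ) (x : Pt d) : ℝ :=
  ∑ F ∈ M.interiorFaces, M.faceMoment s F * M.normBubble F x

/-- The smoothing operator `E₁ = A₁ + B (id - A₁)`. -/
def smoother (Kz : Pt d → Finset (Pt d)) (s : Pt d → ℝ) (x : Pt d) : ℝ :=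
  M.avg Kz s x + M.bubbleOp (fun y => s y - M.avg Kz s y) x

/-- `N` is the new Crouzeix-Raviart method: its bilinear form is the restriction of the broken form
to the Crouzeix-Raviart space, and its smoothing operator is `E₁`. -/
def IsNewCRMethod (Kz : Pt d → Finset (Pt d)) (N : NonconformingMethod M.V M.S) : Prop :=
  (∀ s σ : M.S, N.b s σ = M.form s σ) ∧
    ∀ σ : M.S, (((N.E σ : M.V) : M.brokenH1) : L2 Ω) =ᵐ[volume.restrict Ω]
      M.smoother Kz ((σ : M.brokenH1) : L2 Ω)

end Mesh

end

end CRMethod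

open CRMethod

open MeasureTheory Set
open scoped ContDiff

namespace CRMethod

noncomputable section

variable {d : ℕ}

/-! ### Simplices and barycentric coordinates -/

/-! Quasi-optimality rests on two properties of the smoothing operator `E`: the identity `a(s, Eσ) =
a(s, σ)` for all `s, σ` in `S`, and boundedness of `E` in the broken energy norm. Given them, put `σ
= U - s` for an arbitrary `s` in `S`. The discrete equation and the identity give `a(σ, σ) = a(u,
Eσ) - a(s, Eσ) = a(u - s, Eσ)`, hence `‖U - s‖ ≤ C ‖u - s‖` with the bound `C` of `E`, and the
triangle inequality yields the constant `1 + C` (`mem_qoptConstants`).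

The identity (`form_smoothing`) holds because broken gradients of functions in `S` are constant on
each element, so that only element means of `∇Eσ` matter. By the divergence theorem these are
determined by face integrals of `Eσ`, and the bubbles are scaled so that `Eσ` and `σ` have the same
face integrals (`faceIntegral_smoothPiece`). The divergence theorem on a simplex
(`IsSimplex.integral_fderiv`) is assembled from its version for the fields `f(x) (x - z)` with a
vertex `z`, which is integration along the rays from `z` (`integral_cone`).

Boundedness (`norm_brokenGrad_smoothing_le`) reduces to the error of the nodal values of `A₁`. Jumps
have mean zero on faces, so they are bounded by gradients times diameters
(`abs_le_of_faceIntegral_eq_zero`). The difference of the values in `z` from two elements telescopes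
along a chain of elements around `z` in which neighbours share an interior face containing `z`. For
a boundary vertex the chain ends at a boundary face. A packing argument bounds the length of the
chains (`card_star_le`), and shape regularity compares the diameters along them.

That such chains exist is a topological fact. The key is `exists_mem_hull_of_shared`: if a family of
elements shares within itself all faces that meet a convex open set `B`, then the mass of a bump on
the family does not change while the bump moves inside `B`, since boundary terms cancel in pairs. So
the family covers `B` or its elements have no interior points in it. On a small ball about a vertex
this gives connectedness of stars. On the whole space it gives definiteness of the form on `V + S`:
a function with vanishing broken gradient is constant on each element, the elements with nonzero
constant share all their faces, and bounded sets do not cover the space.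

The Lipschitz boundary enters only through the inclusion of the interior of the closure of `Ω` in
`Ω`. Membership of `Eσ` in `H¹₀` holds because `Eσ` is Lipschitz continuous and vanishes outside of
`Ω` (`mem_H10_of_lipschitz`). Conversely, weighted face integrals are continuous functionals of a
function and its gradient, so they pass from test functions to `H¹₀` (`exists_face_functional`). A
piecewise affine function in `H¹₀` therefore has no jumps, `A₁` reproduces it, and the method is a
Galerkin method. -/

/-- `K` is the set of vertices of a nondegenerate `d`-simplex. -/
structure IsSimplex (K : Finset (Pt d)) : Prop where
  card_eq : K.card = d + 1
  indep : AffineIndependent ℝ ((↑) : K → Pt d)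

theorem Mesh.isSimplex {Ω : Set (Pt d)} (M : Mesh Ω) {K : Finset (Pt d)} (hK : K ∈ M.elems) :
    IsSimplex K := ⟨M.card_eq K hK, M.indep K hK⟩

theorem AffineMap.continuous_real (f : Pt d →ᵃ[ℝ] ℝ) : Continuous f :=
  f.continuous_of_finiteDimensional

theorem isCompact_hull (K : Finset (Pt d)) : IsCompact (hull K) :=
  K.finite_toSet.isCompact_convexHull ℝ

theorem isClosed_hull (K : Finset (Pt d)) : IsClosed (hull K) := (isCompact_hull K).isClosed

/-- A real affine function that is nonnegative on the vertices is nonnegative on the simplex. -/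
theorem nonneg_of_mem_hull {K : Finset (Pt d)} (f : Pt d →ᵃ[ℝ] ℝ) (hf : ∀ y ∈ K, 0 ≤ f y)
    {x : Pt d} (hx : x ∈ hull K) : 0 ≤ f x := by
  have h : hull K ⊆ f ⁻¹' Ici 0 :=
    convexHull_min (fun y hy => hf y hy) ((convex_Ici (0 : ℝ)).affine_preimage f)
  exact h hx

theorem le_of_mem_hull {K : Finset (Pt d)} (f g : Pt d →ᵃ[ℝ] ℝ) (hf : ∀ y ∈ K, f y ≤ g y)
    {x : Pt d} (hx : x ∈ hull K) : f x ≤ g x := by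
  have := nonneg_of_mem_hull (g - f) (fun y hy => by simpa using hf y hy) hx
  simpa using this

theorem eq_of_mem_hull {K : Finset (Pt d)} (f g : Pt d →ᵃ[ℝ] ℝ) (hf : ∀ y ∈ K, f y = g y)
    {x : Pt d} (hx : x ∈ hull K) : f x = g x :=
  le_antisymm (le_of_mem_hull f g (fun y hy => (hf y hy).le) hx)
    (le_of_mem_hull g f (fun y hy => (hf y hy).ge) hx)

theorem hull_mono {F K : Finset (Pt d)} (h : F ⊆ K) : hull F ⊆ hull K :=
  convexHull_mono (by exact_mod_cast h)

theorem mem_hull_of_mem {K : Finset (Pt d)} {z : Pt d} (h : z ∈ K) : z ∈ hull K :=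
  subset_convexHull ℝ _ (by exact_mod_cast h)

theorem sum_smul_apply {ι : Type*} (s : Finset ι) (c : ι → ℝ) (f : ι → Pt d →ᵃ[ℝ] ℝ) (x : Pt d) :
    (∑ i ∈ s, c i • f i) x = ∑ i ∈ s, c i * f i x := by
  classical
  induction s using Finset.induction_on with
  | empty => simp
  | insert a s ha ih => simp [Finset.sum_insert ha, ih]

theorem linear_sum_smul_apply {ι : Type*} (s : Finset ι) (c : ι → ℝ) (f : ι → Pt d →ᵃ[ℝ] ℝ)
    (x : Pt d) : (∑ i ∈ s, c i • f i).linear x = ∑ i ∈ s, c i * (f i).linear x := by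
  classical
  induction s using Finset.induction_on with
  | empty => simp
  | insert a s ha ih => simp [Finset.sum_insert ha, ih]

namespace IsSimplex

variable {K : Finset (Pt d)}

theorem span_eq_top (hK : IsSimplex K) : affineSpan ℝ (range ((↑) : K → Pt d)) = ⊤ := by
  rw [hK.indep.affineSpan_eq_top_iff_card_eq_finrank_add_one]
  simp [hK.card_eq]

/-- The vertices of a simplex as an affine basis. -/
def affineBasis (hK : IsSimplex K) : AffineBasis K ℝ (Pt d) := ⟨(↑), hK.indep, hK.span_eq_top⟩

theorem affineBasis_apply (hK : IsSimplex K) (z : K) : hK.affineBasis z = z := rfl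

theorem affine_ext (hK : IsSimplex K) {P : Type*} [AddCommGroup P] [Module ℝ P] {f g : Pt d →ᵃ[ℝ] P}
    (h : ∀ y ∈ K, f y = g y) : f = g := by
  refine AffineMap.ext_on hK.span_eq_top ?_
  rintro _ ⟨y, rfl⟩
  exact h y y.2

open Classical in
theorem bary_vertex (hK : IsSimplex K) (z : Pt d) {y : Pt d} (hy : y ∈ K) :
    bary K z y = if y = z then 1 else 0 := by
  have h : ∃ f : Pt d →ᵃ[ℝ] ℝ, ∀ y ∈ K, f y = if y = z then 1 else 0 := by
    by_cases hz : z ∈ K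
    · refine ⟨hK.affineBasis.coord ⟨z, hz⟩, fun y hy => ?_⟩
      have := hK.affineBasis.coord_apply ⟨z, hz⟩ ⟨y, hy⟩
      rw [affineBasis_apply] at this
      rw [this]
      simp [eq_comm]
    · refine ⟨0, fun y hy => ?_⟩
      rw [if_neg (by rintro rfl; exact hz hy)]; rfl
  rw [bary, dif_pos h]
  exact h.choose_spec y hy

theorem bary_self (hK : IsSimplex K) {z : Pt d} (hz : z ∈ K) : bary K z z = 1 := by
  rw [hK.bary_vertex z hz, if_pos rfl]

theorem bary_ne (hK : IsSimplex K) {z y : Pt d} (hy : y ∈ K) (h : y ≠ z) : bary K z y = 0 := by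
  rw [hK.bary_vertex z hy, if_neg h]

theorem bary_eq_coord (hK : IsSimplex K) (z : K) : bary K z = hK.affineBasis.coord z := by
  classical
  refine hK.affine_ext fun y hy => ?_
  have := hK.affineBasis.coord_apply z ⟨y, hy⟩
  rw [affineBasis_apply] at this
  rw [this, hK.bary_vertex _ hy]
  simp [eq_comm, Subtype.ext_iff]

theorem bary_of_notMem (hK : IsSimplex K) {z : Pt d} (hz : z ∉ K) : bary K z = 0 :=
  hK.affine_ext fun y hy => by
    rw [hK.bary_ne hy (by rintro rfl; exact hz hy)]; rfl

theorem sum_bary (hK : IsSimplex K) (x : Pt d) : ∑ z ∈ K, bary K z x = 1 := by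
  rw [← Finset.sum_coe_sort K fun z => bary K z x]
  simp_rw [hK.bary_eq_coord]
  exact hK.affineBasis.sum_coord_apply_eq_one x

theorem sum_bary_smul (hK : IsSimplex K) (x : Pt d) : ∑ z ∈ K, bary K z x • z = x := by
  rw [← Finset.sum_coe_sort K fun z => bary K z x • z]
  simp_rw [hK.bary_eq_coord]
  exact hK.affineBasis.linear_combination_coord_eq_self x

/-- An affine function is determined by its values in the vertices. -/
theorem affine_eq_sum (hK : IsSimplex K) (f : Pt d →ᵃ[ℝ] ℝ) : f = ∑ z ∈ K, f z • bary K z := by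
  classical
  refine hK.affine_ext fun y hy => ?_
  rw [sum_smul_apply, Finset.sum_eq_single_of_mem y hy]
  · rw [hK.bary_self hy, mul_one]
  · intro z _ hzy
    rw [hK.bary_ne hy hzy.symm, mul_zero]

theorem mem_hull_iff (hK : IsSimplex K) {x : Pt d} : x ∈ hull K ↔ ∀ z ∈ K, 0 ≤ bary K z x := by
  have h := hK.affineBasis.convexHull_eq_nonneg_coord
  have hr : range hK.affineBasis = (K : Set (Pt d)) := by
    change range ((↑) : K → Pt d) = _
    simp
  rw [hr] at h
  rw [hull, h]
  simp only [mem_ofPred_eq]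
  constructor
  · intro hx z hz
    rw [hK.bary_eq_coord ⟨z, hz⟩]; exact hx _
  · intro hx z
    rw [← hK.bary_eq_coord z]; exact hx _ z.2

theorem mem_interior_iff (hK : IsSimplex K)
    {x : Pt d} : x ∈ interior (hull K) ↔ ∀ z ∈ K, 0 < bary K z x := by
  have h := hK.affineBasis.interior_convexHull
  have hr : range hK.affineBasis = (K : Set (Pt d)) := by
    change range ((↑) : K → Pt d) = _
    simp
  rw [hr] at h
  rw [hull, h]
  simp only [mem_ofPred_eq]
  constructor
  · intro hx z hz
    rw [hK.bary_eq_coord ⟨z, hz⟩]; exact hx _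
  · intro hx z
    rw [← hK.bary_eq_coord z]; exact hx _ z.2

theorem bary_nonneg (hK : IsSimplex K)
    {x : Pt d} (hx : x ∈ hull K) (z : Pt d) : 0 ≤ bary K z x := by
  by_cases hz : z ∈ K
  · exact hK.mem_hull_iff.1 hx z hz
  · rw [hK.bary_of_notMem hz]; rfl

theorem bary_le_one (hK : IsSimplex K)
    {x : Pt d} (hx : x ∈ hull K) (z : Pt d) : bary K z x ≤ 1 := by
  by_cases hz : z ∈ K
  · rw [← hK.sum_bary x]
    exact Finset.single_le_sum (f := fun z => bary K z x) (fun y _ => hK.bary_nonneg hx y) hz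
  · rw [hK.bary_of_notMem hz]; exact zero_le_one

/-- The subsimplices of a simplex in barycentric coordinates. -/
theorem mem_hull_subset_iff (hK : IsSimplex K) {T : Finset (Pt d)} (hT : T ⊆ K) {x : Pt d} :
    x ∈ hull T ↔ x ∈ hull K ∧ ∀ z ∈ K, z ∉ T → bary K z x = 0 := by
  constructor
  · intro hx
    refine ⟨hull_mono hT hx, fun z hz hzT => ?_⟩
    exact eq_of_mem_hull (bary K z) 0
      (fun y hy => hK.bary_ne (hT hy) (by rintro rfl; exact hzT hy)) hx
  · rintro ⟨hx, h⟩
    have h1 : ∑ z ∈ T, bary K z x • z = x := by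
      rw [Finset.sum_subset hT fun z hz hzT => by rw [h z hz hzT, zero_smul]]
      exact hK.sum_bary_smul x
    have h2 : ∑ z ∈ T, bary K z x = 1 := by
      rw [Finset.sum_subset hT fun z hz hzT => h z hz hzT]
      exact hK.sum_bary x
    rw [← h1]
    exact (convex_convexHull ℝ _).sum_mem (fun z _ => hK.bary_nonneg hx z) h2
      (fun z hz => mem_hull_of_mem hz)

theorem exists_mem_interior (hK : IsSimplex K) : (interior (hull K)).Nonempty := by
  have hr : range hK.affineBasis = (K : Set (Pt d)) := by
    change range ((↑) : K → Pt d) = _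
    simp
  have := hK.affineBasis.centroid_mem_interior_convexHull
  rw [hr] at this
  exact ⟨_, this⟩

theorem nonempty (hK : IsSimplex K) : K.Nonempty := Finset.card_pos.1 (by rw [hK.card_eq]; omega)

/-- The radius `inDiam K / 4` is half of the supremum of the admissible radii, so no ball that
attains the supremum is needed. The radii are bounded because a ball of radius `r` contains a point
at distance `r` from its centre, which uses a coordinate direction and hence `1 ≤ d`. -/
theorem ball_subset (hK : IsSimplex K)
    (hd : 1 ≤ d) :
    ∃ c : Pt d, Metric.closedBall c (inDiam K / 4) ⊆ hull K ∧ 0 < inDiam K := by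
  obtain ⟨c, hc⟩ := hK.exists_mem_interior
  obtain ⟨ε, hε, hball⟩ := Metric.isOpen_iff.1 isOpen_interior c hc
  set R := {r : ℝ | 0 ≤ r ∧ ∃ c : Pt d, Metric.closedBall c r ⊆ hull K} with hR
  have hmem : ε / 2 ∈ R := ⟨by positivity, c,
    (Metric.closedBall_subset_ball (by linarith)).trans (hball.trans interior_subset)⟩
  have hbdd : BddAbove R := by
    refine ⟨Metric.diam (hull K), ?_⟩
    rintro r ⟨hr0, c, hc⟩
    have h1 : c + r • EuclideanSpace.single (⟨0, hd⟩ : Fin d) (1 : ℝ) ∈ hull K :=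
      hc (by simp [norm_smul, abs_of_nonneg hr0])
    have h2 : c ∈ hull K := hc (by simpa using hr0)
    have := Metric.dist_le_diam_of_mem (isCompact_hull K).isBounded h1 h2
    simpa [norm_smul, abs_of_nonneg hr0] using this
  have hpos : 0 < sSup R := lt_of_lt_of_le (by positivity) (le_csSup hbdd hmem)
  have hin : inDiam K = 2 * sSup R := rfl
  obtain ⟨r, ⟨hr0, c', hc'⟩, hr⟩ := exists_lt_of_lt_csSup ⟨_, hmem⟩ (half_lt_self hpos)
  refine ⟨c', (Metric.closedBall_subset_closedBall ?_).trans hc', by rw [hin]; positivity⟩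
  rw [hin]; linarith

theorem inDiam_pos (hK : IsSimplex K)
    (hd : 1 ≤ d) : 0 < inDiam K := (hK.ball_subset hd).choose_spec.2

/-- Along a diameter, of length `inDiam K / 2`, of the ball from `ball_subset` the coordinate stays
in `[0, 1]`, so its slope is at most `2 / inDiam K`. -/
theorem abs_linear_bary_le (hK : IsSimplex K) (hd : 1 ≤ d) (z w : Pt d) :
    |(bary K z).linear w| ≤ 2 / inDiam K * ‖w‖ := by
  rcases eq_or_ne w 0 with rfl | hw
  · simp
  obtain ⟨c, hc, hpos⟩ := hK.ball_subset hd
  have hw0 : 0 < ‖w‖ := norm_pos_iff.2 hw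
  set u : Pt d := (inDiam K / 4 / ‖w‖) • w with hu
  have hun : ‖u‖ = inDiam K / 4 := by
    rw [hu, norm_smul, Real.norm_of_nonneg (by positivity)]; field_simp
  have h1 : c + u ∈ hull K := hc (by simp [hun])
  have h2 : c - u ∈ hull K := hc (by simp [hun])
  have e1 : bary K z (c + u) = (bary K z).linear u + bary K z c := by
    rw [add_comm c u]; exact (bary K z).map_vadd c u
  have e2 : bary K z (c - u) = -(bary K z).linear u + bary K z c := by
    rw [sub_eq_neg_add, ← map_neg]; exact (bary K z).map_vadd c (-u)
  have a1 := hK.bary_nonneg h1 z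
  have a2 := hK.bary_nonneg h2 z
  have b1 := hK.bary_le_one h1 z
  have b2 := hK.bary_le_one h2 z
  have h3 : |(bary K z).linear u| ≤ 1 / 2 := by
    rw [abs_le]; constructor <;> linarith
  rw [hu, map_smul, smul_eq_mul, abs_mul, abs_of_pos (by positivity)] at h3
  calc |(bary K z).linear w| =
      (inDiam K / 4 / ‖w‖ * |(bary K z).linear w|) * (4 * ‖w‖ / inDiam K) := by field_simp
    _ ≤ 1 / 2 * (4 * ‖w‖ / inDiam K) := by gcongr
    _ = _ := by ring

/-- Every edge is at least as long as half of the diameter of the inscribed ball. -/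
theorem inDiam_le_dist (hK : IsSimplex K)
    (hd : 1 ≤ d) {a b : Pt d} (ha : a ∈ K) (hb : b ∈ K) (hab : a ≠ b) :
    inDiam K ≤ 2 * dist a b := by
  have h := hK.abs_linear_bary_le hd a (a - b)
  -- The coordinate of `a` drops from 1 to 0 along the edge, which is impossible on a shorter edge
  -- by the slope bound.
  have h1 : (bary K a).linear (a - b) = 1 := by
    have := (bary K a).linearMap_vsub a b
    rw [vsub_eq_sub] at this
    rw [this, hK.bary_self ha, hK.bary_ne hb hab.symm]; simp
  have hp := hK.inDiam_pos hd
  rw [h1, abs_one, ← dist_eq_norm] at h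
  rw [div_mul_eq_mul_div, le_div_iff₀ hp] at h
  linarith

end IsSimplex

/-! ### Integration over cones -/

theorem mem_hull_cone_iff {F K : Finset (Pt d)} {z : Pt d} (hK : (K : Set (Pt d)) = insert z ↑F)
    (hne : F.Nonempty) {x : Pt d} :
    x ∈ hull K ↔ ∃ t ∈ Icc (0 : ℝ) 1, ∃ y ∈ hull F, x = z + t • (y - z) := by
  rw [hull, hK, convexHull_insert (by simpa using hne), mem_convexJoin]
  simp only [mem_singleton_iff, exists_eq_left]
  constructor
  · rintro ⟨y, hy, hx⟩
    rw [segment_eq_image'] at hx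
    obtain ⟨t, ht, rfl⟩ := hx
    exact ⟨t, ht, y, hy, rfl⟩
  · rintro ⟨t, ht, y, hy, rfl⟩
    refine ⟨y, hy, ?_⟩
    rw [segment_eq_image']
    exact ⟨t, ht, rfl⟩

theorem inner_eq_of_mem_hull {F : Finset (Pt d)} {z v : Pt d} {c : ℝ}
    (hF : ∀ y ∈ F, inner ℝ v (y - z) = c) {y : Pt d} (hy : y ∈ hull F) :
    inner ℝ v (y - z) = c := by
  have h : hull F ⊆ {y | inner ℝ v y = c + inner ℝ v z} := by
    refine convexHull_min (fun y hy => ?_) ?_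
    · have := hF y hy
      rw [inner_sub_right] at this
      simp only [mem_ofPred_eq]; linarith
    · exact convex_hyperplane (f := fun y => inner ℝ v y) ⟨fun _ _ => inner_add_right _ _ _,
        fun _ _ => by simp [real_inner_smul_right]⟩ _
  have := h hy
  rw [mem_ofPred_eq] at this
  rw [inner_sub_right]; linarith

/-- The volume on a simplex in polar coordinates about the vertex `z`. -/
theorem volume_restrict_cone {F K : Finset (Pt d)} {z v : Pt d}
    (hK : (K : Set (Pt d)) = insert z ↑F) (hne : F.Nonempty) (hv : v ≠ 0)
    (hF : ∀ y ∈ F, inner ℝ v (y - z) = ‖v‖ ^ 2)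
    (hfin : (Measure.euclideanHausdorffMeasure (d - 1) : Measure (Pt d)) (hull F) < ⊤) :
    volume.restrict (hull K) = Measure.map (fun q : ℝ × Pt d => z + q.1 • (q.2 - z))
      (((volume.restrict (Ioo (0 : ℝ) 1)).withDensity
        (fun t => ENNReal.ofReal (‖v‖ * t ^ (d - 1)))).prod
        ((Measure.euclideanHausdorffMeasure (d - 1)).restrict (hull F))) := by
  have hcK : IsCompact (hull K) := K.finite_toSet.isCompact_convexHull ℝ
  have hcF : IsCompact (hull F) := F.finite_toSet.isCompact_convexHull ℝ
  have hv2 : 0 < ‖v‖ ^ 2 := by positivity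
  have : IsFiniteMeasure
      ((Measure.euclideanHausdorffMeasure (d - 1) : Measure (Pt d)).restrict (hull F)) :=
    ⟨by simpa using hfin⟩
  have hmeas : Measurable (fun q : ℝ × Pt d => z + q.1 • (q.2 - z)) := by fun_prop
  ext A hA
  -- Here `v` is the perpendicular from `z` to the plane of `F`. The volume is sliced by the
  -- hyperplanes orthogonal to `v`; the slice of the cone at parameter `t` is the homothetic image
  -- of `F` with ratio `t`, which accounts for the factor `t ^ (d - 1)`, and `‖v‖` converts the
  -- parameter into height.
  rw [Measure.map_apply hmeas hA, Measure.prod_apply (hmeas hA), Measure.restrict_apply hA,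
    lintegral_withDensity_eq_lintegral_mul₀ (by fun_prop)
      (measurable_measure_prodMk_left (hmeas hA)).aemeasurable,
    ← InnerProductSpace.euclideanHausdorffMeasure_eq_volume,
    EuclideanGeometry.euclideanHausdorffMeasure_eq_lintegral z hv
      (hA.inter hcK.measurableSet), ← lintegral_const_mul' _ _ (by simp)]
  have hrank : Module.finrank ℝ (Pt d) = d := by simp
  rw [hrank, ← lintegral_indicator measurableSet_Ioo]
  -- The two end values form a null set: at 0 the homothety degenerates, and the slice at 1 is not
  -- empty although 1 lies outside of the open interval.
  have h01 : ∀ᵐ t : ℝ, t ≠ 0 ∧ t ≠ 1 := by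
    have : ∀ a : ℝ, ∀ᵐ t : ℝ, t ≠ a := fun a => Measure.ae_ne volume a
    filter_upwards [this 0, this 1] with t h0 h1 using ⟨h0, h1⟩
  refine lintegral_congr_ae ?_
  filter_upwards [h01] with t ⟨ht0, ht1⟩
  have hH : ∀ x : Pt d, x ∈ AffineSubspace.mk' (t • v +ᵥ z) (ℝ ∙ v)ᗮ ↔
      inner ℝ v (x - z) = t * ‖v‖ ^ 2 := by
    intro x
    rw [AffineSubspace.mem_mk', Submodule.mem_orthogonal_singleton_iff_inner_right]
    simp only [vsub_eq_sub, vadd_eq_add]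
    rw [show x - (t • v + z) = (x - z) - t • v by abel, inner_sub_right, real_inner_smul_right,
      real_inner_self_eq_norm_sq, sub_eq_zero]
  by_cases ht : t ∈ Ioo (0 : ℝ) 1
  · rw [indicator_of_mem ht]
    have himg : A ∩ hull K ∩ AffineSubspace.mk' (t • v +ᵥ z) (ℝ ∙ v)ᗮ =
        AffineMap.homothety z t ''
          ((Prod.mk t ⁻¹' ((fun q : ℝ × Pt d => z + q.1 • (q.2 - z)) ⁻¹' A)) ∩ hull F) := by
      ext x
      simp only [mem_inter_iff, SetLike.mem_coe, mem_image, mem_preimage,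
        AffineMap.homothety_apply, vsub_eq_sub, vadd_eq_add]
      constructor
      · rintro ⟨⟨hxA, hxK⟩, hx⟩
        obtain ⟨s, hs, y, hy, rfl⟩ := (mem_hull_cone_iff hK hne).1 hxK
        replace hx := (hH _).1 hx
        rw [add_sub_cancel_left, real_inner_smul_right, inner_eq_of_mem_hull hF hy] at hx
        obtain rfl : s = t := mul_right_cancel₀ hv2.ne' hx
        exact ⟨y, ⟨hxA, hy⟩, by abel⟩
      · rintro ⟨y, ⟨hyA, hy⟩, rfl⟩
        rw [add_comm]
        refine ⟨⟨hyA, (mem_hull_cone_iff hK hne).2 ⟨t, ⟨ht.1.le, ht.2.le⟩, y, hy, rfl⟩⟩, (hH _).2 ?_⟩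
        rw [add_sub_cancel_left, real_inner_smul_right, inner_eq_of_mem_hull hF hy]
    rw [himg, euclideanHausdorffMeasure_homothety_image (d - 1) z ht0,
      Pi.mul_apply, Measure.restrict_apply (measurable_prodMk_left (hmeas hA)),
      ENNReal.ofReal_mul (norm_nonneg _), mul_assoc, ENNReal.smul_def, smul_eq_mul]
    congr 2
    · exact (ofReal_norm v).symm
    · rw [ENNReal.ofReal_pow ht.1.le, ENNReal.coe_pow, ← Real.enorm_eq_ofReal ht.1.le]
      rfl
  · rw [indicator_of_notMem ht]
    have : A ∩ hull K ∩ AffineSubspace.mk' (t • v +ᵥ z) (ℝ ∙ v)ᗮ = ∅ := by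
      rw [eq_empty_iff_forall_notMem]
      rintro x ⟨⟨_, hxK⟩, hx⟩
      obtain ⟨s, hs, y, hy, rfl⟩ := (mem_hull_cone_iff hK hne).1 hxK
      have hx := (hH _).1 hx
      rw [add_sub_cancel_left, real_inner_smul_right, inner_eq_of_mem_hull hF hy] at hx
      obtain rfl : s = t := mul_right_cancel₀ hv2.ne' hx
      exact ht ⟨lt_of_le_of_ne hs.1 (Ne.symm ht0), lt_of_le_of_ne hs.2 ht1⟩
    rw [this]; simp

/-- The divergence theorem for the vector field `f(x) (x - z)` on a simplex with vertex `z`. -/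
theorem integral_cone (hd : 1 ≤ d) {F K : Finset (Pt d)} {z v : Pt d}
    (hK : (K : Set (Pt d)) = insert z ↑F) (hne : F.Nonempty) (hv : v ≠ 0)
    (hF : ∀ y ∈ F, inner ℝ v (y - z) = ‖v‖ ^ 2)
    (hfin : (Measure.euclideanHausdorffMeasure (d - 1) : Measure (Pt d)) (hull F) < ⊤)
    {f : Pt d → ℝ} (hf : ContDiff ℝ 1 f) :
    ∫ x in hull K, (fderiv ℝ f x (x - z) + d * f x) = ‖v‖ * faceIntegral F f := by
  have hcF : IsCompact (hull F) := F.finite_toSet.isCompact_convexHull ℝ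
  have hcK : IsCompact (hull K) := K.finite_toSet.isCompact_convexHull ℝ
  have : IsFiniteMeasure
      ((Measure.euclideanHausdorffMeasure (d - 1) : Measure (Pt d)).restrict (hull F)) :=
    ⟨by simpa using hfin⟩
  have hmeas : Measurable (fun q : ℝ × Pt d => z + q.1 • (q.2 - z)) := by fun_prop
  have hgc : Continuous fun x => fderiv ℝ f x (x - z) + d * f x := by
    have := hf.continuous_fderiv (by simp)
    have := hf.continuous
    fun_prop
  have hint : IntegrableOn (fun x => fderiv ℝ f x (x - z) + d * f x) (hull K) :=
    hgc.continuousOn.integrableOn_compact hcK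
  have hcone := volume_restrict_cone hK hne hv hF hfin
  rw [IntegrableOn, hcone, integrable_map_measure hgc.aestronglyMeasurable hmeas.aemeasurable]
    at hint
  simp only [Function.comp_def] at hint
  rw [hcone, integral_map hmeas.aemeasurable hgc.aestronglyMeasurable,
    integral_prod_symm _ hint, faceIntegral, ← integral_const_mul]
  refine integral_congr_ae (ae_of_all _ fun y => ?_)
  beta_reduce
  have hdens : (fun t : ℝ => ENNReal.ofReal (‖v‖ * t ^ (d - 1))) =
      fun t => ((Real.toNNReal (‖v‖ * t ^ (d - 1)) : NNReal) : ENNReal) := rfl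
  rw [hdens, integral_withDensity_eq_integral_smul (by fun_prop),
    ← integral_Ioc_eq_integral_Ioo, ← intervalIntegral.integral_of_le zero_le_one]
  -- On the ray towards `y` the integrand times the density is the derivative of `‖v‖ t ^ d f(z + t
  -- (y - z))`. This primitive vanishes at 0 because `1 ≤ d`, and its value at 1 is the integrand on
  -- the face.
  have hder : ∀ t ∈ uIcc (0 : ℝ) 1, HasDerivAt (fun t : ℝ => ‖v‖ * (t ^ d * f (z + t • (y - z))))
      (‖v‖ * (d * t ^ (d - 1) * f (z + t • (y - z)) +
        t ^ d * fderiv ℝ f (z + t • (y - z)) (y - z))) t := by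
    intro t _
    have h1 : HasDerivAt (fun t : ℝ => z + t • (y - z)) (y - z) t := by
      simpa using ((hasDerivAt_id t).smul_const (y - z)).const_add z
    have h2 := (hf.differentiable (by simp) (z + t • (y - z))).hasFDerivAt.comp_hasDerivAt t h1
    exact ((hasDerivAt_pow d t).mul h2).const_mul _
  have hFTC := intervalIntegral.integral_eq_sub_of_hasDerivAt hder (by
    apply Continuous.intervalIntegrable
    have h3 := hf.continuous_fderiv (by simp)
    have := hf.continuous
    have h4 : Continuous fun t : ℝ => z + t • (y - z) := by fun_prop
    have h5 := h3.comp h4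
    fun_prop)
  rw [show (‖v‖ * f y : ℝ) = ‖v‖ * (1 ^ d * f (z + (1 : ℝ) • (y - z))) -
    ‖v‖ * (0 ^ d * f (z + (0 : ℝ) • (y - z))) by
      rw [zero_pow (by omega)]; simp, ← hFTC]
  refine intervalIntegral.integral_congr fun t ht => ?_
  rw [uIcc_of_le zero_le_one] at ht
  have h0 : 0 ≤ ‖v‖ * t ^ (d - 1) := mul_nonneg (norm_nonneg _) (pow_nonneg ht.1 _)
  obtain ⟨k, rfl⟩ : ∃ k, d = k + 1 := ⟨d - 1, by omega⟩
  rw [Nat.add_sub_cancel] at h0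
  simp only [add_sub_cancel_left, map_smul, NNReal.smul_def, smul_eq_mul,
    Nat.add_sub_cancel, Real.coe_toNNReal _ h0]
  ring

/-! ### Gradients of affine functions -/

/-- The gradient of an affine function. -/
def affGrad (p : Pt d →ᵃ[ℝ] ℝ) : Pt d :=
  (InnerProductSpace.toDual ℝ (Pt d)).symm (LinearMap.toContinuousLinearMap p.linear)

theorem inner_affGrad (p : Pt d →ᵃ[ℝ] ℝ) (w : Pt d) : inner ℝ (affGrad p) w = p.linear w := by
  rw [affGrad, InnerProductSpace.toDual_symm_apply]; rfl

theorem inner_affGrad_sub (p : Pt d →ᵃ[ℝ] ℝ) (x y : Pt d) :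
    inner ℝ (affGrad p) (x - y) = p x - p y := by
  rw [inner_affGrad]; exact p.linearMap_vsub x y

theorem affGrad_unique {p : Pt d →ᵃ[ℝ] ℝ} {g : Pt d} (h : ∀ w, inner ℝ g w = p.linear w) :
    affGrad p = g :=
  ext_inner_right ℝ fun w => by rw [inner_affGrad, h]

theorem affGrad_sub (p q : Pt d →ᵃ[ℝ] ℝ) : affGrad (p - q) = affGrad p - affGrad q :=
  affGrad_unique fun w => by simp [inner_sub_left, inner_affGrad]

theorem affGrad_smul (c : ℝ) (p : Pt d →ᵃ[ℝ] ℝ) : affGrad (c • p) = c • affGrad p :=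
  affGrad_unique fun w => by simp [real_inner_smul_left, inner_affGrad]

theorem hasFDerivAt_affine (p : Pt d →ᵃ[ℝ] ℝ) (x : Pt d) :
    HasFDerivAt p (LinearMap.toContinuousLinearMap p.linear) x := by
  have h := (LinearMap.toContinuousLinearMap p.linear).hasFDerivAt (x := x)
  have e : (p : Pt d → ℝ) = fun y => LinearMap.toContinuousLinearMap p.linear y + p 0 := by
    ext y
    have := congrFun p.decomp y
    simpa using this
  rw [e]
  exact h.add_const _

theorem fderiv_affine (p : Pt d →ᵃ[ℝ] ℝ) (x w : Pt d) :
    fderiv ℝ p x w = inner ℝ (affGrad p) w := by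
  rw [(hasFDerivAt_affine p x).fderiv, inner_affGrad]; rfl

theorem contDiff_affine (p : Pt d →ᵃ[ℝ] ℝ) : ContDiff ℝ ∞ p := by
  have e : (p : Pt d → ℝ) = fun y => LinearMap.toContinuousLinearMap p.linear y + p 0 := by
    ext y
    have := congrFun p.decomp y
    simpa using this
  rw [e]
  exact (LinearMap.toContinuousLinearMap p.linear).contDiff.add contDiff_const

theorem abs_affine_sub_le (p : Pt d →ᵃ[ℝ] ℝ) (x y : Pt d) :
    |p x - p y| ≤ ‖affGrad p‖ * dist x y := by
  rw [← inner_affGrad_sub, dist_eq_norm]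
  exact abs_real_inner_le_norm _ _

/-! ### Integrals over faces -/

/-- The `(d-1)`-dimensional volume of a face. -/
def faceArea (F : Finset (Pt d)) : ℝ :=
  (Measure.euclideanHausdorffMeasure (d - 1) : Measure (Pt d)).real (hull F)

/-- The face of the simplex `K` opposite to the vertex `z`. -/
structure IsFaceOf (F K : Finset (Pt d)) (z : Pt d) : Prop where
  simplex : IsSimplex K
  mem : z ∈ K
  notMem : z ∉ F
  subset : F ⊆ K
  card_eq : F.card = d

namespace IsFaceOf

variable {F K : Finset (Pt d)} {z : Pt d}

theorem mem_iff (h : IsFaceOf F K z) {y : Pt d} : y ∈ K ↔ y = z ∨ y ∈ F := by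
  classical
  have : insert z F = K := by
    refine Finset.eq_of_subset_of_card_le ?_ ?_
    · exact Finset.insert_subset h.mem h.subset
    · rw [Finset.card_insert_of_notMem h.notMem, h.card_eq, h.simplex.card_eq]
  rw [← this, Finset.mem_insert]

theorem coe_eq (h : IsFaceOf F K z) : (K : Set (Pt d)) = insert z ↑F := by
  ext y
  simp only [Finset.mem_coe, mem_insert_iff, h.mem_iff]

theorem indep (h : IsFaceOf F K z)
    : AffineIndependent ℝ ((↑) : F → Pt d) := h.simplex.indep.mono h.subset

theorem measure_lt_top (h : IsFaceOf F K z) :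
    (Measure.euclideanHausdorffMeasure (d - 1) : Measure (Pt d)) (hull F) < ⊤ :=
  measure_face_lt_top h.card_eq h.indep

theorem integrable (h : IsFaceOf F K z) {f : Pt d → ℝ} (hf : Continuous f) :
    IntegrableOn f (hull F) (Measure.euclideanHausdorffMeasure (d - 1)) :=
  integrableOn_face h.card_eq h.indep hf

theorem bary_eq_zero (h : IsFaceOf F K z) {y : Pt d} (hy : y ∈ hull F) : bary K z y = 0 :=
  ((h.simplex.mem_hull_subset_iff h.subset).1 hy).2 z h.mem h.notMem

theorem mem_hull_iff (h : IsFaceOf F K z)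
    {y : Pt d} : y ∈ hull F ↔ y ∈ hull K ∧ bary K z y = 0 := by
  rw [h.simplex.mem_hull_subset_iff h.subset]
  refine and_congr_right fun _ => ⟨fun H => H z h.mem h.notMem, fun H w hw hwF => ?_⟩
  rcases h.mem_iff.1 hw with rfl | hw
  · exact H
  · exact absurd hw hwF

theorem nonempty (h : IsFaceOf F K z)
    (hd : 1 ≤ d) : F.Nonempty := Finset.card_pos.1 (by rw [h.card_eq]; omega)

theorem affGrad_bary_ne_zero (h : IsFaceOf F K z) (hd : 1 ≤ d) : affGrad (bary K z) ≠ 0 := by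
  obtain ⟨y, hy⟩ := h.nonempty hd
  intro h0
  have := inner_affGrad_sub (bary K z) z y
  rw [h0, inner_zero_left, h.simplex.bary_self h.mem, h.bary_eq_zero (mem_hull_of_mem hy)] at this
  norm_num at this

theorem norm_affGrad_bary_pos (h : IsFaceOf F K z) (hd : 1 ≤ d) : 0 < ‖affGrad (bary K z)‖ :=
  norm_pos_iff.2 (h.affGrad_bary_ne_zero hd)

/-- The divergence theorem for the vector field `f(x) (x - z)`. Here `‖∇λ‖⁻¹` is the height of the
simplex. -/
theorem integral_cone (h : IsFaceOf F K z) (hd : 1 ≤ d) {f : Pt d → ℝ} (hf : ContDiff ℝ 1 f) :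
    ∫ x in hull K, (fderiv ℝ f x (x - z) + d * f x) =
      ‖affGrad (bary K z)‖⁻¹ * faceIntegral F f := by
  have hg := h.norm_affGrad_bary_pos hd
  set g := affGrad (bary K z) with hgdef
  -- The perpendicular from `z` to the plane of `F` is `-∇λ / ‖∇λ‖ ^ 2`, since `λ` decreases from 1
  -- to 0 along it.
  have hv : ‖(-(‖g‖ ^ 2)⁻¹) • g‖ = ‖g‖⁻¹ := by
    rw [norm_smul, norm_neg, norm_inv, norm_pow, norm_norm]; field_simp
  rw [← hv]
  refine CRMethod.integral_cone hd h.coe_eq (h.nonempty hd) ?_ (fun y hy => ?_) h.measure_lt_top hf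
  · rw [← norm_pos_iff, hv]; positivity
  · rw [hv, real_inner_smul_left, inner_affGrad_sub, h.bary_eq_zero (mem_hull_of_mem hy),
      h.simplex.bary_self h.mem]
    field_simp; norm_num

/-- The cone formula with `f = 1` reads `d` times volume equals height times area, so positivity is
inherited from the volume of `K`. -/
theorem faceArea_pos (h : IsFaceOf F K z) (hd : 1 ≤ d) : 0 < faceArea F := by
  have h1 := h.integral_cone hd (f := fun _ => 1) contDiff_const
  have hg := h.norm_affGrad_bary_pos hd
  have hvol : 0 < volume.real (hull K) := by
    refine ENNReal.toReal_pos (ne_of_gt ?_) (isCompact_hull K).measure_lt_top.ne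
    exact lt_of_lt_of_le (isOpen_interior.measure_pos volume h.simplex.exists_mem_interior)
      (measure_mono interior_subset)
  have hlhs : ∫ x in hull K, (fderiv ℝ (fun _ : Pt d => (1 : ℝ)) x (x - z) + d * (1 : ℝ)) =
      volume.real (hull K) * d := by simp
  have hrhs : faceIntegral F (fun _ => (1 : ℝ)) = faceArea F := by simp [faceIntegral, faceArea]
  rw [hlhs, hrhs] at h1
  have h2 : 0 < ‖affGrad (bary K z)‖⁻¹ * faceArea F := by
    rw [← h1]
    have : (0 : ℝ) < d := by exact_mod_cast hd
    positivity
  exact (pos_iff_pos_of_mul_pos h2).1 (by positivity)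

theorem abs_faceIntegral_le (h : IsFaceOf F K z)
    {f : Pt d → ℝ} {m : ℝ} (hf : ∀ y ∈ hull F, |f y| ≤ m) :
    |faceIntegral F f| ≤ m * faceArea F := by
  exact norm_setIntegral_le_of_norm_le_const (f := f) (C := m) h.measure_lt_top hf

/-- A lower bound for the integral of a function that is bounded from below on a scaled copy of
the face. -/
theorem le_faceIntegral (h : IsFaceOf F K z)
    {f : Pt d → ℝ} (hf : Continuous f) (h0 : ∀ y ∈ hull F, 0 ≤ f y)
    {x : Pt d} (hx : x ∈ hull F) {t m : ℝ} (ht : t ∈ Ioc (0 : ℝ) 1)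
    (hm : ∀ y ∈ hull F, m ≤ f (x + t • (y - x))) :
    m * (t ^ (d - 1) * faceArea F) ≤ faceIntegral F f := by
  set A := AffineMap.homothety x t '' hull F with hA
  have happ : ∀ y, AffineMap.homothety x t y = x + t • (y - x) := fun y => by
    rw [AffineMap.homothety_apply]; simp [add_comm]
  have hAF : A ⊆ hull F := by
    rintro _ ⟨y, hy, rfl⟩
    rw [happ]
    exact (convex_convexHull ℝ _).add_smul_sub_mem hx hy ⟨ht.1.le, ht.2⟩
  have hcA : IsCompact A := (isCompact_hull F).image (by
    simp_rw [funext happ]; fun_prop)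
  have harea : (Measure.euclideanHausdorffMeasure (d - 1) : Measure (Pt d)).real A =
      t ^ (d - 1) * faceArea F := by
    rw [Measure.real, hA, euclideanHausdorffMeasure_homothety_image _ _ ht.1.ne', faceArea,
      Measure.real, ENNReal.smul_def, smul_eq_mul, ENNReal.toReal_mul]
    simp [abs_of_pos ht.1]
  have hfinA : (Measure.euclideanHausdorffMeasure (d - 1) : Measure (Pt d)) A < ⊤ :=
    (measure_mono hAF).trans_lt h.measure_lt_top
  calc m * (t ^ (d - 1) * faceArea F)
      = ∫ _ in A, m ∂(Measure.euclideanHausdorffMeasure (d - 1)) := by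
        rw [setIntegral_const, harea, smul_eq_mul, mul_comm]
    _ ≤ ∫ y in A, f y ∂(Measure.euclideanHausdorffMeasure (d - 1)) := by
        refine setIntegral_mono_on (integrableOn_const hfinA.ne)
          ((h.integrable hf).mono_set hAF) hcA.measurableSet ?_
        rintro _ ⟨y, hy, rfl⟩
        rw [happ]; exact hm y hy
    _ ≤ faceIntegral F f := by
        refine setIntegral_mono_set (h.integrable hf) ?_ hAF.eventuallyLE
        exact ae_restrict_of_forall_mem (isClosed_hull F).measurableSet h0

/-- By continuity `f` exceeds half of its value in `x` on a small homothetic copy of the face about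
`x`, and this copy has positive area. -/
theorem faceIntegral_pos (h : IsFaceOf F K z) (hd : 1 ≤ d) {f : Pt d → ℝ} (hf : Continuous f)
    (h0 : ∀ y ∈ hull F, 0 ≤ f y) {x : Pt d} (hx : x ∈ hull F) (hfx : 0 < f x) :
    0 < faceIntegral F f := by
  obtain ⟨R, hR⟩ := (isCompact_hull F).isBounded.subset_closedBall x
  obtain ⟨ε, hε, hball⟩ := Metric.continuousAt_iff.1 hf.continuousAt (f x / 2) (by positivity)
  have hR0 : 0 ≤ R := by simpa using hR hx
  set t := min 1 (ε / (2 * (R + 1))) with ht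
  have htpos : 0 < t := lt_min one_pos (by positivity)
  have key := h.le_faceIntegral hf h0 hx (t := t) (m := f x / 2) ⟨htpos, min_le_left _ _⟩
    (fun y hy => by
      have h1 : dist (x + t • (y - x)) x < ε := by
        rw [dist_eq_norm, add_sub_cancel_left, norm_smul, Real.norm_of_nonneg htpos.le]
        have h2 : ‖y - x‖ ≤ R := by simpa [dist_eq_norm] using hR hy
        calc t * ‖y - x‖ ≤ ε / (2 * (R + 1)) * (R + 1) := by
              gcongr
              · exact min_le_right _ _
              · linarith
          _ = ε / 2 := by field_simp
          _ < ε := by linarith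
      have h3 := hball h1
      rw [Real.dist_eq, abs_lt] at h3
      linarith [h3.1])
  have := h.faceArea_pos hd
  exact lt_of_lt_of_le (by positivity) key

/-- An affine function whose mean value on a face vanishes is controlled by its gradient. -/
theorem abs_le_of_faceIntegral_eq_zero (h : IsFaceOf F K z) (hd : 1 ≤ d) {p : Pt d →ᵃ[ℝ] ℝ}
    (hp : faceIntegral F p = 0) {x : Pt d} (hx : x ∈ hull F) :
    |p x| ≤ ‖affGrad p‖ * Metric.diam (hull F) := by
  have hc : Continuous p := AffineMap.continuous_real p
  have hlow : ∀ y ∈ hull F, |p x - p y| ≤ ‖affGrad p‖ * Metric.diam (hull F) := fun y hy =>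
    (abs_affine_sub_le p x y).trans (by
      gcongr; exact Metric.dist_le_diam_of_mem (isCompact_hull F).isBounded hx hy)
  -- If `|p x|` exceeded the oscillation of `p` on the face, then `p` would have a strict sign
  -- there, contrary to the vanishing mean value.
  by_contra hlt
  push Not at hlt
  rcases le_total 0 (p x) with h0 | h0
  · rw [abs_of_nonneg h0] at hlt
    have hy : ∀ y ∈ hull F, 0 < p y := fun y hy => by
      have := (abs_le.1 (hlow y hy)).2; linarith
    exact (h.faceIntegral_pos hd hc (fun y hy' => (hy y hy').le) hx (hy x hx)).ne' hp
  · rw [abs_of_nonpos h0] at hlt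
    have hy : ∀ y ∈ hull F, 0 < -p y := fun y hy => by
      have := (abs_le.1 (hlow y hy)).1; linarith
    have := h.faceIntegral_pos hd hc.neg (fun y hy' => (hy y hy').le) hx (hy x hx)
    have hn : faceIntegral F (fun y => -p y) = 0 := by
      rw [faceIntegral, integral_neg]; simpa [faceIntegral] using hp
    exact this.ne' hn

theorem eq_zero_of_faceIntegral_sq_eq_zero (h : IsFaceOf F K z)
    (hd : 1 ≤ d) {f : Pt d → ℝ} (hf : Continuous f)
    (hp : faceIntegral F (fun y => f y * f y) = 0) {x : Pt d} (hx : x ∈ hull F) : f x = 0 := by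
  by_contra hne
  exact (h.faceIntegral_pos hd (hf.mul hf) (fun y _ => mul_self_nonneg _) hx
    (mul_self_pos.2 hne)).ne' hp

/-- A scaled copy of the face on which all barycentric coordinates are bounded from below. -/
theorem le_faceIntegral_prod_bary (h : IsFaceOf F K z) (hd : 1 ≤ d) :
    (1 / (2 * d) : ℝ) ^ d * ((1 / 2) ^ (d - 1) * faceArea F) ≤
      faceIntegral F (fun y => ∏ w ∈ F, bary K w y) := by
  have hd0 : (0 : ℝ) < d := by exact_mod_cast hd
  -- On the copy of `F` shrunk by one half about the centroid `c`, whose coordinates are all `1 /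
  -- d`, every coordinate is at least `1 / (2 * d)`.
  set c : Pt d := ∑ w ∈ F, (1 / d : ℝ) • w with hc
  have hcF : c ∈ hull F := (convex_convexHull ℝ _).sum_mem (fun _ _ => by positivity)
    (by rw [Finset.sum_const, h.card_eq]; simp [hd0.ne']) (fun w hw => mem_hull_of_mem hw)
  have hbc : ∀ w ∈ F, bary K w c = 1 / d := by
    intro w hw
    have h1 : ∑ u ∈ F, (1 / d : ℝ) = 1 := by rw [Finset.sum_const, h.card_eq]; simp [hd0.ne']
    have h3 : ∀ u, bary K w u = (bary K w).linear u + bary K w 0 := fun u => by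
      simpa using congrFun (bary K w).decomp u
    have h4 : bary K w c = ∑ u ∈ F, (1 / d : ℝ) * bary K w u := by
      rw [Finset.sum_congr rfl fun u _ => by rw [h3 u], h3 c, hc, map_sum]
      simp_rw [map_smul, smul_eq_mul, mul_add, Finset.sum_add_distrib, ← Finset.sum_mul]
      rw [h1, one_mul]
    rw [h4, Finset.sum_eq_single_of_mem w hw]
    · rw [h.simplex.bary_self (h.subset hw), mul_one]
    · intro u hu huw
      rw [h.simplex.bary_ne (h.subset hu) huw, mul_zero]
  have hcont : Continuous fun y => ∏ w ∈ F, bary K w y :=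
    continuous_finsetProd _ fun w _ => AffineMap.continuous_real _
  refine h.le_faceIntegral hcont
    (fun y hy => Finset.prod_nonneg fun w _ => h.simplex.bary_nonneg (hull_mono h.subset hy) w)
    hcF (by constructor <;> norm_num) fun y hy => ?_
  have hprod : (1 / (2 * d) : ℝ) ^ d = ∏ _w ∈ F, (1 / (2 * d) : ℝ) := by
    rw [Finset.prod_const, h.card_eq]
  rw [hprod]
  refine Finset.prod_le_prod (fun _ _ => by positivity) fun w hw => ?_
  have hb : bary K w (c + (1 / 2 : ℝ) • (y - c)) = 1 / 2 * bary K w c + 1 / 2 * bary K w y := by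
    have h1 := inner_affGrad_sub (bary K w) (c + (1 / 2 : ℝ) • (y - c)) c
    have h2 := inner_affGrad_sub (bary K w) y c
    rw [add_sub_cancel_left, real_inner_smul_right, h2] at h1
    linarith
  rw [hb, hbc w hw]
  have := h.simplex.bary_nonneg (hull_mono h.subset hy) w
  have e : (1 / (2 * d) : ℝ) = 1 / 2 * (1 / d) := by field_simp
  rw [e]
  linarith

end IsFaceOf

open Classical in
theorem IsSimplex.isFaceOf_erase {K : Finset (Pt d)} (hK : IsSimplex K) {z : Pt d} (hz : z ∈ K) :
    IsFaceOf (K.erase z) K z where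
  simplex := hK
  mem := hz
  notMem := Finset.notMem_erase z K
  subset := Finset.erase_subset z K
  card_eq := by rw [Finset.card_erase_of_mem hz, hK.card_eq]; simp

open Classical in
theorem IsFaceOf.eq_erase {F K : Finset (Pt d)} {z : Pt d} (h : IsFaceOf F K z) :
    F = K.erase z := by
  ext y
  rw [Finset.mem_erase, h.mem_iff]
  constructor
  · intro hy
    exact ⟨by rintro rfl; exact h.notMem hy, Or.inr hy⟩
  · rintro ⟨h1, h2 | h2⟩
    · exact absurd h2 h1
    · exact h2

open Classical in
theorem IsSimplex.exists_isFaceOf {F K : Finset (Pt d)} (hK : IsSimplex K) (hF : F ⊆ K)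
    (hc : F.card = d) : ∃ z, IsFaceOf F K z := by
  obtain ⟨z, hzK, hzF⟩ := Finset.exists_of_ssubset
    (Finset.ssubset_iff_subset_ne.2 ⟨hF, by rintro rfl; have := hK.card_eq; omega⟩)
  exact ⟨z, hK, hzK, hzF, hF, hc⟩

open Classical in
/-- The divergence theorem on a simplex. The outer unit normal of the face opposite to `z` is
`-‖∇λ_z‖⁻¹ ∇λ_z`. -/
theorem IsSimplex.integral_fderiv {K : Finset (Pt d)} (hK : IsSimplex K) (hd : 1 ≤ d)
    {f : Pt d → ℝ} (hf : ContDiff ℝ 1 f) (w : Pt d) :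
    ∫ x in hull K, fderiv ℝ f x w = ∑ z ∈ K, -(inner ℝ (affGrad (bary K z)) w *
      (‖affGrad (bary K z)‖⁻¹ * faceIntegral (K.erase z) f)) := by
  -- Together `h1` and `h2` express the constant field `w` as the combination of the fields `x - z`
  -- with coefficients `-∂_w λ_z`, for which the cone formula is available.
  have h1 : ∑ z ∈ K, inner ℝ (affGrad (bary K z)) w = 0 := by
    have e : ∀ z, inner ℝ (affGrad (bary K z)) w = bary K z w - bary K z 0 := fun z => by
      rw [← inner_affGrad_sub, sub_zero]
    simp_rw [e]
    rw [Finset.sum_sub_distrib, hK.sum_bary, hK.sum_bary, sub_self]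
  have h2 : ∑ z ∈ K, inner ℝ (affGrad (bary K z)) w • z = w := by
    have e : ∀ z, inner ℝ (affGrad (bary K z)) w = bary K z w - bary K z 0 := fun z => by
      rw [← inner_affGrad_sub, sub_zero]
    simp_rw [e, sub_smul]
    rw [Finset.sum_sub_distrib, hK.sum_bary_smul, hK.sum_bary_smul, sub_zero]
  have hgc : ∀ z, Continuous fun x => fderiv ℝ f x (x - z) + d * f x := fun z => by
    have := hf.continuous_fderiv (by simp)
    have := hf.continuous
    fun_prop
  calc ∫ x in hull K, fderiv ℝ f x w
      = ∫ x in hull K, ∑ z ∈ K, -(inner ℝ (affGrad (bary K z)) w *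
          (fderiv ℝ f x (x - z) + d * f x)) := by
        congr 1
        ext x
        have h3 : ∑ z ∈ K, inner ℝ (affGrad (bary K z)) w * fderiv ℝ f x (x - z) =
            -fderiv ℝ f x w := by
          conv_rhs => rw [← h2, map_sum]
          simp_rw [map_sub, mul_sub, Finset.sum_sub_distrib, ← Finset.sum_mul, h1, map_smul,
            smul_eq_mul]
          ring
        simp_rw [mul_add, Finset.sum_neg_distrib, Finset.sum_add_distrib, h3, ← Finset.sum_mul,
          h1]
        ring
    _ = _ := by
        rw [integral_finsetSum]
        · refine Finset.sum_congr rfl fun z hz => ?_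
          rw [integral_neg, integral_const_mul, (hK.isFaceOf_erase hz).integral_cone hd hf]
        · intro z _
          exact (((hgc z).const_mul _).neg.continuousOn).integrableOn_compact (isCompact_hull K)

/-! ### Topology of domains and meshes -/

theorem affine_add_smul_sub (p : Pt d →ᵃ[ℝ] ℝ) (a b : Pt d) (t : ℝ) :
    p (a + t • (b - a)) = p a + t * (p b - p a) := by
  have h1 := inner_affGrad_sub p (a + t • (b - a)) a
  rw [add_sub_cancel_left, real_inner_smul_right, inner_affGrad_sub] at h1
  linarith

/-- From a boundary point a small step against `e` leads strictly below the graph, where a whole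
neighbourhood misses `Ω`. So no boundary point is interior to the closure. -/
theorem HasLipschitzBoundary.interior_closure_subset {Ω : Set (Pt d)} (ho : IsOpen Ω)
    (hL : HasLipschitzBoundary Ω) : interior (closure Ω) ⊆ Ω := by
  intro x hx
  by_contra hxΩ
  have hxf : x ∈ frontier Ω := ⟨interior_subset hx, by rwa [ho.interior_eq]⟩
  obtain ⟨e, he, L, g, hg, r, hr, H⟩ := hL x hxf
  have hex : inner ℝ e x ≤ g (x - inner ℝ e x • e) := by
    by_contra hlt
    exact hxΩ ((H x (Metric.mem_ball_self hr)).2 (not_le.1 hlt))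
  have hee : inner ℝ e e = (1 : ℝ) := by rw [real_inner_self_eq_norm_sq, he]; norm_num
  set N : Set (Pt d) := {y | inner ℝ e y < g (y - inner ℝ e y • e)} with hN
  have hNo : IsOpen N := by
    have hgc := hg.continuous
    exact isOpen_lt (by fun_prop) (by fun_prop)
  obtain ⟨δ, hδ, hball⟩ := Metric.isOpen_iff.1 isOpen_interior x hx
  set t := min δ r / 2 with ht
  have htpos : 0 < t := by positivity
  have htδ : t < δ := (half_lt_self (by positivity)).trans_le (min_le_left _ _)
  have htr : t < r := (half_lt_self (by positivity)).trans_le (min_le_right _ _)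
  have hdist : dist (x - t • e) x = t := by
    rw [dist_eq_norm]; simp [norm_smul, he, abs_of_pos htpos]
  have h1 : x - t • e ∈ closure Ω := interior_subset (hball (by rw [Metric.mem_ball, hdist]; exact htδ))
  have h2 : x - t • e ∈ N := by
    have e1 : inner ℝ e (x - t • e) = inner ℝ e x - t := by
      rw [inner_sub_right, real_inner_smul_right, hee, mul_one]
    have e2 : x - t • e - inner ℝ e (x - t • e) • e = x - inner ℝ e x • e := by
      rw [e1, sub_smul]; abel
    simp only [hN, mem_ofPred_eq]
    rw [e2, e1]; linarith
  obtain ⟨y, ⟨hyN, hyB⟩, hyΩ⟩ := mem_closure_iff.1 h1 (N ∩ Metric.ball x r)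
    (hNo.inter Metric.isOpen_ball) ⟨h2, by rw [Metric.mem_ball, hdist]; exact htr⟩
  exact lt_asymm ((H y hyB).1 hyΩ) hyN

theorem IsLipschitzDomain.interior_closure_subset {Ω : Set (Pt d)} (h : IsLipschitzDomain Ω) :
    interior (closure Ω) ⊆ Ω := h.lipschitz.interior_closure_subset h.isOpen

namespace IsFaceOf

variable {F K K' : Finset (Pt d)} {z z' : Pt d}

/-- There are points in the relative interior of a face. -/
theorem exists_relint (h : IsFaceOf F K z) (hd : 1 ≤ d) :
    ∃ y ∈ hull F, ∀ w ∈ F, 0 < bary K w y := by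
  by_contra! hcon
  have h1 := h.le_faceIntegral_prod_bary hd
  have h2 := h.faceArea_pos hd
  have hd0 : (0 : ℝ) < d := by exact_mod_cast hd
  -- If every point of the face had a vanishing coordinate, the product would vanish on the face,
  -- against its positive integral.
  have h3 : faceIntegral F (fun y => ∏ w ∈ F, bary K w y) = 0 := by
    refine setIntegral_eq_zero_of_forall_eq_zero fun y hy => ?_
    obtain ⟨w, hw, hle⟩ := hcon y hy
    exact Finset.prod_eq_zero hw
      (le_antisymm hle (h.simplex.bary_nonneg (hull_mono h.subset hy) w))
  rw [h3] at h1
  have : 0 < (1 / (2 * d) : ℝ) ^ d * ((1 / 2) ^ (d - 1) * faceArea F) := by positivity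
  linarith

/-- The barycentric coordinates of two simplices that vanish on a common face are proportional. -/
theorem bary_eq_smul (h : IsFaceOf F K z) (h' : IsFaceOf F K' z') :
    bary K z = bary K z z' • bary K' z' := by
  refine h'.simplex.affine_ext fun y hy => ?_
  rw [AffineMap.coe_smul, Pi.smul_apply, smul_eq_mul]
  rcases h'.mem_iff.1 hy with rfl | hyF
  · rw [h'.simplex.bary_self hy, mul_one]
  · rw [h.bary_eq_zero (mem_hull_of_mem hyF), h'.bary_eq_zero (mem_hull_of_mem hyF), mul_zero]

theorem bary_opposite_ne_zero (h : IsFaceOf F K z) (h' : IsFaceOf F K' z') :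
    bary K z z' ≠ 0 := by
  intro h0
  have := h.bary_eq_smul h'
  rw [h0, zero_smul] at this
  have h1 := h.simplex.bary_self h.mem
  rw [this] at h1
  simp at h1

/-- The unit normals of two simplices on opposite sides of a face. -/
theorem normal_eq_neg (hd : 1 ≤ d) (h : IsFaceOf F K z) (h' : IsFaceOf F K' z')
    (hneg : bary K z z' < 0) :
    ‖affGrad (bary K z)‖⁻¹ • affGrad (bary K z) =
      -(‖affGrad (bary K' z')‖⁻¹ • affGrad (bary K' z')) := by
  have hp := h'.norm_affGrad_bary_pos hd
  rw [h.bary_eq_smul h', affGrad_smul, norm_smul, Real.norm_of_nonpos hneg.le, smul_smul,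
    ← neg_smul]
  have hne := hneg.ne
  congr 1
  field_simp

end IsFaceOf

namespace Mesh

variable {Ω : Set (Pt d)} (M : Mesh Ω)

theorem hull_subset_closure {K : Finset (Pt d)} (hK : K ∈ M.elems) : hull K ⊆ closure Ω := by
  rw [M.cover]
  exact subset_biUnion_of_mem (u := fun K : Finset (Pt d) => hull K) hK

theorem exists_mem_hull {x : Pt d} (hx : x ∈ closure Ω) : ∃ K ∈ M.elems, x ∈ hull K := by
  rw [M.cover] at hx
  simpa using hx

theorem interior_hull_subset (hΩ : IsLipschitzDomain Ω) {K : Finset (Pt d)} (hK : K ∈ M.elems) :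
    interior (hull K) ⊆ Ω :=
  (interior_mono (M.hull_subset_closure hK)).trans hΩ.interior_closure_subset

/-- Face-to-face meshes put `x` into the hull of the common vertices, where two affine functions
agree as soon as they agree in these vertices. This makes the hat functions well defined and
continuous across elements. -/
theorem bary_eq_bary {K K' : Finset (Pt d)} (hK : K ∈ M.elems) (hK' : K' ∈ M.elems) (z : Pt d)
    {x : Pt d} (hx : x ∈ hull K) (hx' : x ∈ hull K') : bary K z x = bary K' z x := by
  classical
  have h : x ∈ hull (K ∩ K') := by
    have := M.inter K hK K' hK'
    rw [hull, Finset.coe_inter, ← this]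
    exact ⟨hx, hx'⟩
  refine eq_of_mem_hull _ _ (fun y hy => ?_) h
  rw [Finset.mem_inter] at hy
  rw [(M.isSimplex hK).bary_vertex z hy.1, (M.isSimplex hK').bary_vertex z hy.2]

theorem hat_eq {K : Finset (Pt d)} (hK : K ∈ M.elems) (z : Pt d) {x : Pt d} (hx : x ∈ hull K) :
    M.hat z x = bary K z x := by
  have h : ∃ K ∈ M.elems, x ∈ hull K := ⟨K, hK, hx⟩
  rw [hat, dif_pos h]
  exact M.bary_eq_bary h.choose_spec.1 hK z h.choose_spec.2 hx

theorem hat_eq_zero {x : Pt d} (hx : x ∉ closure Ω) (z : Pt d) : M.hat z x = 0 := by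
  rw [hat, dif_neg]
  rintro ⟨K, hK, hxK⟩
  exact hx (M.hull_subset_closure hK hxK)

theorem mem_of_bary_pos {K K' : Finset (Pt d)} (hK : K ∈ M.elems) (hK' : K' ∈ M.elems) {z x : Pt d}
    (hx : x ∈ hull K) (hx' : x ∈ hull K') (hz : 0 < bary K z x) : z ∈ K' := by
  by_contra hzK
  rw [M.bary_eq_bary hK hK' z hx hx', (M.isSimplex hK').bary_of_notMem hzK] at hz
  exact lt_irrefl _ hz

theorem mem_of_mem_hull {K K' : Finset (Pt d)} (hK : K ∈ M.elems) (hK' : K' ∈ M.elems) {z : Pt d}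
    (hz : z ∈ K) (hz' : z ∈ hull K') : z ∈ K' :=
  M.mem_of_bary_pos hK hK' (mem_hull_of_mem hz) hz' (by rw [(M.isSimplex hK).bary_self hz]; norm_num)

theorem eq_of_mem_interior {K K' : Finset (Pt d)} (hK : K ∈ M.elems) (hK' : K' ∈ M.elems)
    {x : Pt d} (hx : x ∈ interior (hull K)) (hx' : x ∈ hull K') : K = K' :=
  Finset.eq_of_subset_of_card_le
    (fun _ hz => M.mem_of_bary_pos hK hK' (interior_subset hx) hx'
      ((M.isSimplex hK).mem_interior_iff.1 hx _ hz))
    (by rw [M.card_eq K hK, M.card_eq K' hK'])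

/-- Two elements that share a face lie on opposite sides of it. -/
theorem bary_opposite_neg (hd : 1 ≤ d) {F K K' : Finset (Pt d)} {z z' : Pt d} (hK : K ∈ M.elems)
    (hK' : K' ∈ M.elems) (hne : K ≠ K') (h : IsFaceOf F K z) (h' : IsFaceOf F K' z') :
    bary K z z' < 0 := by
  by_contra hge
  have hpos : 0 < bary K z z' := lt_of_le_of_ne (not_lt.1 hge) (h.bary_opposite_ne_zero h').symm
  obtain ⟨y, hy, hyp⟩ := h.exists_relint hd
  have hyK := hull_mono h.subset hy
  have hyK' := hull_mono h'.subset hy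
  have hline : Continuous fun t : ℝ => y + t • (z - y) := by fun_prop
  -- If both opposite vertices were on the same side, a short move from the relative interior of `F`
  -- towards `z` would enter the interiors of both elements.
  have ev : ∀ᶠ t in nhdsWithin (0 : ℝ) (Ioi 0), (∀ w ∈ F, 0 < bary K w (y + t • (z - y))) ∧
      ∀ w ∈ F, 0 < bary K' w (y + t • (z - y)) := by
    refine Filter.Eventually.filter_mono nhdsWithin_le_nhds (Filter.Eventually.and ?_ ?_)
    · refine (Finset.eventually_all F).2 fun w hw => ?_
      refine (((AffineMap.continuous_real (bary K w)).comp hline).continuousAt).eventually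
        (lt_mem_nhds ?_)
      simpa using hyp w hw
    · refine (Finset.eventually_all F).2 fun w hw => ?_
      refine (((AffineMap.continuous_real (bary K' w)).comp hline).continuousAt).eventually
        (lt_mem_nhds ?_)
      simpa [← M.bary_eq_bary hK hK' w hyK hyK'] using hyp w hw
  obtain ⟨t, ⟨h1, h2⟩, ht⟩ := (ev.and self_mem_nhdsWithin).exists
  have ht : 0 < t := ht
  have hz : 0 < bary K z (y + t • (z - y)) := by
    rw [affine_add_smul_sub, h.bary_eq_zero hy, h.simplex.bary_self h.mem]; linarith
  have hz' : 0 < bary K' z' (y + t • (z - y)) := by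
    rw [h.bary_eq_smul h', AffineMap.coe_smul, Pi.smul_apply, smul_eq_mul] at hz
    exact (pos_iff_pos_of_mul_pos hz).1 hpos
  refine hne (M.eq_of_mem_interior hK hK' (x := y + t • (z - y)) ?_ (interior_subset (?_)))
  · rw [h.simplex.mem_interior_iff]
    intro w hw
    rcases h.mem_iff.1 hw with rfl | hw
    exacts [hz, h1 w hw]
  · rw [h'.simplex.mem_interior_iff]
    intro w hw
    rcases h'.mem_iff.1 hw with rfl | hw
    exacts [hz', h2 w hw]

/-- The relative interior of a face that is shared by two elements belongs to the domain. -/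
theorem relint_subset (hΩ : IsLipschitzDomain Ω) (hd : 1 ≤ d) {F K K' : Finset (Pt d)}
    {z z' : Pt d} (hK : K ∈ M.elems) (hK' : K' ∈ M.elems) (hne : K ≠ K') (h : IsFaceOf F K z)
    (h' : IsFaceOf F K' z') {y : Pt d} (hy : y ∈ hull F) (hyp : ∀ w ∈ F, 0 < bary K w y) :
    y ∈ Ω := by
  have hneg := M.bary_opposite_neg hd hK hK' hne h h'
  refine hΩ.interior_closure_subset (mem_interior_iff_mem_nhds.2 ?_)
  have ev : ∀ᶠ x in nhds y, (∀ w ∈ F, 0 < bary K w x) ∧ ∀ w ∈ F, 0 < bary K' w x := by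
    refine Filter.Eventually.and ?_ ?_
    · exact (Finset.eventually_all F).2 fun w hw =>
        (AffineMap.continuous_real (bary K w)).continuousAt.eventually (lt_mem_nhds (hyp w hw))
    · refine (Finset.eventually_all F).2 fun w hw =>
        (AffineMap.continuous_real (bary K' w)).continuousAt.eventually (lt_mem_nhds ?_)
      rw [← M.bary_eq_bary hK hK' w (hull_mono h.subset hy) (hull_mono h'.subset hy)]
      exact hyp w hw
  filter_upwards [ev] with x ⟨h1, h2⟩
  -- Near `y` the coordinates of the vertices of `F` are positive for both elements, so the side of
  -- the plane of `F` decides which element contains `x`.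
  rcases le_total 0 (bary K z x) with h0 | h0
  · refine M.hull_subset_closure hK (h.simplex.mem_hull_iff.2 fun w hw => ?_)
    rcases h.mem_iff.1 hw with rfl | hw
    exacts [h0, (h1 w hw).le]
  · refine M.hull_subset_closure hK' (h'.simplex.mem_hull_iff.2 fun w hw => ?_)
    rcases h'.mem_iff.1 hw with rfl | hw
    · rw [h.bary_eq_smul h', AffineMap.coe_smul, Pi.smul_apply, smul_eq_mul] at h0
      by_contra hlt
      have := mul_pos_of_neg_of_neg hneg (not_le.1 hlt)
      linarith
    · exact (h2 w hw).le

theorem mem_faces_iff {F : Finset (Pt d)} :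
    F ∈ M.faces ↔ ∃ K ∈ M.elems, F ⊆ K ∧ F.card = d := by
  simp [faces, Finset.mem_biUnion, Finset.mem_powersetCard]

theorem mem_faces_of_isFaceOf {F K : Finset (Pt d)} {z : Pt d} (hK : K ∈ M.elems)
    (h : IsFaceOf F K z) : F ∈ M.faces := M.mem_faces_iff.2 ⟨K, hK, h.subset, h.card_eq⟩

/-- A face that is not a boundary face is shared by two elements. -/
theorem exists_neighbour (hΩ : IsLipschitzDomain Ω) (hd : 1 ≤ d) {F K : Finset (Pt d)} {z : Pt d}
    (hK : K ∈ M.elems) (h : IsFaceOf F K z) (hF : ¬ M.IsBoundaryFace F) :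
    ∃ K' ∈ M.elems, K ≠ K' ∧ F ⊆ K' := by
  by_contra! hcon
  apply hF
  -- Without a second element at `F`, a point of the relative interior of `F` has a neighbourhood
  -- that meets no element but `K`. If it were in `Ω`, it would be interior to `K`, although the
  -- opposite coordinate vanishes there. The whole face follows since the frontier is closed.
  have key : ∀ y ∈ hull F, (∀ w ∈ F, 0 < bary K w y) → y ∈ frontier Ω := by
    intro y hy hyp
    have hyK := hull_mono h.subset hy
    refine ⟨M.hull_subset_closure hK hyK, fun hyi => ?_⟩
    rw [hΩ.isOpen.interior_eq] at hyi
    have ev : ∀ᶠ x in nhds y, ∀ K' ∈ M.elems, x ∈ hull K' → K' = K := by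
      refine (Finset.eventually_all M.elems).2 fun K' hK' => ?_
      rcases eq_or_ne K K' with rfl | hne
      · exact Filter.Eventually.of_forall fun _ _ => rfl
      have hyK' : y ∉ hull K' := fun hyK' => hcon K' hK' hne fun w hw =>
        M.mem_of_bary_pos hK hK' hyK hyK' (hyp w hw)
      filter_upwards [(isClosed_hull K').isOpen_compl.mem_nhds hyK'] with x hx hx'
      exact absurd hx' hx
    have hnhds : hull K ∈ nhds y := by
      filter_upwards [ev, hΩ.isOpen.mem_nhds hyi] with x hx hxΩ
      obtain ⟨K', hK', hxK'⟩ := M.exists_mem_hull (subset_closure hxΩ)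
      rw [← hx K' hK' hxK']; exact hxK'
    have := h.simplex.mem_interior_iff.1 (mem_interior_iff_mem_nhds.2 hnhds) z h.mem
    rw [h.bary_eq_zero hy] at this
    exact lt_irrefl _ this
  intro x hx
  obtain ⟨y, hy, hyp⟩ := h.exists_relint hd
  have hlim : Filter.Tendsto (fun t : ℝ => x + t • (y - x)) (nhdsWithin 0 (Ioi 0)) (nhds x) := by
    have : Continuous fun t : ℝ => x + t • (y - x) := by fun_prop
    have h0 := this.tendsto 0
    simp only [zero_smul, add_zero] at h0
    exact h0.mono_left nhdsWithin_le_nhds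
  refine isClosed_frontier.mem_of_tendsto hlim ?_
  filter_upwards [Ioo_mem_nhdsGT (show (0 : ℝ) < 1 by norm_num)] with t ht
  refine key _ ((convex_convexHull ℝ _).add_smul_sub_mem hx hy ⟨ht.1.le, ht.2.le⟩) fun w hw => ?_
  rw [affine_add_smul_sub]
  have h1 := h.simplex.bary_nonneg (hull_mono h.subset hx) w
  have h2 := hyp w hw
  nlinarith [ht.1, ht.2, mul_pos ht.1 h2, mul_nonneg (sub_nonneg.2 ht.2.le) h1]

/-- Near a vertex there are only elements that contain it. -/
theorem eventually_mem_star {z : Pt d} {K : Finset (Pt d)} (hK : K ∈ M.elems) (hz : z ∈ K) :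
    ∀ᶠ x in nhds z, ∀ K' ∈ M.elems, x ∈ hull K' → z ∈ K' := by
  refine (Finset.eventually_all M.elems).2 fun K' hK' => ?_
  by_cases hzK' : z ∈ hull K'
  · exact Filter.Eventually.of_forall fun _ _ => M.mem_of_mem_hull hK hK' hz hzK'
  · filter_upwards [(isClosed_hull K').isOpen_compl.mem_nhds hzK'] with x hx hx'
    exact absurd hx' hx

/-- The hat functions of interior vertices vanish outside of the domain. -/
theorem hat_eq_zero_of_notMem (hΩ : IsLipschitzDomain Ω) {z x : Pt d} (hz : z ∈ Ω) (hx : x ∉ Ω) :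
    M.hat z x = 0 := by
  by_cases hxc : x ∈ closure Ω
  swap
  · exact M.hat_eq_zero hxc z
  obtain ⟨K, hK, hxK⟩ := M.exists_mem_hull hxc
  rw [M.hat_eq hK z hxK]
  by_contra hne
  have hKs := M.isSimplex hK
  have hpos : 0 < bary K z x := lt_of_le_of_ne (hKs.bary_nonneg hxK z) (Ne.symm hne)
  have hzK : z ∈ K := by
    by_contra hzK
    exact hne (by rw [hKs.bary_of_notMem hzK]; rfl)
  refine hx (hΩ.interior_closure_subset (mem_interior_iff_mem_nhds.2 ?_))
  have hU : ∀ᶠ y in nhds z, y ∈ Ω ∧ ∀ K' ∈ M.elems, y ∈ hull K' → z ∈ K' :=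
    (hΩ.isOpen.eventually_mem hz).and (M.eventually_mem_star hK hzK)
  obtain ⟨U, hUsub, hUo, hzU⟩ := eventually_nhds_iff.1 hU
  -- The neighbourhood of `z` is transported to `x` by the homothety about `z`. An element
  -- containing `z` and `z + ε (y - z)` also contains `y` once its `z`-coordinate is positive in
  -- `y`, because all other coordinates are only scaled by `ε`.
  obtain ⟨ε, hεU, hε⟩ : ∃ ε : ℝ, z + ε • (x - z) ∈ U ∧ ε ∈ Ioo (0 : ℝ) 1 := by
    have hc : Continuous fun t : ℝ => z + t • (x - z) := by fun_prop
    have h0 : ∀ᶠ t in nhds (0 : ℝ), z + t • (x - z) ∈ U :=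
      hc.continuousAt.eventually (hUo.mem_nhds (by simpa using hzU))
    exact ((h0.filter_mono nhdsWithin_le_nhds).and
      (Ioo_mem_nhdsGT (show (0 : ℝ) < 1 by norm_num))).exists
  have hcy : Continuous fun y : Pt d => z + ε • (y - z) := by fun_prop
  have ev1 : ∀ᶠ y in nhds x, z + ε • (y - z) ∈ U :=
    hcy.continuousAt.eventually (hUo.mem_nhds hεU)
  have ev2 : ∀ᶠ y in nhds x, ∀ K' ∈ M.elems, z + ε • (y - z) ∈ hull K' → z ∈ K' →
      0 < bary K' z y := by
    refine (Finset.eventually_all M.elems).2 fun K' hK' => ?_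
    by_cases hzK' : z ∈ K'
    swap
    · exact Filter.Eventually.of_forall fun _ _ h => absurd h hzK'
    by_cases hmem : z + ε • (x - z) ∈ hull K'
    · have hmemK : z + ε • (x - z) ∈ hull K :=
        (convex_convexHull ℝ _).add_smul_sub_mem (mem_hull_of_mem hzK) hxK ⟨hε.1.le, hε.2.le⟩
      have heq := M.bary_eq_bary hK hK' z hmemK hmem
      rw [affine_add_smul_sub, affine_add_smul_sub, hKs.bary_self hzK,
        (M.isSimplex hK').bary_self hzK'] at heq
      have heq' : bary K z x = bary K' z x := by
        have := mul_left_cancel₀ hε.1.ne' (add_left_cancel heq)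
        linarith
      rw [heq'] at hpos
      filter_upwards [(AffineMap.continuous_real (bary K' z)).continuousAt.eventually
        (lt_mem_nhds hpos)] with y hy _ _ using hy
    · filter_upwards [hcy.continuousAt.eventually
        ((isClosed_hull K').isOpen_compl.mem_nhds hmem)] with y hy hy'
      exact absurd hy' hy
  filter_upwards [ev1, ev2] with y hy1 hy2
  obtain ⟨hyΩ, hystar⟩ := hUsub _ hy1
  obtain ⟨K', hK', hyK'⟩ := M.exists_mem_hull (subset_closure hyΩ)
  have hzK' := hystar K' hK' hyK'
  have hK's := M.isSimplex hK'
  refine M.hull_subset_closure hK' (hK's.mem_hull_iff.2 fun w hw => ?_)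
  rcases eq_or_ne w z with rfl | hwz
  · exact (hy2 K' hK' hyK' hzK').le
  · have := hK's.bary_nonneg hyK' w
    rw [affine_add_smul_sub, hK's.bary_ne hzK' hwz.symm, sub_zero, zero_add] at this
    exact nonneg_of_mul_nonneg_right this hε.1

theorem mem_interiorFaces_iff {F : Finset (Pt d)} :
    F ∈ M.interiorFaces ↔ F ∈ M.faces ∧ ¬ M.IsBoundaryFace F := by
  simp [interiorFaces]

theorem bubble_eq {K : Finset (Pt d)} (hK : K ∈ M.elems) (F : Finset (Pt d)) {x : Pt d}
    (hx : x ∈ hull K) : M.bubble F x = ∏ z ∈ F, bary K z x :=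
  Finset.prod_congr rfl fun z _ => M.hat_eq hK z hx

/-- The bubble functions of interior faces vanish outside of the domain. -/
theorem bubble_eq_zero_of_notMem (hΩ : IsLipschitzDomain Ω) (hd : 1 ≤ d) {F : Finset (Pt d)}
    (hF : F ∈ M.interiorFaces) {x : Pt d} (hx : x ∉ Ω) : M.bubble F x = 0 := by
  obtain ⟨hFf, hFb⟩ := M.mem_interiorFaces_iff.1 hF
  obtain ⟨_, _, _, hcard⟩ := M.mem_faces_iff.1 hFf
  by_cases hxc : x ∈ closure Ω
  swap
  · obtain ⟨z, hz⟩ : F.Nonempty := Finset.card_pos.1 (by omega)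
    exact Finset.prod_eq_zero hz (M.hat_eq_zero hxc z)
  obtain ⟨K, hK, hxK⟩ := M.exists_mem_hull hxc
  have hKs := M.isSimplex hK
  rw [M.bubble_eq hK F hxK]
  by_contra hne
  have hpos : ∀ w ∈ F, 0 < bary K w x := fun w hw =>
    lt_of_le_of_ne (hKs.bary_nonneg hxK w) (Ne.symm (Finset.prod_ne_zero_iff.1 hne w hw))
  have hFK : F ⊆ K := fun w hw => M.mem_of_bary_pos hK hK hxK hxK (hpos w hw)
  obtain ⟨z, h⟩ := hKs.exists_isFaceOf hFK hcard
  obtain ⟨K', hK', hKK', hFK'⟩ := M.exists_neighbour hΩ hd hK h hFb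
  obtain ⟨z', h'⟩ := (M.isSimplex hK').exists_isFaceOf hFK' hcard
  have hz0 : bary K z x = 0 := by
    by_contra hz0
    refine hx (M.interior_hull_subset hΩ hK (hKs.mem_interior_iff.2 fun w hw => ?_))
    rcases h.mem_iff.1 hw with rfl | hw
    · exact lt_of_le_of_ne (hKs.bary_nonneg hxK _) (Ne.symm hz0)
    · exact hpos w hw
  exact hx (M.relint_subset hΩ hd hK hK' hKK' h h' (h.mem_hull_iff.2 ⟨hxK, hz0⟩) hpos)

end Mesh

/-! ### Families of elements without boundary -/

namespace Mesh

variable {Ω : Set (Pt d)} (M : Mesh Ω)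

/-- At most two elements share a face. -/
theorem eq_or_eq_of_isFaceOf (hd : 1 ≤ d) {F K K' K'' : Finset (Pt d)} {z z' z'' : Pt d}
    (hK : K ∈ M.elems) (hK' : K' ∈ M.elems) (hK'' : K'' ∈ M.elems) (hne : K ≠ K')
    (h : IsFaceOf F K z) (h' : IsFaceOf F K' z') (h'' : IsFaceOf F K'' z'') :
    K'' = K ∨ K'' = K' := by
  by_contra! hcon
  have h1 := M.bary_opposite_neg hd hK hK' hne h h'
  have h2 := M.bary_opposite_neg hd hK hK'' hcon.1.symm h h''
  have h3 := M.bary_opposite_neg hd hK' hK'' hcon.2.symm h' h''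
  -- Three elements would lie pairwise on opposite sides of one plane. Algebraically, the negative
  -- number `h2` is the product of the negative numbers in `h1` and `h3`.
  rw [h.bary_eq_smul h', AffineMap.coe_smul, Pi.smul_apply, smul_eq_mul] at h2
  have := mul_pos_of_neg_of_neg h1 h3
  linarith

/-- If every face that meets `B` of an element in `T` is shared by another element in `T`, then
integrals of derivatives of functions supported in `B` cancel. -/
theorem sum_integral_fderiv_eq_zero (hd : 1 ≤ d) {T : Finset (Finset (Pt d))} (hTM : T ⊆ M.elems)
    {B : Set (Pt d)}
    (hT : ∀ K ∈ T, ∀ F z, IsFaceOf F K z → (hull F ∩ B).Nonempty → ∃ K' ∈ T, K ≠ K' ∧ F ⊆ K')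
    {f : Pt d → ℝ} (hf : ContDiff ℝ 1 f) (hfB : ∀ x, x ∉ B → f x = 0) (w : Pt d) :
    ∑ K ∈ T, ∫ x in hull K, fderiv ℝ f x w = 0 := by
  classical
  rw [Finset.sum_congr rfl fun K hK => (M.isSimplex (hTM hK)).integral_fderiv hd hf w]
  -- The boundary terms are indexed by pairs of an element and a vertex and are regrouped by the
  -- opposite face. A face that meets `B` occurs exactly twice, with opposite normals; on any other
  -- face `f` vanishes.
  rw [Finset.sum_sigma' T (fun K => K)]
  rw [← Finset.sum_fiberwise_of_maps_to
    (g := fun q : (_ : Finset (Pt d)) × Pt d => q.1.erase q.2)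
    (t := (T.sigma fun K => K).image fun q => q.1.erase q.2)
    (fun q hq => Finset.mem_image_of_mem _ hq)]
  refine Finset.sum_eq_zero fun F hF => ?_
  obtain ⟨⟨K, z⟩, hKz, hFe⟩ := Finset.mem_image.1 hF
  obtain ⟨hKT, hzK⟩ := Finset.mem_sigma.1 hKz
  have hface : ∀ q ∈ (T.sigma fun K => K).filter (fun q => q.1.erase q.2 = F),
      q.1 ∈ T ∧ IsFaceOf F q.1 q.2 := by
    intro q hq
    obtain ⟨hq1, hq2⟩ := Finset.mem_filter.1 hq
    obtain ⟨hq3, hq4⟩ := Finset.mem_sigma.1 hq1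
    refine ⟨hq3, ?_⟩
    rw [← hq2]
    exact (M.isSimplex (hTM hq3)).isFaceOf_erase hq4
  have h : IsFaceOf F K z := (hface ⟨K, z⟩ (Finset.mem_filter.2 ⟨hKz, hFe⟩)).2
  by_cases hB : (hull F ∩ B).Nonempty
  · obtain ⟨K', hK'T, hne, hFK'⟩ := hT K hKT F z h hB
    obtain ⟨z', h'⟩ := (M.isSimplex (hTM hK'T)).exists_isFaceOf hFK' h.card_eq
    have hfib : (T.sigma fun K => K).filter (fun q => q.1.erase q.2 = F) = {⟨K, z⟩, ⟨K', z'⟩} := by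
      ext ⟨K'', z''⟩
      rw [Finset.mem_insert, Finset.mem_singleton]
      constructor
      · intro hq
        obtain ⟨hq1, h''⟩ := hface _ hq
        have huniq : ∀ {y y' : Pt d}, IsFaceOf F K'' y → IsFaceOf F K'' y' → y = y' :=
          fun g g' => (g.mem_iff.1 g'.mem).elim (fun e => e.symm) fun e => absurd e g'.notMem
        rcases M.eq_or_eq_of_isFaceOf hd (hTM hKT) (hTM hK'T) (hTM hq1) hne h h' h'' with e | e
        · left
          have e : K'' = K := e
          subst e
          rw [show z'' = z from huniq h'' h]
        · right
          have e : K'' = K' := e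
          subst e
          rw [show z'' = z' from huniq h'' h']
      · rintro (e | e) <;> rw [e, Finset.mem_filter, Finset.mem_sigma]
        · exact ⟨⟨hKT, h.mem⟩, h.eq_erase.symm⟩
        · exact ⟨⟨hK'T, h'.mem⟩, h'.eq_erase.symm⟩
    rw [hfib, Finset.sum_pair (by
      intro e; exact hne (congrArg Sigma.fst e))]
    simp only
    rw [← h.eq_erase, ← h'.eq_erase]
    have hn := congrArg (fun g => inner ℝ g w) (h.normal_eq_neg hd h'
      (M.bary_opposite_neg hd (hTM hKT) (hTM hK'T) hne h h'))
    simp only [inner_neg_left, real_inner_smul_left] at hn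
    linear_combination (-faceIntegral F f) * hn
  · refine Finset.sum_eq_zero fun q hq => ?_
    have hq' := (Finset.mem_filter.1 hq).2
    have h0 : faceIntegral F f = 0 := setIntegral_eq_zero_of_forall_eq_zero fun y hy =>
      hfB y fun hyB => hB ⟨y, hy, hyB⟩
    rw [hq', h0]; simp

/-- The derivative along the motion of a bump is minus its spatial derivative. It is needed with
weight 1 on elements, for the covering argument, and with an `L²` function as weight, for functions
with vanishing weak gradient. -/
theorem hasDerivAt_integral_translate {μ : Measure (Pt d)} {g : Pt d → ℝ} (hg : Integrable g μ)
    {ψ : Pt d → ℝ} (hψ : ContDiff ℝ 1 ψ) (hc : HasCompactSupport ψ) (a w : Pt d) (t : ℝ) :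
    HasDerivAt (fun t : ℝ => ∫ x, g x * ψ (x - (a + t • w)) ∂μ)
      (-∫ x, g x * fderiv ℝ (fun x => ψ (x - (a + t • w))) x w ∂μ) t := by
  have hψ' := hψ.continuous_fderiv (by simp)
  obtain ⟨C, hC⟩ := hψ'.bounded_above_of_compact_support (hc.fderiv ℝ)
  have hcont := hψ.continuous
  obtain ⟨C₀, hC₀⟩ := hcont.bounded_above_of_compact_support hc
  have hder : ∀ (x : Pt d) (t : ℝ), HasDerivAt (fun t : ℝ => g x * ψ (x - (a + t • w)))
      (-(g x * fderiv ℝ ψ (x - (a + t • w)) w)) t := by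
    intro x t
    have h1 : HasDerivAt (fun t : ℝ => x - (a + t • w)) (-w) t := by
      simpa using (((hasDerivAt_id t).smul_const w).const_add a).const_sub x
    have := ((hψ.differentiable (by simp) (x - (a + t • w))).hasFDerivAt.comp_hasDerivAt t
      h1).const_mul (g x)
    rw [map_neg, mul_neg] at this
    exact this
  have hfd : ∀ x, fderiv ℝ (fun x => ψ (x - (a + t • w))) x = fderiv ℝ ψ (x - (a + t • w)) :=
    fun x => fderiv_comp_sub (𝕜 := ℝ) (f := ψ) (a := a + t • w) (x := x)
  simp_rw [hfd, ← integral_neg]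
  refine (hasDerivAt_integral_of_dominated_loc_of_deriv_le (s := univ)
    (F := fun t x => g x * ψ (x - (a + t • w)))
    (F' := fun t x => -(g x * fderiv ℝ ψ (x - (a + t • w)) w))
    (bound := fun x => ‖g x‖ * (C * ‖w‖))
    Filter.univ_mem ?_ ?_ ?_ ?_ ?_ ?_).2
  · exact Filter.Eventually.of_forall fun s =>
      hg.aestronglyMeasurable.mul (Continuous.aestronglyMeasurable (by fun_prop))
  · exact hg.mul_bdd (Continuous.aestronglyMeasurable (by fun_prop)) (ae_of_all _ fun x => hC₀ _)
  · refine (hg.aestronglyMeasurable.mul (Continuous.aestronglyMeasurable ?_)).neg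
    have : Continuous fun x => fderiv ℝ ψ (x - (a + t • w)) := hψ'.comp (by fun_prop)
    fun_prop
  · refine ae_of_all _ fun x s _ => ?_
    rw [norm_neg, norm_mul]
    gcongr
    exact (ContinuousLinearMap.le_opNorm _ _).trans (by gcongr; exact hC _)
  · exact hg.norm.mul_const _
  · exact ae_of_all _ fun x s _ => hder x s

/-- A family of elements whose faces in the convex open set `B` are all shared within the family
covers `B` if it meets `B`. -/
theorem exists_mem_hull_of_shared (hd : 1 ≤ d) {T : Finset (Finset (Pt d))}
    (hTM : T ⊆ M.elems) {B : Set (Pt d)} (hBo : IsOpen B) (hBc : Convex ℝ B)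
    (hT : ∀ K ∈ T, ∀ F z, IsFaceOf F K z → (hull F ∩ B).Nonempty → ∃ K' ∈ T, K ≠ K' ∧ F ⊆ K')
    {K₀ : Finset (Pt d)} (hK₀ : K₀ ∈ T) (hmeet : (interior (hull K₀) ∩ B).Nonempty)
    {b : Pt d} (hb : b ∈ B) : ∃ K ∈ T, b ∈ hull K := by
  by_contra! hcon
  obtain ⟨a, haK, haB⟩ := hmeet
  have hbo : ∀ᶠ x in nhds b, x ∈ B ∧ ∀ K ∈ T, x ∉ hull K :=
    (hBo.eventually_mem hb).and ((Finset.eventually_all T).2 fun K hK =>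
      (isClosed_hull K).isOpen_compl.eventually_mem (hcon K hK))
  obtain ⟨ε₁, hε₁, hball₁⟩ := Metric.eventually_nhds_iff_ball.1 hbo
  obtain ⟨ε₂, hε₂, hball₂⟩ := Metric.isOpen_iff.1 (isOpen_interior.inter hBo) a ⟨haK, haB⟩
  set ε := min ε₁ ε₂ with hεdef
  have hε : 0 < ε := lt_min hε₁ hε₂
  let ψ : ContDiffBump (0 : Pt d) := ⟨ε / 4, ε / 2, by positivity, by linarith⟩
  have hψ : ContDiff ℝ 1 (ψ : Pt d → ℝ) := ψ.contDiff
  set w := b - a with hw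
  have hsupp : ∀ {c x : Pt d}, ψ (x - c) ≠ 0 → x ∈ Metric.ball c ε := by
    intro c x hx
    have : x - c ∈ Function.support ψ := hx
    rw [ψ.support_eq, mem_ball_zero_iff] at this
    rw [Metric.mem_ball, dist_eq_norm]
    exact this.trans (half_lt_self hε)
  -- The mass of the bump on the family as its centre moves from `a` to `b`. By convexity the
  -- support stays in `B`, so the derivative vanishes by cancellation on shared faces. Yet the mass
  -- is positive at `a` and would be zero at an uncovered `b`.
  set I : ℝ → ℝ := fun t => ∑ K ∈ T, ∫ x in hull K, ψ (x - (a + t • w)) with hI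
  have hder : ∀ t ∈ Icc (0 : ℝ) 1, HasDerivAt I 0 t := by
    intro t ht
    have h1 : HasDerivAt I
        (∑ K ∈ T, -∫ x in hull K, fderiv ℝ (fun x => ψ (x - (a + t • w))) x w) t :=
      HasDerivAt.fun_sum fun K _ => by
        simpa only [one_mul] using hasDerivAt_integral_translate (g := fun _ => 1)
          (continuousOn_const.integrableOn_compact (isCompact_hull K)) hψ ψ.hasCompactSupport a w t
    have h2 : ∑ K ∈ T, ∫ x in hull K, fderiv ℝ (fun x => ψ (x - (a + t • w))) x w = 0 := by
      refine M.sum_integral_fderiv_eq_zero hd hTM hT (hψ.comp (contDiff_id.sub contDiff_const))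
        (fun x hx => ?_) w
      by_contra hne
      have hx' := hsupp hne
      apply hx
      have e1 : a + (x - (a + t • w)) ∈ B := (hball₂ (by
        rw [Metric.mem_ball, dist_eq_norm, add_sub_cancel_left, ← dist_eq_norm]
        exact (Metric.mem_ball.1 hx').trans_le (min_le_right _ _))).2
      have e2 : b + (x - (a + t • w)) ∈ B := (hball₁ _ (by
        rw [Metric.mem_ball, dist_eq_norm, add_sub_cancel_left, ← dist_eq_norm]
        exact (Metric.mem_ball.1 hx').trans_le (min_le_left _ _))).1
      have := hBc.add_smul_sub_mem e1 e2 ht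
      convert this using 1
      rw [hw]
      module
    rw [Finset.sum_neg_distrib, h2, neg_zero] at h1
    exact h1
  have hconst := constant_of_has_deriv_right_zero
    (fun t ht => (hder t ht).continuousAt.continuousWithinAt)
    (fun t ht => (hder t ⟨ht.1, ht.2.le⟩).hasDerivWithinAt) 1 (right_mem_Icc.2 zero_le_one)
  have hI1 : I 1 = 0 := by
    refine Finset.sum_eq_zero fun K hK => setIntegral_eq_zero_of_forall_eq_zero fun x hx => ?_
    by_contra hne
    have := hsupp hne
    rw [hw, one_smul, add_sub_cancel] at this
    exact (hball₁ x (Metric.ball_subset_ball (min_le_left _ _) this)).2 K hK hx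
  have hI0 : 0 < I 0 := by
    have hnn : ∀ K : Finset (Pt d), 0 ≤ ∫ x in hull K, ψ (x - (a + (0 : ℝ) • w)) :=
      fun K => integral_nonneg fun x => ψ.nonneg
    refine Finset.sum_pos' (fun K _ => hnn K) ⟨K₀, hK₀, ?_⟩
    rw [zero_smul, add_zero]
    have hcont : Continuous fun x => ψ (x - a) := ψ.continuous.comp (by fun_prop)
    have hint : IntegrableOn (fun x => ψ (x - a)) (hull K₀) :=
      hcont.continuousOn.integrableOn_compact (isCompact_hull K₀)
    rw [integral_pos_iff_support_of_nonneg (fun x => ψ.nonneg) hint]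
    have hopen : IsOpen (Function.support (fun x => ψ (x - a)) ∩ interior (hull K₀)) :=
      (hcont.isOpen_support).inter isOpen_interior
    have ha0 : a ∈ Function.support (fun x => ψ (x - a)) := by
      have : ψ 0 = 1 := ψ.one_of_mem_closedBall (by simp; positivity)
      simp [this]
    refine lt_of_lt_of_le (hopen.measure_pos volume ⟨a, ha0, haK⟩) ?_
    rw [Measure.restrict_apply hcont.isOpen_support.measurableSet]
    exact measure_mono (inter_subset_inter_right _ interior_subset)
  rw [hI1] at hconst
  exact hI0.ne hconst

/-! ### Face-connectedness of the stars of vertices -/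

/-- The elements that contain the vertex `z`. -/
abbrev Star (z : Pt d) : Type := {K : Finset (Pt d) // K ∈ M.elems ∧ z ∈ K}

/-- Two elements of the star of `z` are adjacent if they share an interior face that contains `z`. -/
def starGraph (z : Pt d) : SimpleGraph (M.Star z) where
  Adj K K' := K ≠ K' ∧
    ∃ F : Finset (Pt d), F ⊆ K.1 ∧ F ⊆ K'.1 ∧ F.card = d ∧ z ∈ F ∧ ¬ M.IsBoundaryFace F
  symm := ⟨fun _ _ ⟨h, F, h1, h2, h3⟩ => ⟨h.symm, F, h2, h1, h3⟩⟩
  loopless := ⟨fun _ h => h.1 rfl⟩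

theorem exists_mem_interior_near {K : Finset (Pt d)} (hK : IsSimplex K) {z : Pt d} (hz : z ∈ K)
    {U : Set (Pt d)} (hU : U ∈ nhds z) : (interior (hull K) ∩ U).Nonempty := by
  have : z ∈ closure (interior (hull K)) := by
    rw [(convex_convexHull ℝ _).closure_interior_eq_closure_of_nonempty_interior
      hK.exists_mem_interior]
    exact subset_closure (mem_hull_of_mem hz)
  rw [inter_comm]
  exact mem_closure_iff_nhds.1 this U hU

/-- A part of the star of `z` that is closed under adjacency and has no boundary face at `z`
covers a neighbourhood of `z`. -/
theorem eventually_mem_reachable (hΩ : IsLipschitzDomain Ω) (hd : 1 ≤ d) {z : Pt d}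
    (K : M.Star z)
    (hno : ∀ K' : M.Star z, (M.starGraph z).Reachable K K' → ∀ F ⊆ K'.1, F.card = d → z ∈ F →
      ¬ M.IsBoundaryFace F) :
    ∀ᶠ x in nhds z, ∃ K' : M.Star z, (M.starGraph z).Reachable K K' ∧ x ∈ hull K'.1 := by
  classical
  -- In a small ball about `z` an element of the star has only faces that contain `z`. Hence
  -- adjacency around `z` accounts for all faces that the covering lemma asks about.
  have hF : ∀ᶠ x in nhds z, ∀ F ∈ M.faces, x ∈ hull F →
      ∀ K' ∈ M.elems, z ∈ K' → F ⊆ K' → z ∈ F := by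
    refine (Finset.eventually_all M.faces).2 fun F _ => ?_
    by_cases hzF : z ∈ hull F
    · refine Filter.Eventually.of_forall fun _ _ K' hK' hzK' hFK' => ?_
      by_contra hcon
      have := ((M.isSimplex hK').mem_hull_subset_iff hFK').1 hzF
      have h0 := this.2 z hzK' hcon
      rw [(M.isSimplex hK').bary_self hzK'] at h0
      exact one_ne_zero h0
    · filter_upwards [(isClosed_hull F).isOpen_compl.mem_nhds hzF] with x hx hx'
      exact absurd hx' hx
  obtain ⟨r, hr, hball⟩ := Metric.eventually_nhds_iff_ball.1 hF
  set T : Finset (Finset (Pt d)) := M.elems.filter fun K' =>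
    ∃ h : K' ∈ M.elems ∧ z ∈ K', (M.starGraph z).Reachable K ⟨K', h⟩ with hT
  have hTmem : ∀ {K'}, K' ∈ T ↔ ∃ h : K' ∈ M.elems ∧ z ∈ K', (M.starGraph z).Reachable K ⟨K', h⟩ :=
    fun {K'} => by
      rw [hT, Finset.mem_filter]
      exact ⟨fun h => h.2, fun h => ⟨h.choose.1, h⟩⟩
  have hKT : K.1 ∈ T := hTmem.2 ⟨K.2, SimpleGraph.Reachable.refl _⟩
  have hshared : ∀ K' ∈ T, ∀ F y, IsFaceOf F K' y → (hull F ∩ Metric.ball z r).Nonempty →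
      ∃ K'' ∈ T, K' ≠ K'' ∧ F ⊆ K'' := by
    intro K' hK' F y h hmeet
    obtain ⟨⟨hK'M, hzK'⟩, hreach⟩ := hTmem.1 hK'
    obtain ⟨x, hxF, hxB⟩ := hmeet
    have hzF := hball x hxB F (M.mem_faces_of_isFaceOf hK'M h) hxF K' hK'M hzK' h.subset
    have hnb := hno _ hreach F h.subset h.card_eq hzF
    obtain ⟨K'', hK'', hne, hFK''⟩ := M.exists_neighbour hΩ hd hK'M h hnb
    refine ⟨K'', hTmem.2 ⟨⟨hK'', hFK'' hzF⟩, hreach.trans (SimpleGraph.Adj.reachable ?_)⟩, hne,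
      hFK''⟩
    exact ⟨fun e => hne (congrArg Subtype.val e), F, h.subset, hFK'', h.card_eq, hzF, hnb⟩
  filter_upwards [Metric.ball_mem_nhds z hr] with b hb
  obtain ⟨K', hK', hbK'⟩ := M.exists_mem_hull_of_shared hd (T := T) (Finset.filter_subset _ _)
    Metric.isOpen_ball (convex_ball z r) hshared hKT
    (exists_mem_interior_near (M.isSimplex K.2.1) K.2.2 (Metric.ball_mem_nhds z hr)) hb
  obtain ⟨h, hreach⟩ := hTmem.1 hK'
  exact ⟨⟨K', h⟩, hreach, hbK'⟩

/-- The star of an interior vertex is face-connected. -/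
theorem starGraph_reachable (hΩ : IsLipschitzDomain Ω) (hd : 1 ≤ d) {z : Pt d} (hz : z ∈ Ω)
    (K K' : M.Star z) : (M.starGraph z).Reachable K K' := by
  -- A face through a point of `Ω` is not a boundary face. So the component of `K` covers a
  -- neighbourhood of `z` and meets the interior of `K'`, which must then belong to it.
  have ev := M.eventually_mem_reachable hΩ hd K fun K'' _ F _ _ hzF hF =>
    (hF (mem_hull_of_mem hzF)).2 (by rwa [hΩ.isOpen.interior_eq])
  obtain ⟨x, hxK, K'', hr, hx⟩ :=
    exists_mem_interior_near (M.isSimplex K'.2.1) K'.2.2 ev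
  have : K' = K'' := Subtype.ext (M.eq_of_mem_interior K'.2.1 K''.2.1 hxK hx)
  rwa [this]

/-- Every element at a boundary vertex is connected to a boundary face at this vertex. -/
theorem exists_boundaryFace_reachable (hΩ : IsLipschitzDomain Ω) (hd : 1 ≤ d) {z : Pt d}
    (hz : z ∉ Ω) (K : M.Star z) : ∃ K' : M.Star z, (M.starGraph z).Reachable K K' ∧
      ∃ F ⊆ K'.1, F.card = d ∧ z ∈ F ∧ M.IsBoundaryFace F := by
  -- Without a boundary face at `z` the component of `K` would cover a neighbourhood of `z`, and `z`
  -- would be interior to the closure of `Ω`.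
  by_contra! hcon
  have ev := M.eventually_mem_reachable hΩ hd K fun K'' hr F hF hc hzF => hcon K'' hr F hF hc hzF
  refine hz (hΩ.interior_closure_subset (mem_interior_iff_mem_nhds.2 ?_))
  filter_upwards [ev] with x ⟨K', _, hx⟩
  exact M.hull_subset_closure K'.2.1 hx

end Mesh

/-! ### Lipschitz functions that vanish outside of the domain -/

/-- Closed subspaces of a product are closed under limits that are strong in the first and weak in
the second component. -/
theorem exists_mem_topologicalClosure {H₁ H₂ : Type*} [NormedAddCommGroup H₁] [NormedSpace ℝ H₁]
    [NormedAddCommGroup H₂] [InnerProductSpace ℝ H₂] [CompleteSpace H₂]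
    (G : Submodule ℝ (H₁ × H₂)) {x : ℕ → H₁} {y : ℕ → H₂} {x₀ : H₁} {C : ℝ}
    (hG : ∀ n, (x n, y n) ∈ G) (hx : Filter.Tendsto x Filter.atTop (nhds x₀))
    (hy : ∀ n, ‖y n‖ ≤ C) : ∃ y₀, (x₀, y₀) ∈ G.topologicalClosure := by
  -- A limit along a nonprincipal ultrafilter replaces the choice of a weakly convergent
  -- subsequence.
  let U : Ultrafilter ℕ := Filter.hyperfilter ℕ
  have hU : (U : Filter ℕ) ≤ Filter.atTop := Nat.hyperfilter_le_atTop
  let ξ : ℕ → WeakDual ℝ H₂ := fun n =>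
    StrongDual.toWeakDual (InnerProductSpace.toDual ℝ H₂ (y n))
  have hcpt := WeakDual.isCompact_closedBall (𝕜 := ℝ) (E := H₂) 0 C
  obtain ⟨η, -, hη⟩ := isCompact_iff_ultrafilter_le_nhds.1 hcpt (U.map ξ) (by
    rw [Filter.le_principal_iff]
    refine Filter.mem_map.2 (Filter.univ_mem' fun n => ?_)
    change dist (InnerProductSpace.toDual ℝ H₂ (y n)) 0 ≤ C
    rw [dist_zero_right]
    simpa using hy n)
  have hlim : ∀ v : H₂, Filter.Tendsto (fun n => inner ℝ (y n) v) U (nhds (η v)) := fun v =>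
    ((WeakDual.eval_continuous v).tendsto η).comp (show Filter.Tendsto ξ U (nhds η) from hη)
  set y₀ := (InnerProductSpace.toDual ℝ H₂).symm (WeakDual.toStrongDual η) with hy₀
  have hy₀' : ∀ v, inner ℝ y₀ v = η v := fun v => by
    rw [hy₀, InnerProductSpace.toDual_symm_apply]; rfl
  refine ⟨y₀, ?_⟩
  by_contra hnot
  -- A closed subspace is convex, so a point outside is separated from it by a continuous
  -- functional. Such a functional passes to the limit, strongly in the first and weakly in the
  -- second component.
  obtain ⟨f, u, hfu, hux⟩ := geometric_hahn_banach_closed_point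
    (s := (G.topologicalClosure : Set (H₁ × H₂))) G.topologicalClosure.convex
    G.isClosed_topologicalClosure hnot
  let f₂ : StrongDual ℝ H₂ := f.comp (ContinuousLinearMap.inr ℝ H₁ H₂)
  set v := (InnerProductSpace.toDual ℝ H₂).symm f₂ with hv
  have hf : ∀ a b, f (a, b) = f (a, 0) + inner ℝ b v := fun a b => by
    have h1 : ((a, b) : H₁ × H₂) = (a, 0) + (0, b) := by simp
    rw [h1, map_add, real_inner_comm, hv, InnerProductSpace.toDual_symm_apply]; rfl
  have hlim2 : Filter.Tendsto (fun n => f (x n, y n)) U (nhds (f (x₀, y₀))) := by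
    rw [funext fun n => hf (x n) (y n), hf x₀ y₀]
    refine Filter.Tendsto.add ?_ (by rw [hy₀']; exact hlim v)
    have hc : Continuous fun a : H₁ => f (a, (0 : H₂)) := by fun_prop
    exact (hc.tendsto x₀).comp (hx.mono_left hU)
  have hle : f (x₀, y₀) ≤ u := le_of_tendsto hlim2
    (Filter.Eventually.of_forall fun n => (hfu _ (G.le_topologicalClosure (hG n))).le)
  linarith

/-- The soft threshold function. -/
def softThreshold (δ s : ℝ) : ℝ := s - max (-δ) (min δ s)

theorem softThreshold_lipschitz {δ : ℝ} (hδ : 0 ≤ δ) : LipschitzWith 1 (softThreshold δ) := by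
  refine LipschitzWith.of_dist_le_mul fun s t => ?_
  rw [NNReal.coe_one, one_mul, Real.dist_eq, Real.dist_eq, softThreshold, softThreshold]
  rcases le_total δ s with h1 | h1 <;> rcases le_total δ t with h2 | h2 <;>
  rcases le_total (-δ) s with h3 | h3 <;> rcases le_total (-δ) t with h4 | h4 <;>
  simp only [min_eq_left, min_eq_right, max_eq_left, max_eq_right, h1, h2, h3, h4,
    max_eq_right (show -δ ≤ δ by linarith)] <;>
  rw [abs_le] <;> constructor <;> rcases abs_cases (s - t) with ⟨h5, h6⟩ | ⟨h5, h6⟩ <;> linarith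

theorem abs_softThreshold_sub_le {δ : ℝ} (hδ : 0 ≤ δ) (s : ℝ) : |softThreshold δ s - s| ≤ δ := by
  rw [softThreshold, sub_sub_cancel_left, abs_neg, abs_le]
  exact ⟨le_max_left _ _, max_le (by linarith) (min_le_left _ _)⟩

theorem softThreshold_eq_zero {δ s : ℝ} (h : |s| ≤ δ) : softThreshold δ s = 0 := by
  obtain ⟨h1, h2⟩ := abs_le.1 h
  rw [softThreshold, min_eq_right h2, max_eq_right h1, sub_self]

/-- Mollification of Lipschitz functions that vanish outside of an open bounded set. -/
theorem exists_test_near {Ω : Set (Pt d)} (ho : IsOpen Ω) (hb : Bornology.IsBounded Ω)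
    {f : Pt d → ℝ} {L : NNReal} (hf : LipschitzWith L f) (h0 : ∀ x, x ∉ Ω → f x = 0) {ε : ℝ}
    (hε : 0 < ε) :
    ∃ φ, IsTest Ω φ ∧ (∀ x, |φ x - f x| ≤ ε) ∧ ∀ x, ‖fderiv ℝ φ x‖ ≤ L := by
  set δ := ε / 2 with hδ
  have hδ0 : 0 < δ := by positivity
  -- Thresholding confines the support to the compact subset `|f| ≥ δ` of `Ω` without increasing the
  -- Lipschitz constant. This leaves room for the mollification.
  set g : Pt d → ℝ := fun x => softThreshold δ (f x) with hg
  have hgL : LipschitzWith L g := by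
    have := (softThreshold_lipschitz hδ0.le).comp hf
    rwa [one_mul] at this
  set A : Set (Pt d) := {x | δ ≤ |f x|} with hA
  have hAΩ : A ⊆ Ω := fun x hx => by
    by_contra hxΩ
    have : δ ≤ |f x| := hx
    rw [h0 x hxΩ, abs_zero] at this
    linarith
  have hAc : IsClosed A := isClosed_le continuous_const hf.continuous.abs
  have hAcpt : IsCompact A := Metric.isCompact_of_isClosed_isBounded hAc (hb.subset hAΩ)
  have hsuppg : Function.support g ⊆ A := fun x hx => by
    by_contra hxA
    exact hx (softThreshold_eq_zero (not_le.1 hxA).le)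
  obtain ⟨η₀, hη₀, hthick⟩ := hAcpt.exists_cthickening_subset_open ho hAΩ
  -- The first bound keeps the mollified support in `Ω`, the second limits the mollification error
  -- to `ε / 2`; `L + 1` covers the case `L = 0`.
  set η := min η₀ (ε / (2 * (L + 1))) with hη
  have hηpos : 0 < η := lt_min hη₀ (by positivity)
  have hLη : L * η ≤ ε / 2 := by
    calc (L : ℝ) * η ≤ (L + 1) * (ε / (2 * (L + 1))) := by
          gcongr
          · linarith
          · exact min_le_right _ _
      _ = ε / 2 := by field_simp
  let ψ : ContDiffBump (0 : Pt d) := ⟨η / 2, η, by positivity, by linarith⟩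
  have hgloc : LocallyIntegrable g volume := hgL.continuous.locallyIntegrable
  set φ : Pt d → ℝ := convolution (ψ.normed volume) g (ContinuousLinearMap.lsmul ℝ ℝ) volume with hφ
  have hex : ConvolutionExists (ψ.normed volume) g (ContinuousLinearMap.lsmul ℝ ℝ) volume :=
    ψ.hasCompactSupport_normed.convolutionExists_left _ ψ.continuous_normed hgloc
  have hsm : ContDiff ℝ ∞ φ :=
    ψ.hasCompactSupport_normed.contDiff_convolution_left _ ψ.contDiff_normed hgloc
  have hsub : tsupport φ ⊆ Metric.cthickening η A := by
    refine closure_minimal ((support_convolution_subset _).trans ?_) Metric.isClosed_cthickening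
    rintro _ ⟨u, hu, v, hv, rfl⟩
    rw [ψ.support_normed_eq, mem_ball_zero_iff] at hu
    refine Metric.mem_cthickening_of_dist_le _ v η A (hsuppg hv) ?_
    simpa using hu.le
  have hcpt : HasCompactSupport φ :=
    hAcpt.cthickening.of_isClosed_subset (isClosed_tsupport _) hsub
  have hLip : LipschitzWith L φ := by
    refine LipschitzWith.of_dist_le_mul fun x y => ?_
    have h1 : φ x - φ y = ∫ t, ψ.normed volume t * (g (x - t) - g (y - t)) := by
      simp_rw [mul_sub]
      rw [integral_sub]
      · rfl
      · exact hex x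
      · exact hex y
    rw [Real.dist_eq, h1, ← Real.norm_eq_abs]
    calc ‖∫ t, ψ.normed volume t * (g (x - t) - g (y - t))‖
        ≤ ∫ t, ψ.normed volume t * (L * dist x y) := by
          refine norm_integral_le_of_norm_le (ψ.integrable_normed.mul_const _)
            (ae_of_all _ fun t => ?_)
          rw [norm_mul, Real.norm_of_nonneg (ψ.nonneg_normed t)]
          refine mul_le_mul_of_nonneg_left ?_ (ψ.nonneg_normed t)
          have := hgL.dist_le_mul (x - t) (y - t)
          rwa [dist_sub_right, dist_eq_norm] at this
      _ = L * dist x y := by rw [integral_mul_const, ψ.integral_normed, one_mul]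
  refine ⟨φ, ⟨hsm, hcpt, hsub.trans ((Metric.cthickening_mono (min_le_left _ _) A).trans hthick)⟩,
    fun x => ?_, fun x => norm_fderiv_le_of_lipschitz ℝ hLip⟩
  have h1 : dist (φ x) (g x) ≤ ε / 2 := by
    refine ContDiffBump.dist_normed_convolution_le hgL.continuous.aestronglyMeasurable fun y hy => ?_
    refine (hgL.dist_le_mul y x).trans (le_trans ?_ hLη)
    gcongr
    exact (Metric.mem_ball.1 hy).le
  have h2 := abs_softThreshold_sub_le hδ0.le (f x)
  rw [Real.dist_eq] at h1
  calc |φ x - f x| = |(φ x - g x) + (g x - f x)| := by ring_nf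
    _ ≤ |φ x - g x| + |g x - f x| := abs_add_le _ _
    _ ≤ ε := by linarith

theorem norm_gradient {φ : Pt d → ℝ} {x : Pt d} : ‖gradient φ x‖ = ‖fderiv ℝ φ x‖ := by
  rw [gradient, LinearIsometryEquiv.norm_map]

theorem inner_gradient (φ : Pt d → ℝ) (x v : Pt d) : inner ℝ (gradient φ x) v = fderiv ℝ φ x v := by
  rw [gradient, InnerProductSpace.toDual_symm_apply]

theorem continuous_gradient {φ : Pt d → ℝ} (h : ContDiff ℝ 1 φ) : Continuous (gradient φ) :=
  (InnerProductSpace.toDual ℝ (Pt d)).symm.continuous.comp (h.continuous_fderiv (by simp))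

theorem isFiniteMeasure_restrict {Ω : Set (Pt d)} (hb : Bornology.IsBounded Ω) :
    IsFiniteMeasure (volume.restrict Ω) :=
  ⟨by rw [Measure.restrict_apply_univ]; exact hb.measure_lt_top⟩

/-- The approximating test functions converge uniformly, whereas their gradients are only bounded.
Weak compactness of the gradients suffices, since closed subspaces are weakly closed. -/
theorem mem_H10_of_lipschitz {Ω : Set (Pt d)} (ho : IsOpen Ω) (hb : Bornology.IsBounded Ω)
    {f : Pt d → ℝ} {L : NNReal} (hf : LipschitzWith L f) (h0 : ∀ x, x ∉ Ω → f x = 0)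
    {w : L2 Ω} (hw : w =ᵐ[volume.restrict Ω] f) : w ∈ H10 Ω := by
  have := isFiniteMeasure_restrict hb
  have hex : ∀ n : ℕ, ∃ φ, IsTest Ω φ ∧ (∀ x, |φ x - f x| ≤ 1 / ((n : ℝ) + 1)) ∧
      ∀ x, ‖fderiv ℝ φ x‖ ≤ L := fun n => exists_test_near ho hb hf h0 (by positivity)
  choose φ hφ hφf hφL using hex
  have hgm : ∀ n, MemLp (gradient (φ n)) 2 (volume.restrict Ω) := fun n =>
    MemLp.of_bound (continuous_gradient ((hφ n).contDiff.of_le (by simp))).aestronglyMeasurable L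
      (ae_of_all _ fun x => by rw [norm_gradient]; exact hφL n x)
  set x : ℕ → L2 Ω := fun n => ((hφ n).memLp _).toLp (φ n) with hxdef
  set y : ℕ → L2Vec Ω := fun n => (hgm n).toLp with hydef
  set m := (measureUnivNNReal (volume.restrict Ω) : ℝ) ^ ((2 : ENNReal).toReal⁻¹)
  have hG : ∀ n, (x n, y n) ∈ testGraph Ω := fun n =>
    ⟨φ n, hφ n, MemLp.coeFn_toLp ((hφ n).memLp _), MemLp.coeFn_toLp (hgm n)⟩
  have hlp : ∀ {E : Type} [NormedAddCommGroup E] (u : Lp E 2 (volume.restrict Ω)) (c : ℝ), 0 ≤ c →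
      (∀ᵐ x ∂(volume.restrict Ω), ‖u x‖ ≤ c) → ‖u‖ ≤ m * c := by
    intro E _ u c hc h
    exact Lp.norm_le_of_ae_bound hc h
  have hx : Filter.Tendsto x Filter.atTop (nhds w) := by
    rw [tendsto_iff_norm_sub_tendsto_zero]
    refine squeeze_zero (fun _ => norm_nonneg _) (fun n => ?_)
      (g := fun n : ℕ => m * (1 / ((n : ℝ) + 1))) ?_
    · refine hlp _ _ (by positivity) ?_
      filter_upwards [Lp.coeFn_sub (x n) w, hw, MemLp.coeFn_toLp ((hφ n).memLp (volume.restrict Ω))]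
        with z h1 h2 h3
      rw [h1, Pi.sub_apply, h2, h3]
      exact hφf n z
    · simpa using tendsto_one_div_add_atTop_nhds_zero_nat.const_mul m
  have hy : ∀ n, ‖y n‖ ≤ m * L := fun n => by
    refine hlp _ _ L.2 ?_
    filter_upwards [MemLp.coeFn_toLp (hgm n)] with z h1
    rw [h1, norm_gradient]
    exact hφL n z
  obtain ⟨y₀, hy₀⟩ := exists_mem_topologicalClosure (testGraph Ω) hG hx hy
  exact ⟨(w, y₀), hy₀, rfl⟩

/-- A function that is Lipschitz continuous at every point with the same constant is Lipschitz
continuous. -/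
theorem lipschitzWith_of_eventually {f : Pt d → ℝ} {L : NNReal}
    (h : ∀ x, ∀ᶠ y in nhds x, |f y - f x| ≤ L * dist y x) : LipschitzWith L f := by
  have hone : ∀ x y, f y - f x ≤ L * dist y x := by
    intro x y
    have hcf : Continuous f := by
      rw [continuous_iff_continuousAt]
      intro x
      rw [ContinuousAt, tendsto_iff_dist_tendsto_zero]
      refine squeeze_zero' (Filter.Eventually.of_forall fun _ => dist_nonneg) (h x) ?_
      have : Continuous fun y => (L : ℝ) * dist y x := by fun_prop
      simpa using this.tendsto x
    have hline : Continuous fun t : ℝ => x + t • (y - x) := by fun_prop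
    have key := image_le_of_liminf_slope_right_le_deriv_boundary (a := 0) (b := 1)
      (f := fun t : ℝ => f (x + t • (y - x))) (hcf.comp hline).continuousOn
      (B := fun t => f x + t * (L * dist y x)) (B' := fun _ => L * dist y x) (by simp)
      (by fun_prop) (fun t _ => by
        simpa using (((hasDerivAt_id t).mul_const (L * dist y x)).const_add
          (f x)).hasDerivWithinAt) (fun t _ r hr => ?_) (right_mem_Icc.2 zero_le_one)
    · simp only [one_smul, add_sub_cancel, one_mul] at key
      linarith
    · have ev := (hline.tendsto t).eventually (h (x + t • (y - x)))
      refine Filter.Eventually.frequently ?_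
      filter_upwards [ev.filter_mono nhdsWithin_le_nhds, self_mem_nhdsWithin] with s hs hst
      have hst : t < s := hst
      have hpos : 0 < s - t := sub_pos.2 hst
      refine lt_of_le_of_lt ?_ hr
      rw [slope_def_field, div_le_iff₀ hpos]
      refine (le_abs_self _).trans (hs.trans (le_of_eq ?_))
      rw [dist_eq_norm, dist_eq_norm, add_sub_add_left_eq_sub, ← sub_smul, norm_smul,
        Real.norm_of_nonneg hpos.le]
      ring
  refine LipschitzWith.of_dist_le_mul fun x y => ?_
  rw [Real.dist_eq, abs_sub_le_iff]
  exact ⟨by simpa [dist_comm] using hone y x, by simpa [dist_comm] using hone x y⟩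

/-! ### Broken gradients -/

theorem IsTest.eq_zero {U : Set (Pt d)} {φ : Pt d → ℝ} (h : IsTest U φ) {x : Pt d} (hx : x ∉ U) :
    φ x = 0 := image_eq_zero_of_notMem_tsupport fun hx' => hx (h.subset hx')

theorem IsTest.fderiv_eq_zero {U : Set (Pt d)} {φ : Pt d → ℝ} (h : IsTest U φ) {x : Pt d}
    (hx : x ∉ U) : fderiv ℝ φ x = 0 := by
  by_contra hne
  exact hx (h.subset (support_fderiv_subset ℝ hne))

theorem integral_mul_fderiv_test {U : Set (Pt d)} {f φ : Pt d → ℝ} (hf : ContDiff ℝ 1 f)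
    (hφ : IsTest U φ) (v : Pt d) :
    ∫ x, f x * fderiv ℝ φ x v = -∫ x, fderiv ℝ f x v * φ x := by
  have hf' := hf.continuous_fderiv (by simp)
  have hφ' := hφ.contDiff.continuous_fderiv (by simp)
  have hφc := hφ.contDiff.continuous
  have hfc := hf.continuous
  refine integral_mul_fderiv_eq_neg_fderiv_mul_of_integrable ?_ ?_ ?_
    (fun x _ => hf.differentiable (by simp) x) (fun x _ => hφ.contDiff.differentiable (by simp) x)
  · exact Continuous.integrable_of_hasCompactSupport (by fun_prop) hφ.compact.mul_left
  · exact Continuous.integrable_of_hasCompactSupport (by fun_prop)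
      (hφ.compact.fderiv_apply ℝ v).mul_left
  · exact Continuous.integrable_of_hasCompactSupport (by fun_prop) hφ.compact.mul_left

/-- The classical gradient is a weak gradient. -/
theorem hasWeakGradOn_of_eq {Ω U : Set (Pt d)} (hUΩ : U ⊆ Ω) {w : L2 Ω} {G : L2Vec Ω}
    {f : Pt d → ℝ} (hf : ContDiff ℝ 1 f) (hw : ∀ᵐ x ∂(volume.restrict Ω), x ∈ U → w x = f x)
    (hG : ∀ᵐ x ∂(volume.restrict Ω), x ∈ U → G x = gradient f x) : HasWeakGradOn U w G := by
  intro φ hφ v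
  have h1 : ∫ x in Ω, w x * fderiv ℝ φ x v = ∫ x, f x * fderiv ℝ φ x v := by
    rw [← setIntegral_eq_integral_of_forall_compl_eq_zero (μ := volume) (s := Ω)
      (f := fun x => f x * fderiv ℝ φ x v) (fun x hx => by
        rw [hφ.fderiv_eq_zero fun h => hx (hUΩ h)]; simp)]
    refine integral_congr_ae ?_
    filter_upwards [hw] with x hx
    by_cases hxU : x ∈ U
    · rw [hx hxU]
    · rw [hφ.fderiv_eq_zero hxU]; simp
  have h2 : ∫ x in Ω, inner ℝ (G x) v * φ x = ∫ x, fderiv ℝ f x v * φ x := by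
    rw [← setIntegral_eq_integral_of_forall_compl_eq_zero (μ := volume) (s := Ω)
      (f := fun x => fderiv ℝ f x v * φ x) (fun x hx => by
        rw [hφ.eq_zero fun h => hx (hUΩ h)]; simp)]
    refine integral_congr_ae ?_
    filter_upwards [hG] with x hx
    by_cases hxU : x ∈ U
    · rw [hx hxU, inner_gradient]
    · rw [hφ.eq_zero hxU]; simp
  rw [h1, h2, integral_mul_fderiv_test hf hφ v]

theorem ae_mem_interior {μ : Measure (Pt d)} (hμ : μ ≪ volume) (K : Finset (Pt d)) :
    ∀ᵐ x ∂μ, x ∈ hull K → x ∈ interior (hull K) := by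
  have h : ∀ᵐ x, x ∉ frontier (hull K) :=
    measure_eq_zero_iff_ae_notMem.1 ((convex_convexHull ℝ _).addHaar_frontier volume)
  filter_upwards [hμ.ae_le h] with x hx hxK
  by_contra hne
  exact hx ⟨subset_closure hxK, hne⟩

theorem restrict_absolutelyContinuous (Ω : Set (Pt d)) : volume.restrict Ω ≪ volume :=
  Measure.absolutelyContinuous_of_le Measure.restrict_le_self

/-- A function with vanishing weak gradient on a convex open set is constant. -/
theorem exists_ae_eq_const {Ω U : Set (Pt d)} (hΩm : MeasurableSet Ω)
    (hb : Bornology.IsBounded Ω) (hUo : IsOpen U)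
    (hUc : Convex ℝ U) (hUΩ : U ⊆ Ω) {w : L2 Ω} (hw : HasWeakGradOn U w 0) :
    ∃ c : ℝ, ∀ᵐ x ∂(volume.restrict Ω), x ∈ U → w x = c := by
  rcases U.eq_empty_or_nonempty with rfl | hne
  · exact ⟨0, ae_of_all _ fun x hx => absurd hx (notMem_empty x)⟩
  have hfin := isFiniteMeasure_restrict hb
  have hwi : Integrable w (volume.restrict Ω) := (Lp.memLp w).integrable (by norm_num)
  set g : Pt d → ℝ := Ω.indicator w with hg
  have hgi : Integrable g volume := (integrable_indicator_iff hΩm).2 hwi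
  let ψ : ℕ → ContDiffBump (0 : Pt d) := fun n =>
    ⟨1 / (2 * ((n : ℝ) + 1)), 1 / ((n : ℝ) + 1), by positivity, by
      apply one_div_lt_one_div_of_lt (by positivity); linarith⟩
  have hrOut : Filter.Tendsto (fun n => (ψ n).rOut) Filter.atTop (nhds 0) :=
    tendsto_one_div_add_atTop_nhds_zero_nat
  have hae := ContDiffBump.ae_convolution_tendsto_right_of_locallyIntegrable (φ := ψ) (K := 2)
    hrOut (Filter.Eventually.of_forall fun n => by
      change 1 / ((n : ℝ) + 1) ≤ 2 * (1 / (2 * ((n : ℝ) + 1)))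
      exact le_of_eq (by field_simp)) hgi.locallyIntegrable
  have hconv : ∀ n x, convolution ((ψ n).normed volume) g (ContinuousLinearMap.lsmul ℝ ℝ) volume x =
      ∫ y in Ω, w y * (ψ n).normed volume (y - x) := by
    intro n x
    rw [convolution_eq_swap, ← integral_indicator hΩm]
    refine integral_congr_ae (ae_of_all _ fun y => ?_)
    simp only [ContinuousLinearMap.lsmul_apply, smul_eq_mul, hg]
    by_cases hy : y ∈ Ω
    · rw [indicator_of_mem hy, indicator_of_mem hy, mul_comm, ← (ψ n).normed_neg, neg_sub]
    · rw [indicator_of_notMem hy, indicator_of_notMem hy, mul_zero]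
  -- As the bump moves from `a` to `b` its support stays in the convex set `U`. The derivative of
  -- the average is the weak gradient tested with the bump and hence vanishes.
  have hconst : ∀ n a b, Metric.closedBall a (ψ n).rOut ⊆ U → Metric.closedBall b (ψ n).rOut ⊆ U →
      ∫ y in Ω, w y * (ψ n).normed volume (y - b) =
        ∫ y in Ω, w y * (ψ n).normed volume (y - a) := by
    intro n a b ha hb'
    have hψ : ContDiff ℝ 1 ((ψ n).normed volume) := (ψ n).contDiff_normed
    have hder : ∀ t ∈ Icc (0 : ℝ) 1, HasDerivAt (fun t : ℝ =>
        ∫ y in Ω, w y * (ψ n).normed volume (y - (a + t • (b - a)))) 0 t := by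
      intro t ht
      have h1 := Mesh.hasDerivAt_integral_translate hwi hψ (ψ n).hasCompactSupport_normed a (b - a) t
      have htest : IsTest U fun x => (ψ n).normed volume (x - (a + t • (b - a))) := by
        have hsub : tsupport (fun x => (ψ n).normed volume (x - (a + t • (b - a)))) ⊆
            Metric.closedBall (a + t • (b - a)) (ψ n).rOut := by
          refine closure_minimal (fun x hx => ?_) Metric.isClosed_closedBall
          have hx' : x - (a + t • (b - a)) ∈ Function.support ((ψ n).normed volume) := hx
          rw [(ψ n).support_normed_eq, mem_ball_zero_iff] at hx'
          rw [Metric.mem_closedBall, dist_eq_norm]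
          exact hx'.le
        refine ⟨(ψ n).contDiff_normed.comp (contDiff_id.sub contDiff_const), ?_, ?_⟩
        · exact (isCompact_closedBall _ _).of_isClosed_subset (isClosed_tsupport _) hsub
        · refine hsub.trans fun x hx => ?_
          rw [Metric.mem_closedBall, dist_eq_norm] at hx
          have e1 : a + (x - (a + t • (b - a))) ∈ U := ha (by simpa [dist_eq_norm] using hx)
          have e2 : b + (x - (a + t • (b - a))) ∈ U := hb' (by simpa [dist_eq_norm] using hx)
          have := hUc.add_smul_sub_mem e1 e2 ht
          convert this using 1
          module
      have h2 := hw _ htest (b - a)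
      have h3 : ∫ x in Ω, inner ℝ ((0 : L2Vec Ω) x) (b - a) *
          (ψ n).normed volume (x - (a + t • (b - a))) = 0 := by
        refine integral_eq_zero_of_ae ?_
        filter_upwards [Lp.coeFn_zero (Pt d) 2 (volume.restrict Ω)] with x hx
        rw [hx]; simp
      rw [h3] at h2
      rw [h2, neg_zero, neg_zero] at h1
      exact h1
    have := constant_of_has_deriv_right_zero
      (fun t ht => (hder t ht).continuousAt.continuousWithinAt)
      (fun t ht => (hder t ⟨ht.1, ht.2.le⟩).hasDerivWithinAt) 1 (right_mem_Icc.2 zero_le_one)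
    simpa using this
  have hball : ∀ x ∈ U, ∀ᶠ n in Filter.atTop, Metric.closedBall x (ψ n).rOut ⊆ U := by
    intro x hx
    obtain ⟨ε, hε, hsub⟩ := Metric.isOpen_iff.1 hUo x hx
    filter_upwards [hrOut.eventually (gt_mem_nhds hε)] with n hn
    exact (Metric.closedBall_subset_ball hn).trans hsub
  -- The constant is the value at one point where the mollifications converge; such a point exists
  -- because a nonempty open set has positive measure.
  obtain ⟨x₀, hx₀U, hx₀⟩ : ∃ x₀ ∈ U, Filter.Tendsto (fun n => convolution ((ψ n).normed volume) g
      (ContinuousLinearMap.lsmul ℝ ℝ) volume x₀) Filter.atTop (nhds (g x₀)) := by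
    by_contra! hcon
    have : volume U = 0 := measure_mono_null (fun x hx => hcon x hx) hae
    exact (hUo.measure_pos volume hne).ne' this
  refine ⟨g x₀, ?_⟩
  filter_upwards [ae_restrict_of_ae hae] with x hx hxU
  have hgx : g x = w x := indicator_of_mem (hUΩ hxU) _
  rw [← hgx]
  refine tendsto_nhds_unique (hx.congr' ?_) hx₀
  filter_upwards [hball x hxU, hball x₀ hx₀U] with n h1 h2
  rw [hconv, hconv, hconst n x₀ x h2 h1]

namespace Mesh

variable {Ω : Set (Pt d)} (M : Mesh Ω)

/-- For a fixed test function and direction the defining equation only pairs `w` and `G` with fixed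
`L²` functions, so it survives `L²` limits. -/
theorem isClosed_brokenGraph : IsClosed (M.brokenGraph : Set (L2 Ω × L2Vec Ω)) := by
  have : (M.brokenGraph : Set (L2 Ω × L2Vec Ω)) = ⋂ K ∈ M.elems, ⋂ (φ : Pt d → ℝ),
      ⋂ (_ : IsTest (interior (hull K)) φ), ⋂ v : Pt d, {q : L2 Ω × L2Vec Ω |
        ∫ x in Ω, q.1 x * fderiv ℝ φ x v = - ∫ x in Ω, inner ℝ (q.2 x) v * φ x} := by
    ext q
    simp only [mem_iInter]
    rfl
  rw [this]
  refine isClosed_biInter fun K _ => isClosed_iInter fun φ => isClosed_iInter fun hφ =>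
    isClosed_iInter fun v => ?_
  have hm1 := hφ.memLp_fderiv (volume.restrict Ω) v
  have hm2 : MemLp (fun x => φ x • v) 2 (volume.restrict Ω) := by
    refine Continuous.memLp_of_hasCompactSupport ?_ hφ.compact.smul_right
    exact hφ.contDiff.continuous.smul continuous_const
  have e1 : ∀ q : L2 Ω × L2Vec Ω, ∫ x in Ω, q.1 x * fderiv ℝ φ x v = inner ℝ hm1.toLp q.1 := by
    intro q
    rw [L2.inner_def]
    refine integral_congr_ae ?_
    filter_upwards [hm1.coeFn_toLp] with x hx
    rw [hx]; simp
  have e2 : ∀ q : L2 Ω × L2Vec Ω, ∫ x in Ω, inner ℝ (q.2 x) v * φ x = inner ℝ hm2.toLp q.2 := by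
    intro q
    rw [L2.inner_def]
    refine integral_congr_ae ?_
    filter_upwards [hm2.coeFn_toLp] with x hx
    rw [hx, real_inner_smul_left, real_inner_comm, mul_comm]
  simp_rw [e1, e2]
  exact isClosed_eq (by fun_prop) (by fun_prop)

theorem closure_testGraph_le (hΩ : IsLipschitzDomain Ω) :
    (testGraph Ω).topologicalClosure ≤ M.brokenGraph := by
  refine Submodule.topologicalClosure_minimal _ ?_ M.isClosed_brokenGraph
  rintro q ⟨φ, hφ, h1, h2⟩ K hK
  refine hasWeakGradOn_of_eq (M.interior_hull_subset hΩ hK) (hφ.contDiff.of_le (by simp)) ?_ ?_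
  · filter_upwards [h1] with x hx _ using hx
  · filter_upwards [h2] with x hx _ using hx

/-- The broken gradient of a piecewise continuously differentiable function. -/
theorem exists_brokenGrad (hΩ : IsLipschitzDomain Ω) {w : L2 Ω} {f : Finset (Pt d) → Pt d → ℝ}
    (hf : ∀ K ∈ M.elems, ContDiff ℝ 1 (f K))
    (hw : ∀ K ∈ M.elems, ∀ᵐ x ∂(volume.restrict Ω), x ∈ hull K → w x = f K x) :
    ∃ G : L2Vec Ω, (w, G) ∈ M.brokenGraph ∧
      ∀ K ∈ M.elems, ∀ᵐ x ∂(volume.restrict Ω), x ∈ hull K → G x = gradient (f K) x := by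
  have hfin := isFiniteMeasure_restrict hΩ.isBounded
  have hmem : MemLp (∑ K ∈ M.elems, (interior (hull K)).indicator (gradient (f K))) 2
      (volume.restrict Ω) := by
    refine memLp_finsetSum' _ fun K hK => ?_
    have hc := continuous_gradient (hf K hK)
    obtain ⟨C, hC⟩ := (isCompact_hull K).exists_bound_of_continuousOn hc.continuousOn
    refine MemLp.of_bound (hc.aestronglyMeasurable.indicator isOpen_interior.measurableSet) (max C 0)
      (ae_of_all _ fun x => ?_)
    by_cases hx : x ∈ interior (hull K)
    · rw [indicator_of_mem hx]; exact (hC x (interior_subset hx)).trans (le_max_left _ _)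
    · rw [indicator_of_notMem hx, norm_zero]; exact le_max_right _ _
  set G₀ : L2Vec Ω := hmem.toLp _ with hG₀
  have hG : ∀ K ∈ M.elems, ∀ᵐ x ∂(volume.restrict Ω), x ∈ hull K →
      G₀ x = gradient (f K) x := by
    intro K hK
    filter_upwards [hmem.coeFn_toLp, ae_mem_interior (restrict_absolutelyContinuous Ω) K]
      with x hx hint hxK
    rw [hx, Finset.sum_apply, Finset.sum_eq_single_of_mem K hK]
    · rw [indicator_of_mem (hint hxK)]
    · intro K' hK' hne
      refine indicator_of_notMem (fun hx' => hne ?_) _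
      exact (M.eq_of_mem_interior hK' hK hx' hxK)
  refine ⟨G₀, fun K hK => ?_, hG⟩
  refine hasWeakGradOn_of_eq (M.interior_hull_subset hΩ hK) (hf K hK) ?_ ?_
  · filter_upwards [hw K hK] with x hx hxK using hx (interior_subset hxK)
  · filter_upwards [hG K hK] with x hx hxK using hx (interior_subset hxK)

theorem mem_brokenH1_of_mem {w : L2 Ω} {G : L2Vec Ω} (h : (w, G) ∈ M.brokenGraph) :
    w ∈ M.brokenH1 := ⟨(w, G), h, rfl⟩

theorem mk_brokenGrad_mem (w : M.brokenH1) : ((w : L2 Ω), M.brokenGrad w) ∈ M.brokenGraph :=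
  Submodule.mem_graph_toLinearPMap (fun q hq h0 => M.brokenGraph_unique q hq h0) w

theorem brokenGrad_eq {w : M.brokenH1} {G : L2Vec Ω} (h : ((w : L2 Ω), G) ∈ M.brokenGraph) :
    M.brokenGrad w = G := by
  have h1 := M.brokenGraph.sub_mem (M.mk_brokenGrad_mem w) h
  have h2 := M.brokenGraph_unique _ h1 (by simp)
  simpa [sub_eq_zero] using h2

theorem form_apply (w w' : M.brokenH1) :
    M.form w w' = inner ℝ (M.brokenGrad w) (M.brokenGrad w') := rfl

theorem form_self (w : M.brokenH1) : M.form w w = ‖M.brokenGrad w‖ ^ 2 := by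
  rw [form_apply, real_inner_self_eq_norm_sq]

theorem energyNorm_eq (w : M.brokenH1) : energyNorm M.form w = ‖M.brokenGrad w‖ := by
  rw [energyNorm, form_self, Real.sqrt_sq (norm_nonneg _)]

theorem gradient_affine (p : Pt d →ᵃ[ℝ] ℝ) (x : Pt d) : gradient p x = affGrad p :=
  ext_inner_right ℝ fun w => by rw [inner_gradient, fderiv_affine]

theorem H10_sup_crSpace_le (hΩ : IsLipschitzDomain Ω) : H10 Ω ⊔ M.crSpace ≤ M.brokenH1 := by
  refine sup_le ?_ ?_
  · rintro u ⟨q, hq, rfl⟩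
    exact ⟨q, M.closure_testGraph_le hΩ hq, rfl⟩
  · rintro s ⟨p, hp, -⟩
    obtain ⟨G, hG, -⟩ := M.exists_brokenGrad hΩ (f := fun K => p K)
      (fun K _ => (contDiff_affine (p K)).of_le (by simp)) hp
    exact M.mem_brokenH1_of_mem hG

/-! ### Face integrals of functions in `H¹₀` -/

theorem inter_hull_ae_eq (hΩ : IsLipschitzDomain Ω) {K : Finset (Pt d)} (hK : K ∈ M.elems) :
    (Ω ∩ hull K : Set (Pt d)) =ᵐ[volume] hull K := by
  filter_upwards [ae_mem_interior Measure.AbsolutelyContinuous.rfl K] with x hx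
  refine propext ⟨fun h => h.2, fun h => ⟨M.interior_hull_subset hΩ hK (hx h), h⟩⟩

/-- Weighted face integrals are continuous functionals of the function and its gradient on an
element. -/
theorem exists_face_functional (hΩ : IsLipschitzDomain Ω) (hd : 1 ≤ d) {F K : Finset (Pt d)}
    {z : Pt d} (hK : K ∈ M.elems) (h : IsFaceOf F K z) (η : Pt d →ᵃ[ℝ] ℝ) :
    ∃ (A : L2Vec Ω) (b : L2 Ω), ∀ (w : L2 Ω) (G : L2Vec Ω) (f : Pt d → ℝ), ContDiff ℝ 1 f →
      (∀ᵐ x ∂(volume.restrict Ω), x ∈ hull K → w x = f x) →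
      (∀ᵐ x ∂(volume.restrict Ω), x ∈ hull K → G x = gradient f x) →
      inner ℝ A G + inner ℝ b w = faceIntegral F (fun x => f x * η x) := by
  have hfin := isFiniteMeasure_restrict hΩ.isBounded
  have hmK := (isClosed_hull K).measurableSet
  have hηc := AffineMap.continuous_real η
  have hmem : ∀ {E : Type} [NormedAddCommGroup E] {f : Pt d → E} [SecondCountableTopology E],
      Continuous f → MemLp ((hull K).indicator f) 2 (volume.restrict Ω) := by
    intro E _ f _ hc
    obtain ⟨C, hC⟩ := (isCompact_hull K).exists_bound_of_continuousOn hc.continuousOn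
    refine MemLp.of_bound (hc.aestronglyMeasurable.indicator hmK) (max C 0)
      (ae_of_all _ fun x => ?_)
    by_cases hx : x ∈ hull K
    · rw [indicator_of_mem hx]; exact (hC x hx).trans (le_max_left _ _)
    · rw [indicator_of_notMem hx, norm_zero]; exact le_max_right _ _
  -- The product rule in the cone formula for `f η` splits the face integral into pairings of `∇f`
  -- with `η (x - z)` and of `f` with `∇η · (x - z) + d η`. Both fixed factors are bounded on `K`.
  have hA := hmem (f := fun x => η x • (x - z)) (by fun_prop)
  have hb := hmem (f := fun x => inner ℝ (affGrad η) (x - z) + d * η x) (by fun_prop)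
  have hg := h.norm_affGrad_bary_pos hd
  set g := ‖affGrad (bary K z)‖ with hgdef
  refine ⟨g • hA.toLp, g • hb.toLp, fun w G f hf hw hG => ?_⟩
  have hfη : ContDiff ℝ 1 fun x => f x * η x := hf.mul ((contDiff_affine η).of_le (by simp))
  have key := h.integral_cone hd hfη
  rw [real_inner_smul_left, real_inner_smul_left, ← mul_add,
    show inner ℝ hA.toLp G + inner ℝ hb.toLp w =
      ∫ x in hull K, (fderiv ℝ (fun x => f x * η x) x (x - z) + d * (f x * η x)) from ?_, key,
    mul_inv_cancel_left₀ hg.ne']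
  rw [L2.inner_def, L2.inner_def, ← integral_add (L2.integrable_inner _ _)
    (L2.integrable_inner _ _), ← setIntegral_congr_set (M.inter_hull_ae_eq hΩ hK),
    ← setIntegral_indicator hmK]
  refine integral_congr_ae ?_
  filter_upwards [hA.coeFn_toLp, hb.coeFn_toLp, hw, hG] with x h1 h2 h3 h4
  rw [h1, h2]
  by_cases hx : x ∈ hull K
  · rw [indicator_of_mem hx, indicator_of_mem hx, indicator_of_mem hx, h3 hx, h4 hx,
      fderiv_fun_mul (hf.differentiable (by simp) x) (hasFDerivAt_affine η x).differentiableAt]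
    simp only [add_apply, smul_apply, smul_eq_mul,
      fderiv_affine, ← inner_gradient f, real_inner_smul_left]
    rw [real_inner_comm (gradient f x)]
    simp
    ring
  · rw [indicator_of_notMem hx, indicator_of_notMem hx, indicator_of_notMem hx]; simp

/-- A piecewise affine function in `H¹₀` has no jumps. -/
theorem faceIntegral_eq_of_mem_H10 (hΩ : IsLipschitzDomain Ω) (hd : 1 ≤ d) {u : L2 Ω}
    (hu : u ∈ H10 Ω) {p : Finset (Pt d) → Pt d →ᵃ[ℝ] ℝ}
    (hp : ∀ K ∈ M.elems, M.AgreesOn u K (p K)) {F K K' : Finset (Pt d)} {z z' : Pt d}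
    (hK : K ∈ M.elems) (hK' : K' ∈ M.elems) (h : IsFaceOf F K z) (h' : IsFaceOf F K' z')
    (η : Pt d →ᵃ[ℝ] ℝ) :
    faceIntegral F (fun x => p K x * η x) = faceIntegral F (fun x => p K' x * η x) := by
  obtain ⟨⟨u', G⟩, hq, rfl⟩ := hu
  obtain ⟨G', hG', hGp⟩ := M.exists_brokenGrad hΩ (f := fun K => p K)
    (fun K _ => (contDiff_affine (p K)).of_le (by simp)) hp
  have hGG : G = G' := by
    have h1 := M.brokenGraph.sub_mem (M.closure_testGraph_le hΩ hq) hG'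
    have h2 := M.brokenGraph_unique _ h1 (by simp)
    simpa [sub_eq_zero] using h2
  subst hGG
  obtain ⟨A, b, hAb⟩ := M.exists_face_functional hΩ hd hK h η
  obtain ⟨A', b', hAb'⟩ := M.exists_face_functional hΩ hd hK' h' η
  have hc : ∀ p : Pt d →ᵃ[ℝ] ℝ, ContDiff ℝ 1 p := fun p => (contDiff_affine p).of_le (by simp)
  rw [← hAb _ G _ (hc (p K)) (hp K hK) (hGp K hK),
    ← hAb' _ G _ (hc (p K')) (hp K' hK') (hGp K' hK')]
  -- For a test function both sides are the same face integral, and the set of pairs for which they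
  -- agree is closed. So equality extends to `H¹₀`.
  have hcl : IsClosed {q : L2 Ω × L2Vec Ω |
      inner ℝ A q.2 + inner ℝ b q.1 = inner ℝ A' q.2 + inner ℝ b' q.1} :=
    isClosed_eq (by fun_prop) (by fun_prop)
  refine closure_minimal (fun q hq => ?_) hcl hq
  obtain ⟨φ, hφ, h1, h2⟩ := hq
  have hφ1 : ContDiff ℝ 1 φ := hφ.contDiff.of_le (by simp)
  simp only [mem_ofPred_eq]
  rw [hAb _ _ φ hφ1 (h1.mono fun _ h _ => h) (h2.mono fun _ h _ => h),
    hAb' _ _ φ hφ1 (h1.mono fun _ h _ => h) (h2.mono fun _ h _ => h)]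

/-- A piecewise affine function in `H¹₀` vanishes on boundary faces. -/
theorem faceIntegral_eq_zero_of_mem_H10 (hΩ : IsLipschitzDomain Ω) (hd : 1 ≤ d) {u : L2 Ω}
    (hu : u ∈ H10 Ω) {p : Finset (Pt d) → Pt d →ᵃ[ℝ] ℝ}
    (hp : ∀ K ∈ M.elems, M.AgreesOn u K (p K)) {F K : Finset (Pt d)} {z : Pt d}
    (hK : K ∈ M.elems) (h : IsFaceOf F K z) (hF : M.IsBoundaryFace F) (η : Pt d →ᵃ[ℝ] ℝ) :
    faceIntegral F (fun x => p K x * η x) = 0 := by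
  obtain ⟨⟨u', G⟩, hq, rfl⟩ := hu
  obtain ⟨G', hG', hGp⟩ := M.exists_brokenGrad hΩ (f := fun K => p K)
    (fun K _ => (contDiff_affine (p K)).of_le (by simp)) hp
  have hGG : G = G' := by
    have h1 := M.brokenGraph.sub_mem (M.closure_testGraph_le hΩ hq) hG'
    have h2 := M.brokenGraph_unique _ h1 (by simp)
    simpa [sub_eq_zero] using h2
  subst hGG
  obtain ⟨A, b, hAb⟩ := M.exists_face_functional hΩ hd hK h η
  rw [← hAb _ G _ ((contDiff_affine (p K)).of_le (by simp)) (hp K hK) (hGp K hK)]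
  have hcl : IsClosed {q : L2 Ω × L2Vec Ω | inner ℝ A q.2 + inner ℝ b q.1 = 0} :=
    isClosed_eq (by fun_prop) (by fun_prop)
  refine closure_minimal (fun q hq => ?_) hcl hq
  obtain ⟨φ, hφ, h1, h2⟩ := hq
  simp only [mem_ofPred_eq]
  rw [hAb _ _ φ (hφ.contDiff.of_le (by simp)) (h1.mono fun _ h _ => h) (h2.mono fun _ h _ => h)]
  refine setIntegral_eq_zero_of_forall_eq_zero fun x hx => ?_
  rw [hφ.eq_zero fun hxΩ => (hF hx).2 (by rwa [hΩ.isOpen.interior_eq]), zero_mul]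

end Mesh

/-! ### The scalar product on `V + S` -/

theorem affine_eq_of_eqOn_open {U : Set (Pt d)} (hU : IsOpen U) (hne : U.Nonempty)
    {p q : Pt d →ᵃ[ℝ] ℝ} (h : EqOn p q U) : p = q := by
  obtain ⟨c, hc⟩ := hne
  ext x
  have hline : Continuous fun t : ℝ => c + t • (x - c) := by fun_prop
  have ev : ∀ᶠ t in nhds (0 : ℝ), c + t • (x - c) ∈ U :=
    hline.continuousAt.eventually (hU.mem_nhds (by simpa using hc))
  obtain ⟨t, htU, ht⟩ := ((ev.filter_mono nhdsWithin_le_nhds).and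
    (self_mem_nhdsWithin : Ioi (0 : ℝ) ∈ nhdsWithin 0 (Ioi 0))).exists
  have h1 := h htU
  rw [affine_add_smul_sub, affine_add_smul_sub, h hc, add_right_inj] at h1
  have h2 := mul_left_cancel₀ (ne_of_gt ht) h1
  linarith

theorem IsFaceOf.faceIntegral_sub {F K : Finset (Pt d)} {z : Pt d} (h : IsFaceOf F K z)
    {f g : Pt d → ℝ} (hf : Continuous f) (hg : Continuous g) :
    faceIntegral F (fun x => f x - g x) = faceIntegral F f - faceIntegral F g :=
  integral_sub (h.integrable hf) (h.integrable hg)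

theorem IsFaceOf.faceIntegral_add {F K : Finset (Pt d)} {z : Pt d} (h : IsFaceOf F K z)
    {f g : Pt d → ℝ} (hf : Continuous f) (hg : Continuous g) :
    faceIntegral F (fun x => f x + g x) = faceIntegral F f + faceIntegral F g :=
  integral_add (h.integrable hf) (h.integrable hg)

theorem faceIntegral_const (F : Finset (Pt d)) (c : ℝ) :
    faceIntegral F (fun _ => c) = c * faceArea F := by
  rw [faceIntegral, setIntegral_const, smul_eq_mul, mul_comm]; rfl

theorem faceIntegral_const_mul (F : Finset (Pt d)) (c : ℝ) (f : Pt d → ℝ) :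
    faceIntegral F (fun x => c * f x) = c * faceIntegral F f := integral_const_mul _ _

theorem faceIntegral_congr {F : Finset (Pt d)} {f g : Pt d → ℝ} (h : ∀ x ∈ hull F, f x = g x) :
    faceIntegral F f = faceIntegral F g :=
  setIntegral_congr_fun (isClosed_hull F).measurableSet h

theorem exists_notMem_closure (hd : 1 ≤ d) {Ω : Set (Pt d)} (hb : Bornology.IsBounded Ω) :
    ∃ b, b ∉ closure Ω := by
  obtain ⟨R, hR⟩ := hb.closure.subset_closedBall 0
  refine ⟨(|R| + 1) • EuclideanSpace.single (⟨0, hd⟩ : Fin d) (1 : ℝ), fun hmem => ?_⟩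
  have := hR hmem
  rw [mem_closedBall_zero_iff, norm_smul, Real.norm_of_nonneg (by positivity)] at this
  simp at this
  linarith [le_abs_self R]

namespace Mesh

variable {Ω : Set (Pt d)} (M : Mesh Ω)

/-- The interior of an element is a nonempty open part of `Ω`, so values almost everywhere fix the
affine function. Thus the choice in `piece` is immaterial. -/
theorem AgreesOn.unique (hΩ : IsLipschitzDomain Ω) {s : Pt d → ℝ} {K : Finset (Pt d)}
    (hK : K ∈ M.elems) {p q : Pt d →ᵃ[ℝ] ℝ} (hp : M.AgreesOn s K p) (hq : M.AgreesOn s K q) :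
    p = q := by
  refine affine_eq_of_eqOn_open isOpen_interior (M.isSimplex hK).exists_mem_interior ?_
  refine Measure.eqOn_open_of_ae_eq (μ := volume) ?_ isOpen_interior
    (AffineMap.continuous_real p).continuousOn (AffineMap.continuous_real q).continuousOn
  have h1 : ∀ᵐ x ∂(volume.restrict (interior (hull K))), x ∈ hull K → s x = p x :=
    ae_restrict_of_ae_restrict_of_subset (M.interior_hull_subset hΩ hK) hp
  have h2 : ∀ᵐ x ∂(volume.restrict (interior (hull K))), x ∈ hull K → s x = q x :=
    ae_restrict_of_ae_restrict_of_subset (M.interior_hull_subset hΩ hK) hq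
  filter_upwards [h1, h2, ae_restrict_mem isOpen_interior.measurableSet] with x h1 h2 hx
  rw [← h1 (interior_subset hx), h2 (interior_subset hx)]

theorem piece_eq (hΩ : IsLipschitzDomain Ω) {s : Pt d → ℝ} {K : Finset (Pt d)} (hK : K ∈ M.elems)
    {p : Pt d →ᵃ[ℝ] ℝ} (hp : M.AgreesOn s K p) : M.piece s K = p := by
  have h : ∃ p, M.AgreesOn s K p := ⟨p, hp⟩
  rw [piece, dif_pos h]
  exact AgreesOn.unique M hΩ hK h.choose_spec hp

theorem agreesOn_piece (hΩ : IsLipschitzDomain Ω) {s : L2 Ω} (hs : s ∈ M.crSpace)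
    {K : Finset (Pt d)} (hK : K ∈ M.elems) : M.AgreesOn s K (M.piece s K) := by
  obtain ⟨p, hp, -⟩ := hs
  rw [M.piece_eq hΩ hK (hp K hK)]
  exact hp K hK

theorem jumpsVanish_piece (hΩ : IsLipschitzDomain Ω) {s : L2 Ω} (hs : s ∈ M.crSpace) :
    M.JumpsVanish (M.piece s) := by
  obtain ⟨p, hp, hj⟩ := hs
  have e : ∀ K ∈ M.elems, M.piece s K = p K := fun K hK => M.piece_eq hΩ hK (hp K hK)
  intro F hF
  refine ⟨fun hb K hK K' hK' h h' => ?_, fun hb K hK h => ?_⟩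
  · rw [e K hK, e K' hK']; exact (hj F hF).1 hb K hK K' hK' h h'
  · rw [e K hK]; exact (hj F hF).2 hb K hK h

theorem piece_add (hΩ : IsLipschitzDomain Ω) {s t : L2 Ω} (hs : s ∈ M.crSpace) (ht : t ∈ M.crSpace)
    {K : Finset (Pt d)} (hK : K ∈ M.elems) :
    M.piece (s + t : L2 Ω) K = M.piece s K + M.piece t K := by
  refine M.piece_eq hΩ hK ?_
  filter_upwards [Lp.coeFn_add s t, M.agreesOn_piece hΩ hs hK, M.agreesOn_piece hΩ ht hK]
    with x hx h1 h2 hxK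
  rw [hx, Pi.add_apply, h1 hxK, h2 hxK]; rfl

theorem piece_smul (hΩ : IsLipschitzDomain Ω) {s : L2 Ω} (hs : s ∈ M.crSpace) (c : ℝ)
    {K : Finset (Pt d)} (hK : K ∈ M.elems) :
    M.piece (c • s : L2 Ω) K = c • M.piece s K := by
  refine M.piece_eq hΩ hK ?_
  filter_upwards [Lp.coeFn_smul c s, M.agreesOn_piece hΩ hs hK] with x hx h1 hxK
  rw [hx, Pi.smul_apply, h1 hxK]; rfl

theorem ae_exists_mem_hull : ∀ᵐ x ∂(volume.restrict Ω), ∃ K ∈ M.elems, x ∈ hull K := by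
  have : ∀ᵐ x ∂(volume.restrict (closure Ω)), x ∈ closure Ω :=
    ae_restrict_mem isClosed_closure.measurableSet
  filter_upwards [ae_restrict_of_ae_restrict_of_subset subset_closure this] with x hx
  exact M.exists_mem_hull hx

theorem ae_of_forall_elems {P : Pt d → Prop}
    (h : ∀ K ∈ M.elems, ∀ᵐ x ∂(volume.restrict Ω), x ∈ hull K → P x) :
    ∀ᵐ x ∂(volume.restrict Ω), P x := by
  filter_upwards [(Finset.eventually_all M.elems).2 h, M.ae_exists_mem_hull] with x h1 ⟨K, hK, hx⟩
  exact h1 K hK hx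

/-- The broken gradient is injective on `V + S`. -/
theorem eq_zero_of_brokenGrad_eq_zero (hΩ : IsLipschitzDomain Ω) (hd : 1 ≤ d) {u s : L2 Ω}
    (hu : u ∈ H10 Ω) (hs : s ∈ M.crSpace) (h0 : (u + s, (0 : L2Vec Ω)) ∈ M.brokenGraph) :
    u + s = 0 := by
  classical
  have hconst : ∀ K : Finset (Pt d), ∃ c : ℝ, K ∈ M.elems →
      ∀ᵐ x ∂(volume.restrict Ω), x ∈ hull K → (u + s : L2 Ω) x = c := by
    intro K
    by_cases hK : K ∈ M.elems
    · obtain ⟨c, hc⟩ := exists_ae_eq_const hΩ.isOpen.measurableSet hΩ.isBounded isOpen_interior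
        (convex_convexHull ℝ _).interior (M.interior_hull_subset hΩ hK) (h0 K hK)
      refine ⟨c, fun _ => ?_⟩
      filter_upwards [hc, ae_mem_interior (restrict_absolutelyContinuous Ω) K] with x h1 h2 hx
      exact h1 (h2 hx)
    · exact ⟨0, fun h => absurd h hK⟩
  choose c hc using hconst
  -- With `u + s = c K` on `K`, the function `u` itself is piecewise affine. The weight 1 then
  -- compares the means of `u` and `s` on faces, which forces equal constants across interior faces
  -- and zero at boundary faces.
  set q : Finset (Pt d) → Pt d →ᵃ[ℝ] ℝ := fun K =>
    AffineMap.const ℝ (Pt d) (c K) - M.piece s K with hq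
  have hqu : ∀ K ∈ M.elems, M.AgreesOn u K (q K) := by
    intro K hK
    filter_upwards [hc K hK, Lp.coeFn_add u s, M.agreesOn_piece hΩ hs hK] with x h1 h2 h3 hx
    have h1 := h1 hx
    rw [h2, Pi.add_apply, h3 hx] at h1
    simp only [hq, AffineMap.coe_sub, Pi.sub_apply, AffineMap.const_apply]
    linarith
  have hcont : ∀ p : Pt d →ᵃ[ℝ] ℝ, Continuous p := AffineMap.continuous_real
  have hj := M.jumpsVanish_piece hΩ hs
  have hqint : ∀ {F K z}, IsFaceOf F K z →
      faceIntegral F (fun x => q K x * AffineMap.const ℝ (Pt d) (1 : ℝ) x) =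
        c K * faceArea F - faceIntegral F (M.piece s K) := by
    intro F K z h
    rw [← faceIntegral_const, ← h.faceIntegral_sub continuous_const (hcont _)]
    simp [hq]
  have hinner : ∀ {F K K' z z'}, K ∈ M.elems → K' ∈ M.elems → IsFaceOf F K z → IsFaceOf F K' z' →
      ¬ M.IsBoundaryFace F → c K = c K' := by
    intro F K K' z z' hK hK' h h' hb
    have h1 := M.faceIntegral_eq_of_mem_H10 hΩ hd hu hqu hK hK' h h' (AffineMap.const ℝ (Pt d) 1)
    rw [hqint h, hqint h'] at h1
    have h2 := (hj F (M.mem_faces_of_isFaceOf hK h)).1 hb K hK K' hK' h.subset h'.subset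
    rw [h.faceIntegral_sub (hcont _) (hcont _)] at h2
    have h3 : c K * faceArea F = c K' * faceArea F := by linarith
    exact mul_right_cancel₀ (h.faceArea_pos hd).ne' h3
  have hbd : ∀ {F K z}, K ∈ M.elems → IsFaceOf F K z → M.IsBoundaryFace F → c K = 0 := by
    intro F K z hK h hb
    have h1 := M.faceIntegral_eq_zero_of_mem_H10 hΩ hd hu hqu hK h hb (AffineMap.const ℝ (Pt d) 1)
    rw [hqint h, (hj F (M.mem_faces_of_isFaceOf hK h)).2 hb K hK h.subset, sub_zero] at h1
    exact (mul_eq_zero.1 h1).resolve_right (h.faceArea_pos hd).ne'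
  -- The elements with nonzero constant share all their faces among themselves. If there were one,
  -- they would cover the whole space.
  have hzero : ∀ K ∈ M.elems, c K = 0 := by
    intro K₀ hK₀
    by_contra hne
    obtain ⟨b, hb⟩ := exists_notMem_closure hd hΩ.isBounded
    obtain ⟨K, hK, hbK⟩ := M.exists_mem_hull_of_shared hd (T := M.elems.filter fun K => c K ≠ 0)
      (B := univ) (Finset.filter_subset _ _) isOpen_univ convex_univ (by
        intro K hK F z h _
        obtain ⟨hKM, hcK⟩ := Finset.mem_filter.1 hK
        have hnb : ¬ M.IsBoundaryFace F := fun hb => hcK (hbd hKM h hb)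
        obtain ⟨K', hK', hne, hFK'⟩ := M.exists_neighbour hΩ hd hKM h hnb
        obtain ⟨z', h'⟩ := (M.isSimplex hK').exists_isFaceOf hFK' h.card_eq
        refine ⟨K', Finset.mem_filter.2 ⟨hK', ?_⟩, hne, hFK'⟩
        rwa [← hinner hKM hK' h h' hnb]) (Finset.mem_filter.2 ⟨hK₀, hne⟩)
      (by simpa using (M.isSimplex hK₀).exists_mem_interior) (mem_univ b)
    exact hb (M.hull_subset_closure (Finset.mem_filter.1 hK).1 hbK)
  rw [Lp.eq_zero_iff_ae_eq_zero]
  refine M.ae_of_forall_elems fun K hK => ?_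
  filter_upwards [hc K hK] with x hx hxK
  rw [hx hxK, hzero K hK]; rfl

theorem isScalarProductOn (hΩ : IsLipschitzDomain Ω) (hd : 1 ≤ d) :
    IsScalarProductOn M.form (M.V ⊔ M.S) where
  symm u _ v _ := by rw [form_apply, form_apply, real_inner_comm]
  pos w hw hne := by
    rw [form_self]
    refine pow_pos (norm_pos_iff.2 fun h0 => hne ?_) 2
    obtain ⟨u, hu, s, hs, rfl⟩ := Submodule.mem_sup.1 hw
    have := M.mk_brokenGrad_mem (u + s)
    rw [h0] at this
    exact Subtype.ext (M.eq_zero_of_brokenGrad_eq_zero hΩ hd hu hs this)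

/-- The values of the affine pieces in the vertices of their elements are finitely many numbers that
determine the function. -/
theorem finiteDimensional_S (hΩ : IsLipschitzDomain Ω) : FiniteDimensional ℝ M.S := by
  let f : M.S →ₗ[ℝ] ((K : M.elems) × (K : Finset (Pt d))) → ℝ :=
    { toFun := fun s i => M.piece ((s : M.brokenH1) : L2 Ω) i.1 i.2
      map_add' := fun s t => by
        ext i
        have := M.piece_add hΩ s.2 t.2 i.1.2
        exact congrArg (fun p : Pt d →ᵃ[ℝ] ℝ => p i.2) this
      map_smul' := fun c s => by
        ext i
        have := M.piece_smul hΩ s.2 c i.1.2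
        exact congrArg (fun p : Pt d →ᵃ[ℝ] ℝ => p i.2) this }
  refine FiniteDimensional.of_injective f ((injective_iff_map_eq_zero f).2 fun s hs => ?_)
  have hp : ∀ K ∈ M.elems, M.piece ((s : M.brokenH1) : L2 Ω) K = 0 := fun K hK =>
    (M.isSimplex hK).affine_ext fun y hy => congrFun hs ⟨⟨K, hK⟩, ⟨y, hy⟩⟩
  refine Subtype.ext (Subtype.ext ?_)
  change ((s : M.brokenH1) : L2 Ω) = 0
  rw [Lp.eq_zero_iff_ae_eq_zero]
  refine M.ae_of_forall_elems fun K hK => ?_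
  have hs' : ((s : M.brokenH1) : L2 Ω) ∈ M.crSpace := s.2
  filter_upwards [M.agreesOn_piece hΩ hs' hK] with x hx hxK
  rw [hx hxK, hp K hK]; rfl

end Mesh

/-! ### The smoothing operator in terms of the affine pieces -/

namespace Mesh

variable {Ω : Set (Pt d)} (M : Mesh Ω)

/-- Piecewise continuously differentiable functions that vanish outside of the domain are Lipschitz
continuous. -/
theorem exists_lipschitzWith (hΩ : IsLipschitzDomain Ω) {f : Pt d → ℝ}
    {q : Finset (Pt d) → Pt d → ℝ} (hq : ∀ K ∈ M.elems, ContDiff ℝ 1 (q K))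
    (hf : ∀ K ∈ M.elems, ∀ x ∈ hull K, f x = q K x) (h0 : ∀ x, x ∉ Ω → f x = 0) :
    ∃ L, LipschitzWith L f := by
  have hex : ∀ K : Finset (Pt d), ∃ L : NNReal, K ∈ M.elems → ∀ x ∈ hull K, ∀ y ∈ hull K,
      |q K y - q K x| ≤ L * dist y x := by
    intro K
    by_cases hK : K ∈ M.elems
    · obtain ⟨C, hC⟩ := (isCompact_hull K).exists_bound_of_continuousOn
        ((hq K hK).continuous_fderiv (by simp)).continuousOn
      refine ⟨C.toNNReal, fun _ x hx y hy => ?_⟩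
      have := (convex_convexHull ℝ (K : Set (Pt d))).norm_image_sub_le_of_norm_fderiv_le
        (fun x _ => (hq K hK).differentiable (by simp) x) hC hx hy
      rw [Real.norm_eq_abs, ← dist_eq_norm] at this
      refine this.trans ?_
      gcongr
      exact Real.le_coe_toNNReal C
    · exact ⟨0, fun h => absurd h hK⟩
  choose L hL using hex
  refine ⟨∑ K ∈ M.elems, L K, lipschitzWith_of_eventually fun x => ?_⟩
  -- Every element through a point `y` close to `x` contains `x` as well, so the two values can be
  -- compared within one element. The sum of the local constants serves all elements.
  have ev1 : ∀ᶠ y in nhds x, ∀ K ∈ M.elems, y ∈ hull K → x ∈ hull K := by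
    refine (Finset.eventually_all M.elems).2 fun K _ => ?_
    by_cases hx : x ∈ hull K
    · exact Filter.Eventually.of_forall fun _ _ => hx
    · filter_upwards [(isClosed_hull K).isOpen_compl.mem_nhds hx] with y hy hy'
      exact absurd hy' hy
  have ev2 : ∀ᶠ y in nhds x, x ∈ Ω → y ∈ Ω := by
    by_cases hx : x ∈ Ω
    · filter_upwards [hΩ.isOpen.mem_nhds hx] with y hy _ using hy
    · exact Filter.Eventually.of_forall fun _ h => absurd h hx
  filter_upwards [ev1, ev2] with y h1 h2
  by_cases hy : y ∈ closure Ω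
  · obtain ⟨K, hK, hyK⟩ := M.exists_mem_hull hy
    have hxK := h1 K hK hyK
    rw [hf K hK y hyK, hf K hK x hxK]
    refine (hL K hK x hxK y hyK).trans ?_
    gcongr
    exact Finset.single_le_sum (f := L) (fun _ _ => zero_le) hK
  · have hx : x ∉ Ω := fun hx => hy (subset_closure (h2 hx))
    rw [h0 x hx, h0 y fun h => hy (subset_closure h)]
    simp only [sub_self, abs_zero]
    positivity

theorem mem_interiorVertices_iff {z : Pt d} :
    z ∈ M.interiorVertices ↔ (∃ K ∈ M.elems, z ∈ K) ∧ z ∈ Ω := by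
  simp [interiorVertices]

theorem IsNodeChoice.mem {Kz : Pt d → Finset (Pt d)} (hKz : M.IsNodeChoice Kz) {z : Pt d}
    (hz : z ∈ M.interiorVertices) : Kz z ∈ M.elems ∧ z ∈ Kz z := by
  obtain ⟨h1, h2⟩ := hKz z hz
  obtain ⟨⟨K, hK, hzK⟩, -⟩ := M.mem_interiorVertices_iff.1 hz
  exact ⟨h1, M.mem_of_mem_hull hK h1 hzK h2⟩

variable (Kz : Pt d → Finset (Pt d)) (p : Finset (Pt d) → Pt d →ᵃ[ℝ] ℝ)

/-- The nodal average of the piecewise affine function `p` on the element `K`. -/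
def avgPiece (K : Finset (Pt d)) : Pt d →ᵃ[ℝ] ℝ :=
  ∑ z ∈ M.interiorVertices, p (Kz z) z • bary K z

/-- An element that contains the face `F`. -/
def faceElem (F : Finset (Pt d)) : Finset (Pt d) :=
  open Classical in if h : ∃ K ∈ M.elems, F ⊆ K then h.choose else ∅

/-- The coefficient of the bubble function of the face `F`. -/
def bubbleCoef (F : Finset (Pt d)) : ℝ :=
  faceIntegral F (fun x => p (M.faceElem F) x - M.avgPiece Kz p (M.faceElem F) x)

/-- The smoothing operator applied to the piecewise affine function `p`. -/
def smoothFun (x : Pt d) : ℝ :=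
  ∑ z ∈ M.interiorVertices, p (Kz z) z * M.hat z x +
    ∑ F ∈ M.interiorFaces, M.bubbleCoef Kz p F * M.normBubble F x

/-- The restriction of `smoothFun` to the element `K`, as a polynomial. -/
def smoothPiece (K : Finset (Pt d)) (x : Pt d) : ℝ :=
  M.avgPiece Kz p K x + ∑ F ∈ M.interiorFaces, M.bubbleCoef Kz p F *
    ((faceIntegral F (M.bubble F))⁻¹ * ∏ z ∈ F, bary K z x)

theorem avgPiece_apply (K : Finset (Pt d)) (x : Pt d) :
    M.avgPiece Kz p K x = ∑ z ∈ M.interiorVertices, p (Kz z) z * bary K z x :=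
  sum_smul_apply _ _ _ _

theorem avgPiece_eq {K : Finset (Pt d)} (hK : K ∈ M.elems) {x : Pt d} (hx : x ∈ hull K) :
    M.avgPiece Kz p K x = ∑ z ∈ M.interiorVertices, p (Kz z) z * M.hat z x := by
  rw [avgPiece_apply]
  exact Finset.sum_congr rfl fun z _ => by rw [M.hat_eq hK z hx]

theorem smoothFun_eq {K : Finset (Pt d)} (hK : K ∈ M.elems) {x : Pt d} (hx : x ∈ hull K) :
    M.smoothFun Kz p x = M.smoothPiece Kz p K x := by
  rw [smoothFun, smoothPiece, M.avgPiece_eq Kz p hK hx]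
  congr 1
  exact Finset.sum_congr rfl fun F _ => by rw [normBubble, M.bubble_eq hK F hx]

theorem contDiff_smoothPiece (K : Finset (Pt d)) : ContDiff ℝ 1 (M.smoothPiece Kz p K) := by
  have h : ∀ q : Pt d →ᵃ[ℝ] ℝ, ContDiff ℝ 1 q := fun q => (contDiff_affine q).of_le (by simp)
  refine (h _).add (ContDiff.sum fun F _ => contDiff_const.mul (contDiff_const.mul ?_))
  exact contDiff_prod fun z _ => h _

theorem smoothFun_eq_zero (hΩ : IsLipschitzDomain Ω) (hd : 1 ≤ d) {x : Pt d} (hx : x ∉ Ω) :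
    M.smoothFun Kz p x = 0 := by
  rw [smoothFun, Finset.sum_eq_zero, Finset.sum_eq_zero, add_zero]
  · intro F hF
    rw [normBubble, M.bubble_eq_zero_of_notMem hΩ hd hF hx, mul_zero, mul_zero]
  · intro z hz
    rw [M.hat_eq_zero_of_notMem hΩ (M.mem_interiorVertices_iff.1 hz).2 hx, mul_zero]

variable {Kz p}

theorem exists_isFaceOf_of_mem_faces {F : Finset (Pt d)} (hF : F ∈ M.faces) :
    M.faceElem F ∈ M.elems ∧ ∃ z, IsFaceOf F (M.faceElem F) z := by
  obtain ⟨K, hK, hFK, hc⟩ := M.mem_faces_iff.1 hF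
  have h : ∃ K ∈ M.elems, F ⊆ K := ⟨K, hK, hFK⟩
  rw [faceElem, dif_pos h]
  exact ⟨h.choose_spec.1, (M.isSimplex h.choose_spec.1).exists_isFaceOf h.choose_spec.2 hc⟩

theorem mem_faces_of_mem_interiorFaces {F : Finset (Pt d)} (hF : F ∈ M.interiorFaces) :
    F ∈ M.faces := (M.mem_interiorFaces_iff.1 hF).1

/-- The moments in `smoother` refer to the affine pieces of `σ - A₁σ`. By uniqueness of pieces these
are the differences that define `bubbleCoef`. -/
theorem smoother_eq (hΩ : IsLipschitzDomain Ω) {s : L2 Ω} (hs : s ∈ M.crSpace) (x : Pt d) :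
    M.smoother Kz s x = M.smoothFun Kz (M.piece s) x := by
  rw [smoother, smoothFun, avg, bubbleOp]
  congr 1
  refine Finset.sum_congr rfl fun F hF => ?_
  congr 1
  obtain ⟨K, hK, hFK, -⟩ := M.mem_faces_iff.1 (M.mem_faces_of_mem_interiorFaces hF)
  have h : ∃ K ∈ M.elems, F ⊆ K := ⟨K, hK, hFK⟩
  have he : M.faceElem F = h.choose := by rw [faceElem, dif_pos h]
  rw [faceMoment, dif_pos h, bubbleCoef, he]
  have hag : M.AgreesOn (fun y => s y - M.avg Kz s y) h.choose
      (M.piece s h.choose - M.avgPiece Kz (M.piece s) h.choose) := by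
    filter_upwards [M.agreesOn_piece hΩ hs h.choose_spec.1] with y hy hyK
    rw [hy hyK, AffineMap.coe_sub, Pi.sub_apply, M.avgPiece_eq _ _ h.choose_spec.1 hyK, avg]
  rw [M.piece_eq hΩ h.choose_spec.1 hag]
  rfl

/-- Linearity of `piece` is known on elements of the mesh only. This is enough, since the smoothed
function reads `p` only on chosen node elements and face elements. -/
theorem smoothFun_congr (hKz : M.IsNodeChoice Kz) {q : Finset (Pt d) → Pt d →ᵃ[ℝ] ℝ}
    (h : ∀ K ∈ M.elems, p K = q K) (x : Pt d) : M.smoothFun Kz p x = M.smoothFun Kz q x := by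
  have havg : ∀ K, M.avgPiece Kz p K = M.avgPiece Kz q K := fun K =>
    Finset.sum_congr rfl fun z hz => by rw [h _ (hKz z hz).1]
  rw [smoothFun, smoothFun]
  congr 1
  · exact Finset.sum_congr rfl fun z hz => by rw [h _ (hKz z hz).1]
  · refine Finset.sum_congr rfl fun F hF => ?_
    rw [bubbleCoef, bubbleCoef, havg,
      h _ (M.exists_isFaceOf_of_mem_faces (M.mem_faces_of_mem_interiorFaces hF)).1]

theorem smoothFun_add (q : Finset (Pt d) → Pt d →ᵃ[ℝ] ℝ) (x : Pt d) :
    M.smoothFun Kz (p + q) x = M.smoothFun Kz p x + M.smoothFun Kz q x := by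
  have hc : ∀ q : Pt d →ᵃ[ℝ] ℝ, Continuous q := AffineMap.continuous_real
  have hcoef : ∀ F ∈ M.interiorFaces, M.bubbleCoef Kz (p + q) F =
      M.bubbleCoef Kz p F + M.bubbleCoef Kz q F := by
    intro F hF
    obtain ⟨-, z, h⟩ := M.exists_isFaceOf_of_mem_faces (M.mem_faces_of_mem_interiorFaces hF)
    rw [bubbleCoef, bubbleCoef, bubbleCoef,
      ← h.faceIntegral_add
        (f := fun x => p (M.faceElem F) x - M.avgPiece Kz p (M.faceElem F) x)
        (g := fun x => q (M.faceElem F) x - M.avgPiece Kz q (M.faceElem F) x)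
        ((hc _).sub (hc _)) ((hc _).sub (hc _))]
    congr 1
    ext y
    simp only [avgPiece_apply, Pi.add_apply, AffineMap.coe_add, add_mul, Finset.sum_add_distrib]
    ring
  have h2 : ∑ F ∈ M.interiorFaces, M.bubbleCoef Kz (p + q) F * M.normBubble F x =
      ∑ F ∈ M.interiorFaces, M.bubbleCoef Kz p F * M.normBubble F x +
        ∑ F ∈ M.interiorFaces, M.bubbleCoef Kz q F * M.normBubble F x := by
    rw [← Finset.sum_add_distrib]
    exact Finset.sum_congr rfl fun F hF => by rw [hcoef F hF, add_mul]
  rw [smoothFun, smoothFun, smoothFun, h2]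
  simp only [Pi.add_apply, AffineMap.coe_add, add_mul, Finset.sum_add_distrib]
  ring

theorem smoothFun_smul (c : ℝ) (x : Pt d) :
    M.smoothFun Kz (c • p) x = c * M.smoothFun Kz p x := by
  have hcoef : ∀ F, M.bubbleCoef Kz (c • p) F = c * M.bubbleCoef Kz p F := by
    intro F
    rw [bubbleCoef, bubbleCoef, ← faceIntegral_const_mul]
    congr 1
    ext y
    simp only [avgPiece_apply, Pi.smul_apply, AffineMap.coe_smul, smul_eq_mul, mul_sub,
      Finset.mul_sum, mul_assoc]
  simp only [smoothFun, hcoef, Pi.smul_apply, AffineMap.coe_smul, smul_eq_mul, mul_add,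
    Finset.mul_sum, mul_assoc]

/-- The coefficients of the bubble functions can be computed from either side. -/
theorem bubbleCoef_eq (hp : M.JumpsVanish p) {F K : Finset (Pt d)} {z : Pt d}
    (hF : F ∈ M.interiorFaces) (hK : K ∈ M.elems) (h : IsFaceOf F K z) :
    M.bubbleCoef Kz p F = faceIntegral F (fun x => p K x - M.avgPiece Kz p K x) := by
  have hc : ∀ q : Pt d →ᵃ[ℝ] ℝ, Continuous q := AffineMap.continuous_real
  obtain ⟨hFf, hFb⟩ := M.mem_interiorFaces_iff.1 hF
  obtain ⟨hE, z', h'⟩ := M.exists_isFaceOf_of_mem_faces hFf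
  have h1 := (hp F hFf).1 hFb _ hE K hK h'.subset h.subset
  rw [h.faceIntegral_sub (hc _) (hc _)] at h1
  rw [bubbleCoef, h.faceIntegral_sub (hc _) (hc _), h.faceIntegral_sub (hc _) (hc _),
    sub_eq_zero.1 h1]
  congr 1
  refine faceIntegral_congr fun x hx => ?_
  rw [M.avgPiece_eq _ _ hE (hull_mono h'.subset hx), M.avgPiece_eq _ _ hK (hull_mono h.subset hx)]

/-- A different face has a vertex off `F`, and the coordinate of this vertex vanishes on `F`. So the
coefficients of the bubbles can be fixed face by face. -/
theorem prod_bary_eq_zero {F F' K : Finset (Pt d)} {z : Pt d} (h : IsFaceOf F K z)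
    (hc : F'.card = d) (hne : F' ≠ F) {x : Pt d} (hx : x ∈ hull F) :
    ∏ w ∈ F', bary K w x = 0 := by
  obtain ⟨w, hw, hwF⟩ : ∃ w ∈ F', w ∉ F := by
    by_contra! hcon
    exact hne (Finset.eq_of_subset_of_card_le hcon (by rw [hc, h.card_eq]))
  refine Finset.prod_eq_zero hw ?_
  by_cases hwK : w ∈ K
  · exact ((h.simplex.mem_hull_subset_iff h.subset).1 hx).2 w hwK hwF
  · rw [h.simplex.bary_of_notMem hwK]; rfl

theorem card_of_mem_faces {F : Finset (Pt d)} (hF : F ∈ M.faces) : F.card = d := by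
  obtain ⟨_, _, _, h⟩ := M.mem_faces_iff.1 hF
  exact h

theorem faceIntegral_bubble {F K : Finset (Pt d)} {z : Pt d} (hK : K ∈ M.elems)
    (h : IsFaceOf F K z) :
    faceIntegral F (M.bubble F) = faceIntegral F (fun x => ∏ w ∈ F, bary K w x) :=
  faceIntegral_congr fun _ hx => M.bubble_eq hK F (hull_mono h.subset hx)

/-- The smoothing operator preserves the integrals over faces. -/
theorem faceIntegral_smoothPiece (hΩ : IsLipschitzDomain Ω) (hd : 1 ≤ d) (hp : M.JumpsVanish p)
    {F K : Finset (Pt d)} {z : Pt d} (hK : K ∈ M.elems) (h : IsFaceOf F K z) :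
    faceIntegral F (M.smoothPiece Kz p K) = faceIntegral F (p K) := by
  have hc : ∀ q : Pt d →ᵃ[ℝ] ℝ, Continuous q := AffineMap.continuous_real
  have hFf := M.mem_faces_of_isFaceOf hK h
  by_cases hb : M.IsBoundaryFace F
  · rw [(hp F hFf).2 hb K hK h.subset]
    refine setIntegral_eq_zero_of_forall_eq_zero fun x hx => ?_
    rw [← M.smoothFun_eq Kz p hK (hull_mono h.subset hx)]
    exact M.smoothFun_eq_zero Kz p hΩ hd fun hxΩ => (hb hx).2 (by rwa [hΩ.isOpen.interior_eq])
  · have hFi : F ∈ M.interiorFaces := M.mem_interiorFaces_iff.2 ⟨hFf, hb⟩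
    -- On `F` only its own bubble survives, and its coefficient is the defect of the nodal average
    -- in the face integral.
    have e : ∀ x ∈ hull F, M.smoothPiece Kz p K x = M.avgPiece Kz p K x +
        M.bubbleCoef Kz p F * (faceIntegral F (M.bubble F))⁻¹ * ∏ w ∈ F, bary K w x := by
      intro x hx
      rw [smoothPiece, Finset.sum_eq_single_of_mem F hFi, mul_assoc]
      intro F' hF' hne
      rw [prod_bary_eq_zero h (M.card_of_mem_faces (M.mem_faces_of_mem_interiorFaces hF')) hne hx,
        mul_zero, mul_zero]
    have hpos : 0 < faceIntegral F (fun x => ∏ w ∈ F, bary K w x) := by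
      refine lt_of_lt_of_le ?_ (h.le_faceIntegral_prod_bary hd)
      have := h.faceArea_pos hd
      have hd0 : (0 : ℝ) < d := by exact_mod_cast hd
      positivity
    rw [faceIntegral_congr e, h.faceIntegral_add (f := M.avgPiece Kz p K)
      (g := fun x => M.bubbleCoef Kz p F * (faceIntegral F (M.bubble F))⁻¹ *
        ∏ w ∈ F, bary K w x) (hc _) (continuous_const.mul (continuous_finsetProd _ fun w _ => hc _)), faceIntegral_const_mul,
      M.faceIntegral_bubble hK h, inv_mul_cancel_right₀ hpos.ne', M.bubbleCoef_eq hp hFi hK h,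
      h.faceIntegral_sub (hc _) (hc _)]
    ring

/-- The smoothing operator preserves the mean values of the gradient. -/
theorem integral_fderiv_smoothPiece (hΩ : IsLipschitzDomain Ω) (hd : 1 ≤ d) (hp : M.JumpsVanish p)
    {K : Finset (Pt d)} (hK : K ∈ M.elems) (w : Pt d) :
    ∫ x in hull K, fderiv ℝ (M.smoothPiece Kz p K) x w = ∫ x in hull K, fderiv ℝ (p K) x w := by
  have hKs := M.isSimplex hK
  -- By the divergence theorem both sides depend on face integrals only.
  rw [hKs.integral_fderiv hd (M.contDiff_smoothPiece Kz p K),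
    hKs.integral_fderiv hd ((contDiff_affine (p K)).of_le (by simp))]
  refine Finset.sum_congr rfl fun z hz => ?_
  rw [M.faceIntegral_smoothPiece hΩ hd hp hK (hKs.isFaceOf_erase hz)]

end Mesh

/-! ### The new Crouzeix-Raviart method -/

namespace Mesh

variable {Ω : Set (Pt d)} (M : Mesh Ω)

theorem interior_hull_ae_eq (K : Finset (Pt d)) : interior (hull K) =ᵐ[volume] hull K := by
  filter_upwards [ae_mem_interior Measure.AbsolutelyContinuous.rfl K] with x hx
  exact propext ⟨fun h => interior_subset h, fun h => hx h⟩

theorem pairwise_disjoint_interior :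
    (M.elems : Set (Finset (Pt d))).Pairwise
      (Function.onFun Disjoint fun K => interior (hull K)) := by
  intro K hK K' hK' hne
  refine Set.disjoint_left.2 fun x hx hx' => hne ?_
  exact M.eq_of_mem_interior hK hK' hx (interior_subset hx')

theorem integral_eq_sum_elems (hΩ : IsLipschitzDomain Ω) {g : Pt d → ℝ} (hg : IntegrableOn g Ω) :
    ∫ x in Ω, g x = ∑ K ∈ M.elems, ∫ x in hull K, g x := by
  have hU : (⋃ K ∈ M.elems, interior (hull K)) =ᵐ[volume] Ω := by
    have h1 : ∀ᵐ x, ∀ K ∈ M.elems, x ∈ hull K → x ∈ interior (hull K) :=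
      (Finset.eventually_all M.elems).2 fun K _ =>
        ae_mem_interior Measure.AbsolutelyContinuous.rfl K
    filter_upwards [h1] with x hx
    refine propext ⟨fun h => ?_, fun h => ?_⟩
    · obtain ⟨K, hK, hxK⟩ := mem_iUnion₂.1 h
      exact M.interior_hull_subset hΩ hK hxK
    · obtain ⟨K, hK, hxK⟩ := M.exists_mem_hull (subset_closure h)
      exact mem_iUnion₂.2 ⟨K, hK, hx K hK hxK⟩
  rw [← setIntegral_congr_set hU, integral_biUnion_finset M.elems
    (fun K _ => isOpen_interior.measurableSet) M.pairwise_disjoint_interior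
    (fun K hK => hg.mono_set (M.interior_hull_subset hΩ hK))]
  exact Finset.sum_congr rfl fun K _ => setIntegral_congr_set (interior_hull_ae_eq K)

theorem ae_hull_of_ae (hΩ : IsLipschitzDomain Ω) {K : Finset (Pt d)} (hK : K ∈ M.elems)
    {P : Pt d → Prop} (h : ∀ᵐ x ∂(volume.restrict Ω), x ∈ hull K → P x) :
    ∀ᵐ x ∂(volume.restrict (hull K)), P x := by
  rw [← Measure.restrict_congr_set (interior_hull_ae_eq K)]
  filter_upwards [ae_restrict_of_ae_restrict_of_subset (M.interior_hull_subset hΩ hK) h,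
    ae_restrict_mem isOpen_interior.measurableSet] with x hx hxK
  exact hx (interior_subset hxK)

theorem inner_eq_sum (hΩ : IsLipschitzDomain Ω) {G G' : L2Vec Ω}
    {f f' : Finset (Pt d) → Pt d → Pt d}
    (h : ∀ K ∈ M.elems, ∀ᵐ x ∂(volume.restrict Ω), x ∈ hull K → G x = f K x)
    (h' : ∀ K ∈ M.elems, ∀ᵐ x ∂(volume.restrict Ω), x ∈ hull K → G' x = f' K x) :
    inner ℝ G G' = ∑ K ∈ M.elems, ∫ x in hull K, inner ℝ (f K x) (f' K x) := by
  rw [L2.inner_def, M.integral_eq_sum_elems hΩ (L2.integrable_inner G G')]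
  refine Finset.sum_congr rfl fun K hK => integral_congr_ae ?_
  filter_upwards [M.ae_hull_of_ae hΩ hK (h K hK), M.ae_hull_of_ae hΩ hK (h' K hK)] with x h1 h2
  rw [h1, h2]

theorem brokenGrad_ae (hΩ : IsLipschitzDomain Ω) {w : M.brokenH1} {f : Finset (Pt d) → Pt d → ℝ}
    (hf : ∀ K ∈ M.elems, ContDiff ℝ 1 (f K))
    (hw : ∀ K ∈ M.elems, ∀ᵐ x ∂(volume.restrict Ω), x ∈ hull K → (w : L2 Ω) x = f K x) :
    ∀ K ∈ M.elems, ∀ᵐ x ∂(volume.restrict Ω), x ∈ hull K → M.brokenGrad w x = gradient (f K) x := by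
  obtain ⟨G, hG, hGf⟩ := M.exists_brokenGrad hΩ hf hw
  rw [M.brokenGrad_eq hG]
  exact hGf

theorem brokenGrad_ae_of_mem_S (hΩ : IsLipschitzDomain Ω) (s : M.S) :
    ∀ K ∈ M.elems, ∀ᵐ x ∂(volume.restrict Ω), x ∈ hull K →
      M.brokenGrad s x = affGrad (M.piece ((s : M.brokenH1) : L2 Ω) K) := by
  have := M.brokenGrad_ae hΩ (w := (s : M.brokenH1))
    (f := fun K => M.piece ((s : M.brokenH1) : L2 Ω) K)
    (fun K _ => (contDiff_affine _).of_le (by simp)) (fun K hK => M.agreesOn_piece hΩ s.2 hK)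
  intro K hK
  filter_upwards [this K hK] with x hx hxK
  rw [hx hxK, gradient_affine]

variable {Kz : Pt d → Finset (Pt d)}

/-- The polynomial pieces come from one function that vanishes outside of `Ω`. It is therefore
Lipschitz continuous and belongs to `H¹₀`. -/
theorem exists_smooth (hΩ : IsLipschitzDomain Ω) (hd : 1 ≤ d) (p : Finset (Pt d) → Pt d →ᵃ[ℝ] ℝ) :
    ∃ e : M.V, ((e : M.brokenH1) : L2 Ω) =ᵐ[volume.restrict Ω] M.smoothFun Kz p := by
  obtain ⟨L, hL⟩ := M.exists_lipschitzWith hΩ (fun K _ => M.contDiff_smoothPiece Kz p K)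
    (fun K hK x hx => M.smoothFun_eq Kz p hK hx) (fun x hx => M.smoothFun_eq_zero Kz p hΩ hd hx)
  have hcs : HasCompactSupport (M.smoothFun Kz p) := by
    refine HasCompactSupport.intro hΩ.isBounded.isCompact_closure fun x hx => ?_
    exact M.smoothFun_eq_zero Kz p hΩ hd fun h => hx (subset_closure h)
  have hmem : MemLp (M.smoothFun Kz p) 2 (volume.restrict Ω) :=
    hL.continuous.memLp_of_hasCompactSupport hcs
  have hV : hmem.toLp _ ∈ H10 Ω := mem_H10_of_lipschitz hΩ.isOpen hΩ.isBounded hL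
    (fun x hx => M.smoothFun_eq_zero Kz p hΩ hd hx) hmem.coeFn_toLp
  exact ⟨⟨⟨hmem.toLp _, M.H10_sup_crSpace_le hΩ (Submodule.mem_sup_left hV)⟩, hV⟩,
    hmem.coeFn_toLp⟩

theorem V_ext {e e' : M.V} (h : ((e : M.brokenH1) : L2 Ω) =ᵐ[volume.restrict Ω]
    ((e' : M.brokenH1) : L2 Ω)) : e = e' :=
  Subtype.ext (Subtype.ext (Lp.ext h))

/-- The smoothing operator as a linear map. -/
def smoothing (hΩ : IsLipschitzDomain Ω) (hd : 1 ≤ d) (hKz : M.IsNodeChoice Kz) :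
    M.S →ₗ[ℝ] M.V where
  toFun σ := (M.exists_smooth (Kz := Kz) hΩ hd (M.piece ((σ : M.brokenH1) : L2 Ω))).choose
  map_add' σ τ := by
    refine M.V_ext ?_
    set p := M.piece ((σ : M.brokenH1) : L2 Ω) with hp
    set q := M.piece ((τ : M.brokenH1) : L2 Ω) with hq
    have h1 := (M.exists_smooth (Kz := Kz) hΩ hd p).choose_spec
    have h2 := (M.exists_smooth (Kz := Kz) hΩ hd q).choose_spec
    have h3 := (M.exists_smooth (Kz := Kz) hΩ hd
      (M.piece (((σ + τ : M.S) : M.brokenH1) : L2 Ω))).choose_spec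
    refine h3.trans (Filter.EventuallyEq.trans ?_ (Lp.coeFn_add _ _).symm)
    filter_upwards [h1, h2] with x h1 h2
    rw [Pi.add_apply, h1, h2, ← M.smoothFun_add]
    exact M.smoothFun_congr hKz (fun K hK => M.piece_add hΩ σ.2 τ.2 hK) x
  map_smul' c σ := by
    refine M.V_ext ?_
    set p := M.piece ((σ : M.brokenH1) : L2 Ω) with hp
    have h1 := (M.exists_smooth (Kz := Kz) hΩ hd p).choose_spec
    have h3 := (M.exists_smooth (Kz := Kz) hΩ hd
      (M.piece (((c • σ : M.S) : M.brokenH1) : L2 Ω))).choose_spec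
    refine h3.trans (Filter.EventuallyEq.trans ?_ (Lp.coeFn_smul _ _).symm)
    filter_upwards [h1] with x h1
    rw [RingHom.id_apply, Pi.smul_apply, h1, smul_eq_mul, ← M.smoothFun_smul]
    exact M.smoothFun_congr hKz (fun K hK => M.piece_smul hΩ σ.2 c hK) x

variable {p : Finset (Pt d) → Pt d →ᵃ[ℝ] ℝ}

open Classical in
theorem avgPiece_vertex {K : Finset (Pt d)} (hK : K ∈ M.elems) {y : Pt d} (hy : y ∈ K) :
    M.avgPiece Kz p K y = if y ∈ Ω then p (Kz y) y else 0 := by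
  have hKs := M.isSimplex hK
  rw [avgPiece_apply]
  split_ifs with h
  · rw [Finset.sum_eq_single_of_mem y (M.mem_interiorVertices_iff.2 ⟨⟨K, hK, hy⟩, h⟩),
      hKs.bary_self hy, mul_one]
    intro z _ hne
    rw [hKs.bary_ne hy hne.symm, mul_zero]
  · refine Finset.sum_eq_zero fun z hz => ?_
    rw [hKs.bary_ne hy, mul_zero]
    rintro rfl
    exact h (M.mem_interiorVertices_iff.1 hz).2

theorem smoothPiece_eq_self {K : Finset (Pt d)} (h : ∀ K ∈ M.elems, M.avgPiece Kz p K = p K)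
    (hK : K ∈ M.elems) (x : Pt d) : M.smoothPiece Kz p K x = p K x := by
  rw [smoothPiece, h K hK, Finset.sum_eq_zero, add_zero]
  intro F hF
  rw [bubbleCoef,
    h _ (M.exists_isFaceOf_of_mem_faces (M.mem_faces_of_mem_interiorFaces hF)).1]
  simp [faceIntegral]

/-- The piecewise affine functions in `H10` are continuous and vanish on the boundary. -/
theorem avgPiece_eq_self (hΩ : IsLipschitzDomain Ω) (hd : 1 ≤ d) (hKz : M.IsNodeChoice Kz)
    {u : L2 Ω} (hu : u ∈ H10 Ω) (hp : ∀ K ∈ M.elems, M.AgreesOn u K (p K))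
    {K : Finset (Pt d)} (hK : K ∈ M.elems) : M.avgPiece Kz p K = p K := by
  have hc : ∀ q : Pt d →ᵃ[ℝ] ℝ, Continuous q := AffineMap.continuous_real
  have hadj : ∀ {z : Pt d} {K K' : M.Star z}, (M.starGraph z).Reachable K K' →
      p K.1 z = p K'.1 z := by
    rintro z K K' ⟨w⟩
    induction w with
    | nil => rfl
    | @cons K₁ K₂ K₃ hadj w ih =>
      obtain ⟨-, F, h1, h2, hcard, hzF, -⟩ := hadj
      obtain ⟨y, hf⟩ := (M.isSimplex K₁.2.1).exists_isFaceOf h1 hcard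
      obtain ⟨y', hf'⟩ := (M.isSimplex K₂.2.1).exists_isFaceOf h2 hcard
      -- With the jump itself as weight, equality of the weighted integrals says that the square of
      -- the jump has integral zero, so the jump vanishes in every point of the face.
      have e := M.faceIntegral_eq_of_mem_H10 hΩ hd hu hp K₁.2.1 K₂.2.1 hf hf' (p K₁.1 - p K₂.1)
      rw [← sub_eq_zero, ← hf.faceIntegral_sub (f := fun x => p K₁.1 x * (p K₁.1 - p K₂.1) x)
        (g := fun x => p K₂.1 x * (p K₁.1 - p K₂.1) x)
        ((hc _).mul (hc _)) ((hc _).mul (hc _))] at e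
      have e' := hf.eq_zero_of_faceIntegral_sq_eq_zero hd (hc (p K₁.1 - p K₂.1))
        (by rw [← e]; congr 1; ext x; simp; ring) (mem_hull_of_mem hzF)
      rw [← ih]
      exact sub_eq_zero.1 e'
  refine (M.isSimplex hK).affine_ext fun z hz => ?_
  classical
  rw [M.avgPiece_vertex hK hz]
  split_ifs with h
  · have hm := hKz.mem M (M.mem_interiorVertices_iff.2 ⟨⟨K, hK, hz⟩, h⟩)
    exact hadj (M.starGraph_reachable hΩ hd h ⟨_, hm⟩ ⟨K, hK, hz⟩)
  · obtain ⟨K', hr, F, hFK, hcard, hzF, hb⟩ :=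
      M.exists_boundaryFace_reachable hΩ hd h ⟨K, hK, hz⟩
    obtain ⟨y, hf⟩ := (M.isSimplex K'.2.1).exists_isFaceOf hFK hcard
    have e := M.faceIntegral_eq_zero_of_mem_H10 hΩ hd hu hp K'.2.1 hf hb (p K'.1)
    rw [hadj hr]
    exact (hf.eq_zero_of_faceIntegral_sq_eq_zero hd (hc _) e (mem_hull_of_mem hzF)).symm

section

variable (hΩ : IsLipschitzDomain Ω) (hd : 1 ≤ d) (hKz : M.IsNodeChoice Kz)

theorem smoothing_ae (σ : M.S) :
    ((M.smoothing hΩ hd hKz σ : M.brokenH1) : L2 Ω) =ᵐ[volume.restrict Ω]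
      M.smoothFun Kz (M.piece ((σ : M.brokenH1) : L2 Ω)) :=
  (M.exists_smooth (Kz := Kz) hΩ hd (M.piece ((σ : M.brokenH1) : L2 Ω))).choose_spec

theorem brokenGrad_smoothing_ae (σ : M.S) :
    ∀ K ∈ M.elems, ∀ᵐ x ∂(volume.restrict Ω), x ∈ hull K →
      M.brokenGrad (M.smoothing hΩ hd hKz σ) x =
        gradient (M.smoothPiece Kz (M.piece ((σ : M.brokenH1) : L2 Ω)) K) x := by
  refine M.brokenGrad_ae hΩ (fun K _ => M.contDiff_smoothPiece Kz _ K) fun K hK => ?_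
  filter_upwards [M.smoothing_ae hΩ hd hKz σ] with x hx hxK
  rw [hx, M.smoothFun_eq _ _ hK hxK]

/-- The smoothing operator changes a function only by a function that is orthogonal to the
Crouzeix-Raviart space. -/
theorem form_smoothing (s σ : M.S) :
    M.form s (M.smoothing hΩ hd hKz σ) = M.form s σ := by
  rw [form_apply, form_apply, M.inner_eq_sum hΩ (M.brokenGrad_ae_of_mem_S hΩ s)
    (M.brokenGrad_smoothing_ae hΩ hd hKz σ),
    M.inner_eq_sum hΩ (M.brokenGrad_ae_of_mem_S hΩ s) (M.brokenGrad_ae_of_mem_S hΩ σ)]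
  refine Finset.sum_congr rfl fun K hK => ?_
  -- The gradient of `s` is constant on `K`, so the pairing involves only the mean of the other
  -- gradient, in the direction of this constant.
  have h := M.integral_fderiv_smoothPiece (Kz := Kz) hΩ hd
    (M.jumpsVanish_piece (s := ((σ : M.brokenH1) : L2 Ω)) hΩ σ.2) hK
    (affGrad (M.piece ((s : M.brokenH1) : L2 Ω) K))
  simp only [fderiv_affine] at h
  rw [← integral_congr_ae (ae_of_all _ fun x => ?_), h]
  · exact integral_congr_ae (ae_of_all _ fun x => real_inner_comm _ _)
  · rw [← inner_gradient, real_inner_comm]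

/-- The new Crouzeix-Raviart method. -/
def crMethod : NonconformingMethod M.V M.S where
  finDim := M.finiteDimensional_S hΩ
  b := M.form.compl₁₂ M.S.subtype M.S.subtype
  nondeg s hs := by
    by_contra hne
    have h := (M.isScalarProductOn hΩ hd).pos s (Submodule.mem_sup_right s.2)
      fun h => hne (Subtype.ext h)
    exact h.ne' (hs s)
  E := M.smoothing hΩ hd hKz

theorem isNewCRMethod_crMethod : M.IsNewCRMethod Kz (M.crMethod hΩ hd hKz) := by
  refine ⟨fun s σ => rfl, fun σ => ?_⟩
  filter_upwards [M.smoothing_ae hΩ hd hKz σ] with x hx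
  rw [M.smoother_eq (s := ((σ : M.brokenH1) : L2 Ω)) hΩ σ.2]
  exact hx

theorem isGalerkin_crMethod : (M.crMethod hΩ hd hKz).IsGalerkin M.form := by
  refine ⟨fun s σ _ _ => rfl, fun σ hσ => Subtype.ext (Lp.ext ?_)⟩
  refine (M.smoothing_ae hΩ hd hKz σ).trans (M.ae_of_forall_elems fun K hK => ?_)
  have hp : ∀ K ∈ M.elems, M.AgreesOn ((σ : M.brokenH1) : L2 Ω) K
      (M.piece ((σ : M.brokenH1) : L2 Ω) K) := fun K hK => M.agreesOn_piece hΩ σ.2 hK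
  filter_upwards [hp K hK] with x hx hxK
  rw [hx hxK, M.smoothFun_eq _ _ hK hxK, M.smoothPiece_eq_self _ hK]
  exact fun K hK => M.avgPiece_eq_self hΩ hd hKz hσ hp hK

/-- A bound of the smoothing operator bounds the quasi-optimality constant. -/
theorem mem_qoptConstants {C : ℝ} (hC : 0 ≤ C)
    (h : ∀ σ : M.S, ‖M.brokenGrad (M.smoothing hΩ hd hKz σ)‖ ≤ C * ‖M.brokenGrad σ‖) :
    1 + C ∈ (M.crMethod hΩ hd hKz).qoptConstants M.form := by
  refine ⟨by linarith, fun u => ?_⟩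
  set U := (M.crMethod hΩ hd hKz).approx M.form u with hU
  have hspec : ∀ σ : M.S, M.form U σ = M.form u (M.smoothing hΩ hd hKz σ) := fun σ =>
    (M.crMethod hΩ hd hKz).app_spec _ σ
  have key : ∀ s : M.S, energyNorm M.form ((u : M.brokenH1) - (U : M.brokenH1)) ≤
      (1 + C) * energyNorm M.form ((u : M.brokenH1) - (s : M.brokenH1)) := by
    intro s
    simp only [energyNorm_eq]
    have e1 : ‖M.brokenGrad ((U - s : M.S) : M.brokenH1)‖ ≤
        C * ‖M.brokenGrad ((u : M.brokenH1) - (s : M.brokenH1))‖ := by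
      set σ : M.S := U - s with hσ
      have e2 : ‖M.brokenGrad (σ : M.brokenH1)‖ ^ 2 ≤
          ‖M.brokenGrad ((u : M.brokenH1) - (s : M.brokenH1))‖ *
            (C * ‖M.brokenGrad (σ : M.brokenH1)‖) := by
        rw [← form_self]
        -- The discrete equation applies to `U` and the orthogonality to `s`, so that both terms are
        -- tested with the smoothed `σ` and combine to `u - s`.
        have : M.form σ σ = M.form ((u : M.brokenH1) - (s : M.brokenH1))
            (M.smoothing hΩ hd hKz σ) := by
          rw [map_sub, LinearMap.sub_apply, ← hspec, M.form_smoothing hΩ hd hKz,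
            ← LinearMap.sub_apply, ← map_sub]
          rfl
        rw [this, form_apply]
        refine (real_inner_le_norm _ _).trans ?_
        gcongr
        exact h σ
      rcases (norm_nonneg (M.brokenGrad (σ : M.brokenH1))).eq_or_lt with h0 | h0
      · rw [← h0]; positivity
      · nlinarith
    have e3 : M.brokenGrad ((u : M.brokenH1) - (U : M.brokenH1)) =
        M.brokenGrad ((u : M.brokenH1) - (s : M.brokenH1)) -
          M.brokenGrad ((U - s : M.S) : M.brokenH1) := by
      rw [← LinearPMap.map_sub]
      congr 1
      simp
    rw [e3]
    refine (norm_sub_le _ _).trans ?_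
    linarith
  rw [← div_le_iff₀' (by linarith)]
  refine le_ciInf fun s => ?_
  rw [div_le_iff₀' (by linarith)]
  exact key s

theorem isQuasiOptimal_of_bound {C : ℝ} (hC : 0 ≤ C)
    (h : ∀ σ : M.S, ‖M.brokenGrad (M.smoothing hΩ hd hKz σ)‖ ≤ C * ‖M.brokenGrad σ‖) :
    (M.crMethod hΩ hd hKz).IsQuasiOptimal M.form ∧
      (M.crMethod hΩ hd hKz).Cqopt M.form ≤ 1 + C :=
  ⟨⟨_, M.mem_qoptConstants hΩ hd hKz hC h⟩,
    csInf_le ⟨1, fun _ hc => hc.1⟩ (M.mem_qoptConstants hΩ hd hKz hC h)⟩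

end

end Mesh

/-! ### Consequences of shape regularity -/

theorem dist_le_diam_hull {K : Finset (Pt d)} {x y : Pt d} (hx : x ∈ hull K) (hy : y ∈ hull K) :
    dist x y ≤ Metric.diam (hull K) :=
  Metric.dist_le_diam_of_mem (isCompact_hull K).isBounded hx hy

theorem diam_hull_mono {F K : Finset (Pt d)} (h : F ⊆ K) :
    Metric.diam (hull F) ≤ Metric.diam (hull K) :=
  Metric.diam_mono (hull_mono h) (isCompact_hull K).isBounded

theorem IsSimplex.inDiam_le_diam {K : Finset (Pt d)} (hK : IsSimplex K) (hd : 1 ≤ d) :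
    inDiam K ≤ 2 * Metric.diam (hull K) := by
  obtain ⟨a, ha, b, hb, hab⟩ := Finset.one_lt_card.1 (show 1 < K.card by rw [hK.card_eq]; omega)
  refine (hK.inDiam_le_dist hd ha hb hab).trans ?_
  have := dist_le_diam_hull (mem_hull_of_mem ha) (mem_hull_of_mem hb)
  linarith

theorem IsSimplex.diam_pos {K : Finset (Pt d)} (hK : IsSimplex K) (hd : 1 ≤ d) :
    0 < Metric.diam (hull K) := by
  have := hK.inDiam_le_diam hd
  have := hK.inDiam_pos hd
  linarith

/-- Near a vertex a simplex contains balls of radius comparable to their distance to the vertex. -/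
theorem IsSimplex.exists_ball_subset {K : Finset (Pt d)} (hK : IsSimplex K) (hd : 1 ≤ d) {t : ℝ}
    (ht : Metric.diam (hull K) ≤ t * inDiam K) {z : Pt d} (hz : z ∈ K) {r : ℝ} (hr : 0 < r)
    (hrK : r ≤ Metric.diam (hull K)) :
    ∃ c, Metric.ball c (r / (4 * t)) ⊆ interior (hull K) ∩ Metric.closedBall z r := by
  obtain ⟨c, hc, hρ⟩ := hK.ball_subset hd
  have hh := hK.diam_pos hd
  have ht0 : 0 < t := by
    by_contra! h
    nlinarith
  set h := Metric.diam (hull K) with hh'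
  have hzK := mem_hull_of_mem hz
  -- The homothety about `z` with ratio `r / h` maps `K` into itself and into the ball of radius
  -- `r`. The inner ball of `K` has radius `inDiam K / 4 ≥ h / (4 * t)`, so its image has radius at
  -- least `r / (4 * t)`.
  have key : Metric.ball (z + (r / h) • (c - z)) (r / (4 * t)) ⊆
      hull K ∩ Metric.closedBall z r := by
    intro y hy
    set y' := z + (h / r) • (y - z) with hy'
    have e1 : y' - c = (h / r) • (y - (z + (r / h) • (c - z))) := by
      rw [hy', ← sub_sub, smul_sub _ (y - z), smul_smul, div_mul_div_comm, mul_comm h r,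
        div_self (by positivity), one_smul]
      abel
    have e2 : y = z + (r / h) • (y' - z) := by
      rw [hy', add_sub_cancel_left, smul_smul, div_mul_div_comm, mul_comm r h,
        div_self (by positivity), one_smul]
      abel
    have hy'K : y' ∈ hull K := by
      refine hc ?_
      rw [Metric.mem_closedBall, dist_eq_norm, e1, norm_smul, Real.norm_of_nonneg (by positivity)]
      rw [Metric.mem_ball, dist_eq_norm] at hy
      calc h / r * ‖y - (z + (r / h) • (c - z))‖ ≤ h / r * (r / (4 * t)) := by gcongr
        _ = h / (4 * t) := by field_simp
        _ ≤ inDiam K / 4 := by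
          rw [div_le_div_iff₀ (by positivity) (by norm_num)]
          linarith
    constructor
    · rw [e2]
      exact (convex_convexHull ℝ (K : Set (Pt d))).add_smul_sub_mem hzK hy'K
        ⟨by positivity, (div_le_one hh).2 hrK⟩
    · rw [Metric.mem_closedBall, dist_eq_norm, e2, add_sub_cancel_left, norm_smul,
        Real.norm_of_nonneg (by positivity), ← dist_eq_norm]
      calc r / h * dist y' z ≤ r / h * h := by
            gcongr
            exact dist_le_diam_hull hy'K hzK
        _ = r := div_mul_cancel₀ r hh.ne'
  exact ⟨_, subset_inter (interior_maximal (key.trans inter_subset_left) Metric.isOpen_ball)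
    (key.trans inter_subset_right)⟩

theorem measureReal_ball (x : Pt d) {r : ℝ} (hr : 0 < r) :
    volume.real (Metric.ball x r) = r ^ d * volume.real (Metric.ball (0 : Pt d) 1) := by
  rw [measureReal_def, Measure.addHaar_ball_of_pos volume x hr, ENNReal.toReal_mul,
    ENNReal.toReal_ofReal (by positivity), finrank_euclideanSpace, Fintype.card_fin]
  rfl

theorem measureReal_closedBall (x : Pt d) {r : ℝ} (hr : 0 ≤ r) :
    volume.real (Metric.closedBall x r) = r ^ d * volume.real (Metric.ball (0 : Pt d) 1) := by
  rw [Measure.addHaar_real_closedBall volume x hr, finrank_euclideanSpace, Fintype.card_fin]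

theorem measureReal_ball_pos : 0 < volume.real (Metric.ball (0 : Pt d) 1) :=
  ENNReal.toReal_pos (Metric.measure_ball_pos volume 0 one_pos).ne' measure_ball_lt_top.ne

/-- Shape-regular simplices of comparable diameters have comparable volumes. -/
theorem IsSimplex.measureReal_le {K K' : Finset (Pt d)} (hK : IsSimplex K) (hK' : IsSimplex K')
    (hd : 1 ≤ d) {s : ℝ} (hs : Metric.diam (hull K) ≤ s * inDiam K') :
    volume.real (hull K) ≤ (4 * s) ^ d * volume.real (hull K') := by
  obtain ⟨c, hc, hρ⟩ := hK'.ball_subset hd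
  obtain ⟨z, hz⟩ := hK.nonempty
  have hs0 : 0 ≤ s := by
    by_contra! h
    have := hK.diam_pos hd
    nlinarith
  have h1 : volume.real (hull K) ≤ (s * inDiam K') ^ d * volume.real (Metric.ball (0 : Pt d) 1) := by
    rw [← measureReal_closedBall z (by positivity)]
    refine measureReal_mono (fun x hx => ?_) measure_closedBall_lt_top.ne
    exact (dist_le_diam_hull hx (mem_hull_of_mem hz)).trans hs
  have h2 := measureReal_mono (μ := volume) hc (isCompact_hull K').measure_lt_top.ne
  rw [measureReal_closedBall c (by positivity)] at h2
  refine h1.trans (le_trans (le_of_eq ?_) (mul_le_mul_of_nonneg_left h2 (by positivity)))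
  rw [← mul_assoc, ← mul_pow]
  congr 2
  ring

/-- A bound for the number of elements at a vertex. -/
def starBound (d : ℕ) (t : ℝ) : ℕ := ⌊(4 * t) ^ d⌋₊

/-- The constant in the bound of the nodal error of simplified averaging. -/
def nodeConst (d : ℕ) (t : ℝ) : ℝ := 2 * starBound d t * (2 * t) ^ starBound d t

namespace Mesh

variable {Ω : Set (Pt d)} (M : Mesh Ω)

theorem diam_le_shape_mul (hd : 1 ≤ d) {K : Finset (Pt d)} (hK : K ∈ M.elems) :
    Metric.diam (hull K) ≤ M.shape * inDiam K := by
  rw [← div_le_iff₀ ((M.isSimplex hK).inDiam_pos hd)]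
  exact le_ciSup (f := fun K : M.elems => shapeCoeff (K : Finset (Pt d)))
    (Set.finite_range _).bddAbove ⟨K, hK⟩

/-- A packing argument: with `r` the least diameter in the star, every element contains a ball of
radius `r / (4 * t)` that lies within distance `r` of `z`. These balls are disjoint, and comparing
volumes bounds their number. -/
theorem card_star_le (hd : 1 ≤ d) {t : ℝ} (ht0 : 0 < t)
    (ht : ∀ K ∈ M.elems, Metric.diam (hull K) ≤ t * inDiam K) (z : Pt d) :
    Nat.card (M.Star z) ≤ starBound d t := by
  classical
  set T := M.elems.filter (z ∈ ·) with hT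
  have hTm : ∀ {K}, K ∈ T ↔ K ∈ M.elems ∧ z ∈ K := by simp [hT]
  have hcard : Nat.card (M.Star z) = T.card := Nat.subtype_card T fun K => hTm
  rw [hcard]
  refine Nat.le_floor ?_
  rcases T.eq_empty_or_nonempty with h0 | hne
  · rw [h0, Finset.card_empty, Nat.cast_zero]; positivity
  obtain ⟨K₀, hK₀, hmin⟩ := T.exists_min_image (fun K => Metric.diam (hull K)) hne
  set r := Metric.diam (hull K₀) with hr
  have hr0 : 0 < r := (M.isSimplex (hTm.1 hK₀).1).diam_pos hd
  have hex : ∀ K : Finset (Pt d), ∃ c, K ∈ T →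
      Metric.ball c (r / (4 * t)) ⊆ interior (hull K) ∩ Metric.closedBall z r := by
    intro K
    by_cases hK : K ∈ T
    · obtain ⟨h1, h2⟩ := hTm.1 hK
      obtain ⟨c, hc⟩ := (M.isSimplex h1).exists_ball_subset hd (ht K h1) h2 hr0 (hmin K hK)
      exact ⟨c, fun _ => hc⟩
    · exact ⟨0, fun h => absurd h hK⟩
  choose c hc using hex
  have hdisj : (T : Set (Finset (Pt d))).PairwiseDisjoint
      fun K => Metric.ball (c K) (r / (4 * t)) := by
    intro K hK K' hK' hne
    exact (M.pairwise_disjoint_interior (hTm.1 hK).1 (hTm.1 hK').1 hne).mono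
      ((hc K hK).trans inter_subset_left) ((hc K' hK').trans inter_subset_left)
  have h1 := measureReal_biUnion_finset (μ := volume) hdisj
    (fun K _ => Metric.isOpen_ball.measurableSet) (fun K _ => measure_ball_lt_top.ne)
  have h2 : volume.real (⋃ K ∈ T, Metric.ball (c K) (r / (4 * t))) ≤
      volume.real (Metric.closedBall z r) :=
    measureReal_mono (iUnion₂_subset fun K hK => (hc K hK).trans inter_subset_right)
      measure_closedBall_lt_top.ne
  rw [h1, measureReal_closedBall z hr0.le,
    Finset.sum_congr rfl fun K _ => measureReal_ball (c K) (by positivity), Finset.sum_const,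
    nsmul_eq_mul, ← mul_assoc] at h2
  have h3 := le_of_mul_le_mul_right h2 measureReal_ball_pos
  rw [div_pow, mul_div_assoc', div_le_iff₀ (by positivity), mul_comm] at h3
  exact le_of_mul_le_mul_left h3 (by positivity)

/-- Neighbouring elements have comparable diameters. -/
theorem diam_le_of_shared (hd : 2 ≤ d) {t : ℝ} (ht0 : 0 < t)
    (ht : ∀ K ∈ M.elems, Metric.diam (hull K) ≤ t * inDiam K) {F K K' : Finset (Pt d)}
    (hK : K ∈ M.elems) (hFK : F ⊆ K) (hFK' : F ⊆ K') (hF : F.card = d) :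
    Metric.diam (hull K) ≤ 2 * t * Metric.diam (hull K') := by
  -- For `d ≥ 2` the common face has an edge. Its length bounds `inDiam K` from above up to a factor
  -- 2 and is at most the diameter of `K'`.
  obtain ⟨a, ha, b, hb, hab⟩ := Finset.one_lt_card.1 (show 1 < F.card by omega)
  have h1 := (M.isSimplex hK).inDiam_le_dist (by omega) (hFK ha) (hFK hb) hab
  have h2 := dist_le_diam_hull (mem_hull_of_mem (hFK' ha)) (mem_hull_of_mem (hFK' hb))
  calc Metric.diam (hull K) ≤ t * inDiam K := ht K hK
    _ ≤ t * (2 * Metric.diam (hull K')) := by gcongr; linarith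
    _ = _ := by ring

variable {p : Finset (Pt d) → Pt d →ᵃ[ℝ] ℝ}

/-- Telescoping along the walk. Each step crosses an interior face containing `z` on which the jump
has mean zero, so it contributes at most twice `G` times the diameter of the current element.
Diameters grow by at most `2 * t` per step, and `1 / 2 ≤ t` lets a single power dominate all steps.
-/
theorem abs_sub_le_of_walk (hd : 2 ≤ d) {t : ℝ} (ht0 : 1 / 2 ≤ t)
    (ht : ∀ K ∈ M.elems, Metric.diam (hull K) ≤ t * inDiam K) (hp : M.JumpsVanish p) {z : Pt d}
    {K K' : M.Star z} (w : (M.starGraph z).Walk K K') {G : ℝ}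
    (hG : ∀ K'', (M.starGraph z).Reachable K K'' → ‖affGrad (p K''.1)‖ ≤ G) :
    Metric.diam (hull K'.1) ≤ (2 * t) ^ w.length * Metric.diam (hull K.1) ∧
      |p K.1 z - p K'.1 z| ≤
        2 * w.length * (2 * t) ^ w.length * G * Metric.diam (hull K.1) := by
  induction w with
  | nil => simp
  | @cons K₁ K₂ K₃ hadj w ih =>
    have hr : (M.starGraph z).Reachable K₁ K₂ := hadj.reachable
    obtain ⟨ih1, ih2⟩ := ih fun K'' h => hG K'' (hr.trans h)
    have hadj' := hadj
    obtain ⟨-, F, h1, h2, hcard, hzF, hb⟩ := hadj'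
    obtain ⟨y, hf⟩ := (M.isSimplex K₁.2.1).exists_isFaceOf h1 hcard
    have hD := M.diam_le_of_shared hd (by linarith) ht K₂.2.1 h2 h1 hcard
    have hjump : |(p K₁.1 - p K₂.1) z| ≤ ‖affGrad (p K₁.1 - p K₂.1)‖ * Metric.diam (hull F) :=
      hf.abs_le_of_faceIntegral_eq_zero (by omega)
        ((hp F (M.mem_faces_of_isFaceOf K₁.2.1 hf)).1 hb _ K₁.2.1 _ K₂.2.1 h1 h2)
        (mem_hull_of_mem hzF)
    have hG1 := hG K₁ (SimpleGraph.Reachable.refl _)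
    have hG2 := hG K₂ hr
    have hG0 : 0 ≤ G := (norm_nonneg _).trans hG1
    set D := Metric.diam (hull K₁.1) with hD'
    have hD0 : 0 ≤ D := Metric.diam_nonneg
    have hg : 1 ≤ 2 * t := by linarith
    set m := w.length with hm
    have hgm : 1 ≤ (2 * t) ^ m := one_le_pow₀ hg
    have hgm1 : 1 ≤ (2 * t) ^ (m + 1) := one_le_pow₀ hg
    rw [SimpleGraph.Walk.length_cons]
    constructor
    · calc Metric.diam (hull K₃.1) ≤ (2 * t) ^ m * Metric.diam (hull K₂.1) := ih1
        _ ≤ (2 * t) ^ m * (2 * t * D) := by gcongr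
        _ = (2 * t) ^ (m + 1) * D := by ring
    · have e1 : |p K₁.1 z - p K₂.1 z| ≤ 2 * G * D := by
        refine hjump.trans ?_
        have : ‖affGrad (p K₁.1 - p K₂.1)‖ ≤ 2 * G := by
          rw [affGrad_sub]
          refine (norm_sub_le _ _).trans ?_
          linarith
        have := diam_hull_mono h1
        gcongr
      have e2 : |p K₂.1 z - p K₃.1 z| ≤ 2 * m * (2 * t) ^ m * G * (2 * t * D) := by
        refine ih2.trans ?_
        gcongr
      calc |p K₁.1 z - p K₃.1 z| ≤ |p K₁.1 z - p K₂.1 z| + |p K₂.1 z - p K₃.1 z| := abs_sub_le _ _ _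
        _ ≤ 1 * (2 * G * D) + 2 * m * (2 * t) ^ m * G * (2 * t * D) := by linarith
        _ ≤ (2 * t) ^ (m + 1) * (2 * G * D) + 2 * m * (2 * t) ^ m * G * (2 * t * D) := by gcongr
        _ = 2 * (m + 1 : ℕ) * (2 * t) ^ (m + 1) * G * D := by push_cast; ring

/-- A path visits no element twice, so its length is less than the size of the star. The second
summand on the left reserves room for one more step, from the last element to a boundary face. -/
theorem abs_sub_le_of_reachable (hd : 2 ≤ d) {t : ℝ} (ht0 : 1 / 2 ≤ t)
    (ht : ∀ K ∈ M.elems, Metric.diam (hull K) ≤ t * inDiam K) (hp : M.JumpsVanish p) {z : Pt d}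
    {K K' : M.Star z} (h : (M.starGraph z).Reachable K K') {G : ℝ}
    (hG : ∀ K'', (M.starGraph z).Reachable K K'' → ‖affGrad (p K''.1)‖ ≤ G) :
    |p K.1 z - p K'.1 z| + G * Metric.diam (hull K'.1) ≤
      nodeConst d t * G * Metric.diam (hull K.1) := by
  obtain ⟨w, hw⟩ := h.exists_isPath
  have : Finite (M.Star z) := (M.elems.finite_toSet.subset fun K hK => hK.1 : Set.Finite
    {K : Finset (Pt d) | K ∈ M.elems ∧ z ∈ K}).to_subtype
  have := Fintype.ofFinite (M.Star z)
  have hlen : w.length + 1 ≤ starBound d t := by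
    refine (Nat.succ_le_of_lt hw.length_lt).trans ?_
    rw [← Nat.card_eq_fintype_card]
    exact M.card_star_le (by omega) (by linarith) ht z
  obtain ⟨h1, h2⟩ := M.abs_sub_le_of_walk hd ht0 ht hp w hG
  have hG0 : 0 ≤ G := (norm_nonneg _).trans (hG K (SimpleGraph.Reachable.refl _))
  set D := Metric.diam (hull K.1)
  have hD0 : 0 ≤ D := Metric.diam_nonneg
  have hg : 1 ≤ 2 * t := by linarith
  set m := w.length with hm
  have hpow : (2 * t) ^ m ≤ (2 * t) ^ starBound d t := pow_le_pow_right₀ hg (by omega)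
  have hlen' : (m : ℝ) + 1 ≤ starBound d t := by exact_mod_cast hlen
  calc |p K.1 z - p K'.1 z| + G * Metric.diam (hull K'.1)
      ≤ 2 * m * (2 * t) ^ m * G * D + G * ((2 * t) ^ m * D) := by gcongr
    _ = (2 * m + 1) * (2 * t) ^ m * G * D := by ring
    _ ≤ (2 * starBound d t) * (2 * t) ^ starBound d t * G * D := by
      gcongr
      linarith

theorem diam_le_of_reachable (hd : 2 ≤ d) {t : ℝ} (ht0 : 1 / 2 ≤ t)
    (ht : ∀ K ∈ M.elems, Metric.diam (hull K) ≤ t * inDiam K) {z : Pt d}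
    {K K' : M.Star z} (h : (M.starGraph z).Reachable K K') :
    Metric.diam (hull K'.1) ≤ (2 * t) ^ starBound d t * Metric.diam (hull K.1) := by
  obtain ⟨w, hw⟩ := h.exists_isPath
  have : Finite (M.Star z) := (M.elems.finite_toSet.subset fun K hK => hK.1 : Set.Finite
    {K : Finset (Pt d) | K ∈ M.elems ∧ z ∈ K}).to_subtype
  have := Fintype.ofFinite (M.Star z)
  have hlen : w.length ≤ starBound d t := by
    refine hw.length_lt.le.trans ?_
    rw [← Nat.card_eq_fintype_card]
    exact M.card_star_le (by omega) (by linarith) ht z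
  -- The zero function merely gives access to the diameter part of the walk estimate.
  have hp : M.JumpsVanish (fun _ => 0) := fun F _ => by simp [faceIntegral]
  obtain ⟨h1, -⟩ := M.abs_sub_le_of_walk hd ht0 ht hp w (G := ‖affGrad (0 : Pt d →ᵃ[ℝ] ℝ)‖)
    fun _ _ => le_rfl
  refine h1.trans ?_
  gcongr
  linarith

end Mesh

/-! ### Stability of the smoothing operator -/

theorem norm_fderiv_affine (p : Pt d →ᵃ[ℝ] ℝ) (x : Pt d) : ‖fderiv ℝ p x‖ = ‖affGrad p‖ := by
  rw [← norm_gradient, Mesh.gradient_affine]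

namespace IsSimplex

variable {K : Finset (Pt d)}

theorem norm_affGrad_bary_le (hK : IsSimplex K) (hd : 1 ≤ d) (z : Pt d) :
    ‖affGrad (bary K z)‖ ≤ 2 / inDiam K := by
  have h := hK.abs_linear_bary_le hd z (affGrad (bary K z))
  have hρ := hK.inDiam_pos hd
  rw [← inner_affGrad, real_inner_self_eq_norm_sq, abs_of_nonneg (by positivity)] at h
  rcases (norm_nonneg (affGrad (bary K z))).eq_or_lt with h0 | h0
  · rw [← h0]; positivity
  · nlinarith

theorem affGrad_eq_sum (hK : IsSimplex K) (f : Pt d →ᵃ[ℝ] ℝ) :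
    affGrad f = ∑ z ∈ K, f z • affGrad (bary K z) := by
  refine affGrad_unique fun w => ?_
  conv_rhs => rw [hK.affine_eq_sum f, linear_sum_smul_apply]
  rw [sum_inner]
  exact Finset.sum_congr rfl fun z _ => by rw [real_inner_smul_left, inner_affGrad]

/-- An inverse estimate: the gradient is the combination of the `d + 1` gradients of barycentric
coordinates with the vertex values as coefficients. -/
theorem norm_affGrad_le (hK : IsSimplex K) (hd : 1 ≤ d) {f : Pt d →ᵃ[ℝ] ℝ} {m : ℝ}
    (hf : ∀ z ∈ K, |f z| ≤ m) : ‖affGrad f‖ ≤ (d + 1) * (m * (2 / inDiam K)) := by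
  rw [hK.affGrad_eq_sum f]
  refine (norm_sum_le _ _).trans ((Finset.sum_le_card_nsmul K _ (m * (2 / inDiam K))
    fun z hz => ?_).trans (le_of_eq ?_))
  · rw [norm_smul, Real.norm_eq_abs]
    exact mul_le_mul (hf z hz) (hK.norm_affGrad_bary_le hd z) (norm_nonneg _)
      ((abs_nonneg _).trans (hf z hz))
  · rw [hK.card_eq, nsmul_eq_mul]; push_cast; rfl

theorem norm_fderiv_prod_bary_le (hK : IsSimplex K) (hd : 1 ≤ d) (F : Finset (Pt d)) {x : Pt d}
    (hx : x ∈ hull K) :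
    ‖fderiv ℝ (fun y => ∏ w ∈ F, bary K w y) x‖ ≤ F.card * (2 / inDiam K) := by
  classical
  have h := HasFDerivAt.finsetProd (u := F) (x := x) fun w _ =>
    ((contDiff_affine (bary K w)).differentiable (by simp) x).hasFDerivAt
  rw [h.fderiv]
  refine (norm_sum_le _ _).trans ((Finset.sum_le_card_nsmul F _ (2 / inDiam K)
    fun w _ => ?_).trans (le_of_eq (nsmul_eq_mul _ _)))
  rw [norm_smul, norm_fderiv_affine]
  refine (mul_le_mul ?_ (hK.norm_affGrad_bary_le hd w) (norm_nonneg _) zero_le_one).trans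
    (one_mul _).le
  rw [Real.norm_eq_abs, Finset.abs_prod]
  refine Finset.prod_le_one (fun _ _ => abs_nonneg _) fun y _ => ?_
  rw [abs_of_nonneg (hK.bary_nonneg hx y)]
  exact hK.bary_le_one hx y

end IsSimplex

/-- The ratio of the mean value of a face bubble to its maximum is bounded from below. -/
def bubbleConst (d : ℕ) : ℝ := (1 / (2 * d)) ^ d * (1 / 2) ^ (d - 1)

theorem bubbleConst_pos (hd : 1 ≤ d) : 0 < bubbleConst d := by
  have : (0 : ℝ) < d := by exact_mod_cast hd
  rw [bubbleConst]
  positivity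

/-- The constant in the local bound of the gradient of the smoothed function. -/
def gradConst (d : ℕ) (t : ℝ) : ℝ :=
  1 + (d + 1) * nodeConst d t * (2 * t) * (1 + d / bubbleConst d)

/-- A bound for the ratio of the volumes of elements that share a vertex. -/
def volConst (d : ℕ) (t : ℝ) : ℝ := (4 * ((2 * t) ^ starBound d t * t)) ^ d

/-- The stability constant of the smoothing operator. -/
def smoothConst (d : ℕ) (t : ℝ) : ℝ :=
  gradConst d t * ((d + 1) * starBound d t) * volConst d t

namespace Mesh

variable {Ω : Set (Pt d)} (M : Mesh Ω)

/-- The elements `K` and `K'` share a vertex around which they are connected through interior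
faces. -/
def Linked (K K' : Finset (Pt d)) : Prop :=
  ∃ (z : Pt d) (h : K ∈ M.elems ∧ z ∈ K) (h' : K' ∈ M.elems ∧ z ∈ K'),
    (M.starGraph z).Reachable ⟨K, h⟩ ⟨K', h'⟩

variable {M} in
theorem Linked.symm {K K' : Finset (Pt d)} (h : M.Linked K K') : M.Linked K' K := by
  obtain ⟨z, h, h', hr⟩ := h
  exact ⟨z, h', h, hr.symm⟩

theorem linked_self {K : Finset (Pt d)} (hK : K ∈ M.elems) : M.Linked K K := by
  obtain ⟨z, hz⟩ := (M.isSimplex hK).nonempty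
  exact ⟨z, ⟨hK, hz⟩, ⟨hK, hz⟩, SimpleGraph.Reachable.refl _⟩

open Classical in
/-- The elements that are linked to `K`. -/
def patch (K : Finset (Pt d)) : Finset (Finset (Pt d)) := M.elems.filter (M.Linked K)

theorem mem_patch {K K' : Finset (Pt d)} : K' ∈ M.patch K ↔ K' ∈ M.elems ∧ M.Linked K K' := by
  simp [patch]

theorem card_patch_le (hd : 1 ≤ d) {t : ℝ} (ht0 : 0 < t)
    (ht : ∀ K ∈ M.elems, Metric.diam (hull K) ≤ t * inDiam K) {K : Finset (Pt d)}
    (hK : K ∈ M.elems) : (M.patch K).card ≤ (d + 1) * starBound d t := by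
  classical
  have hsub : M.patch K ⊆ K.biUnion fun z => M.elems.filter (z ∈ ·) := by
    intro K' hK'
    obtain ⟨-, z, h, h', -⟩ := M.mem_patch.1 hK'
    exact Finset.mem_biUnion.2 ⟨z, h.2, Finset.mem_filter.2 h'⟩
  refine (Finset.card_le_card hsub).trans ?_
  rw [← (M.isSimplex hK).card_eq]
  refine Finset.card_biUnion_le_card_mul _ _ _ fun z _ => ?_
  have hcard : Nat.card (M.Star z) = (M.elems.filter (z ∈ ·)).card :=
    Nat.subtype_card _ fun K => by simp
  rw [← hcard]
  exact M.card_star_le hd ht0 ht z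

variable {Kz : Pt d → Finset (Pt d)} {p : Finset (Pt d) → Pt d →ᵃ[ℝ] ℝ}

/-- In an interior vertex the average takes the value from the chosen element, and a chain leads
there from `K`. In a boundary vertex the average is zero; a chain leads to an element with a
boundary face at `z`, on which `p` has mean zero and is small in `z`. -/
theorem abs_avgPiece_sub_le (hΩ : IsLipschitzDomain Ω) (hd : 2 ≤ d) (hKz : M.IsNodeChoice Kz)
    {t : ℝ} (ht0 : 1 / 2 ≤ t) (ht : ∀ K ∈ M.elems, Metric.diam (hull K) ≤ t * inDiam K)
    (hp : M.JumpsVanish p) {K : Finset (Pt d)} (hK : K ∈ M.elems) {G : ℝ}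
    (hG : ∀ K', M.Linked K K' → ‖affGrad (p K')‖ ≤ G) {z : Pt d} (hz : z ∈ K) :
    |M.avgPiece Kz p K z - p K z| ≤ nodeConst d t * G * Metric.diam (hull K) := by
  have hG' : ∀ K'', (M.starGraph z).Reachable ⟨K, hK, hz⟩ K'' → ‖affGrad (p K''.1)‖ ≤ G :=
    fun K'' h => hG _ ⟨z, ⟨hK, hz⟩, K''.2, h⟩
  classical
  rw [M.avgPiece_vertex hK hz]
  split_ifs with h
  · have hm := hKz.mem M (M.mem_interiorVertices_iff.2 ⟨⟨K, hK, hz⟩, h⟩)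
    have hr := M.starGraph_reachable hΩ (by omega) h ⟨K, hK, hz⟩ ⟨_, hm⟩
    have h1 := M.abs_sub_le_of_reachable hd ht0 ht hp hr hG'
    have h2 : 0 ≤ G * Metric.diam (hull (Kz z)) :=
      mul_nonneg ((norm_nonneg _).trans (hG' _ hr)) Metric.diam_nonneg
    rw [abs_sub_comm]
    linarith
  · obtain ⟨K', hr, F, hFK, hcard, hzF, hb⟩ :=
      M.exists_boundaryFace_reachable hΩ (by omega) h ⟨K, hK, hz⟩
    obtain ⟨y, hf⟩ := (M.isSimplex K'.2.1).exists_isFaceOf hFK hcard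
    have h1 := M.abs_sub_le_of_reachable hd ht0 ht hp hr hG'
    have h2 := hf.abs_le_of_faceIntegral_eq_zero (by omega)
      ((hp F (M.mem_faces_of_isFaceOf K'.2.1 hf)).2 hb _ K'.2.1 hFK) (mem_hull_of_mem hzF)
    have h3 : ‖affGrad (p K'.1)‖ * Metric.diam (hull F) ≤ G * Metric.diam (hull K'.1) :=
      mul_le_mul (hG' _ hr) (diam_hull_mono hFK) Metric.diam_nonneg
        ((norm_nonneg _).trans (hG' _ hr))
    have h4 := abs_sub_abs_le_abs_sub (p K z) (p K'.1 z)
    rw [zero_sub, abs_neg]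
    change |p K z - p K'.1 z| + _ ≤ nodeConst d t * G * Metric.diam (hull K) at h1
    linarith

/-- The coefficient integrates an affine function bounded by `m` over the face, and the normalizing
integral is at least `bubbleConst d` times the area. The area cancels. -/
theorem abs_bubbleCoef_mul_le (hd : 1 ≤ d) (hp : M.JumpsVanish p)
    {F K : Finset (Pt d)} {z : Pt d} (hK : K ∈ M.elems) (hF : F ∈ M.interiorFaces)
    (h : IsFaceOf F K z) {m : ℝ} (hm : ∀ z ∈ K, |M.avgPiece Kz p K z - p K z| ≤ m) :
    |M.bubbleCoef Kz p F * (faceIntegral F (M.bubble F))⁻¹| ≤ m / bubbleConst d := by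
  have hA := h.faceArea_pos hd
  have hc := bubbleConst_pos hd
  have h1 : |M.bubbleCoef Kz p F| ≤ m * faceArea F := by
    rw [M.bubbleCoef_eq hp hF hK h]
    refine h.abs_faceIntegral_le fun y hy => ?_
    have hy' := hull_mono h.subset hy
    have hup := le_of_mem_hull (p K - M.avgPiece Kz p K) (AffineMap.const ℝ _ m)
      (fun w hw => by
        have := (abs_le.1 (hm w hw)).1
        simp only [AffineMap.coe_sub, Pi.sub_apply, AffineMap.const_apply]
        linarith) hy'
    have hlo := le_of_mem_hull (M.avgPiece Kz p K - p K) (AffineMap.const ℝ _ m)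
      (fun w hw => (abs_le.1 (hm w hw)).2) hy'
    simp only [AffineMap.coe_sub, Pi.sub_apply, AffineMap.const_apply] at hup hlo
    exact abs_le.2 ⟨by linarith, hup⟩
  have h2 : bubbleConst d * faceArea F ≤ faceIntegral F (M.bubble F) := by
    rw [M.faceIntegral_bubble hK h, bubbleConst, mul_assoc]
    exact h.le_faceIntegral_prod_bary hd
  have h0 : 0 < bubbleConst d * faceArea F := by positivity
  rw [abs_mul, abs_inv, abs_of_pos (h0.trans_le h2), ← div_eq_mul_inv,
    div_le_div_iff₀ (h0.trans_le h2) hc]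
  have hm0 : 0 ≤ m := by
    by_contra! hneg
    have := (abs_nonneg _).trans h1
    nlinarith
  calc |M.bubbleCoef Kz p F| * bubbleConst d ≤ m * faceArea F * bubbleConst d := by gcongr
    _ = m * (bubbleConst d * faceArea F) := by ring
    _ ≤ m * faceIntegral F (M.bubble F) := by gcongr

/-- The nodal error carries a factor diameter and every derivative a factor `2 / inDiam K`; their
product is at most `2 * t`, so the bound is free of the mesh size. At most `d + 1` bubbles are
active on an element. -/
theorem norm_fderiv_smoothPiece_le (hΩ : IsLipschitzDomain Ω) (hd : 2 ≤ d)
    (hKz : M.IsNodeChoice Kz) {t : ℝ} (ht0 : 1 / 2 ≤ t)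
    (ht : ∀ K ∈ M.elems, Metric.diam (hull K) ≤ t * inDiam K)
    (hp : M.JumpsVanish p) {K : Finset (Pt d)} (hK : K ∈ M.elems) {G : ℝ}
    (hG : ∀ K', M.Linked K K' → ‖affGrad (p K')‖ ≤ G) {x : Pt d} (hx : x ∈ hull K) :
    ‖fderiv ℝ (M.smoothPiece Kz p K) x‖ ≤ gradConst d t * G := by
  classical
  have hd1 : 1 ≤ d := by omega
  have hKs := M.isSimplex hK
  have hρ := hKs.inDiam_pos hd1
  have hc := bubbleConst_pos hd1
  have hG0 : 0 ≤ G := (norm_nonneg _).trans (hG K (M.linked_self hK))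
  set A := nodeConst d t with hA
  have hA0 : 0 ≤ A := by rw [hA, nodeConst]; positivity
  set m := A * G * Metric.diam (hull K) with hm
  have hnode : ∀ z ∈ K, |M.avgPiece Kz p K z - p K z| ≤ m := fun z hz =>
    M.abs_avgPiece_sub_le hΩ hd hKz ht0 ht hp hK hG hz
  have hmρ : m * (2 / inDiam K) ≤ A * G * (2 * t) := by
    rw [mul_div_assoc', div_le_iff₀ hρ, hm]
    calc A * G * Metric.diam (hull K) * 2 ≤ A * G * (t * inDiam K) * 2 := by
          gcongr
          exact ht K hK
      _ = _ := by ring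
  have hm0 : 0 ≤ m := by positivity
  -- the nodal average
  have havg : ‖fderiv ℝ (M.avgPiece Kz p K) x‖ ≤ G + (d + 1) * (A * G * (2 * t)) := by
    rw [norm_fderiv_affine]
    have e : affGrad (M.avgPiece Kz p K) =
        affGrad (p K) + affGrad (M.avgPiece Kz p K - p K) := by rw [affGrad_sub]; abel
    rw [e]
    refine (norm_add_le _ _).trans (add_le_add (hG K (M.linked_self hK)) ?_)
    refine (hKs.norm_affGrad_le hd1 (f := M.avgPiece Kz p K - p K) hnode).trans ?_
    gcongr
  -- the bubbles
  have hdiff : ∀ F : Finset (Pt d), DifferentiableAt ℝ (fun y => ∏ w ∈ F, bary K w y) x :=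
    fun F => (contDiff_prod fun w _ => contDiff_affine (bary K w)).differentiable (by simp) x
  have hbub : ∀ F ∈ M.interiorFaces, ‖fderiv ℝ (fun y => M.bubbleCoef Kz p F *
      ((faceIntegral F (M.bubble F))⁻¹ * ∏ w ∈ F, bary K w y)) x‖ ≤
      if F ⊆ K then d / bubbleConst d * (A * G * (2 * t)) else 0 := by
    intro F hF
    have hcard := M.card_of_mem_faces (M.mem_faces_of_mem_interiorFaces hF)
    split_ifs with hFK
    · obtain ⟨z, h⟩ := hKs.exists_isFaceOf hFK hcard
      have h1 := M.abs_bubbleCoef_mul_le hd1 hp hK hF h hnode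
      have h2 := hKs.norm_fderiv_prod_bary_le hd1 F hx
      rw [hcard] at h2
      have e : (fun y => M.bubbleCoef Kz p F * ((faceIntegral F (M.bubble F))⁻¹ *
          ∏ w ∈ F, bary K w y)) = fun y => M.bubbleCoef Kz p F * (faceIntegral F (M.bubble F))⁻¹ *
          ∏ w ∈ F, bary K w y := by
        ext y
        rw [mul_assoc]
      rw [e, fderiv_const_mul (hdiff F), norm_smul, Real.norm_eq_abs]
      refine (mul_le_mul h1 h2 (norm_nonneg _) (by positivity)).trans ?_
      calc m / bubbleConst d * (d * (2 / inDiam K))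
          = d / bubbleConst d * (m * (2 / inDiam K)) := by ring
        _ ≤ _ := mul_le_mul_of_nonneg_left hmρ (by positivity)
    · obtain ⟨w, hw, hwK⟩ := Finset.not_subset.1 hFK
      have e : (fun y => M.bubbleCoef Kz p F * ((faceIntegral F (M.bubble F))⁻¹ *
          ∏ w ∈ F, bary K w y)) = fun _ => 0 := by
        ext y
        rw [Finset.prod_eq_zero hw (by rw [hKs.bary_of_notMem hwK]; rfl), mul_zero, mul_zero]
      rw [e]
      simp
  have e : M.smoothPiece Kz p K = fun y => M.avgPiece Kz p K y + ∑ F ∈ M.interiorFaces,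
      M.bubbleCoef Kz p F * ((faceIntegral F (M.bubble F))⁻¹ * ∏ z ∈ F, bary K z y) := rfl
  have hdiff' : ∀ F ∈ M.interiorFaces, DifferentiableAt ℝ (fun y => M.bubbleCoef Kz p F *
      ((faceIntegral F (M.bubble F))⁻¹ * ∏ w ∈ F, bary K w y)) x :=
    fun F _ => ((hdiff F).const_mul _).const_mul _
  rw [e, fderiv_fun_add ((contDiff_affine _).differentiable (by simp) x)
    (DifferentiableAt.fun_sum hdiff'), fderiv_fun_sum hdiff']
  have hcount : ((M.interiorFaces.filter (· ⊆ K)).card : ℝ) ≤ d + 1 := by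
    have hsub : M.interiorFaces.filter (· ⊆ K) ⊆ K.powersetCard d := by
      intro F hF
      obtain ⟨h1, h2⟩ := Finset.mem_filter.1 hF
      exact Finset.mem_powersetCard.2
        ⟨h2, M.card_of_mem_faces (M.mem_faces_of_mem_interiorFaces h1)⟩
    have := Finset.card_le_card hsub
    rw [Finset.card_powersetCard, hKs.card_eq, Nat.choose_succ_self_right] at this
    exact_mod_cast this
  have hsum : ‖∑ F ∈ M.interiorFaces, fderiv ℝ (fun y => M.bubbleCoef Kz p F *
      ((faceIntegral F (M.bubble F))⁻¹ * ∏ w ∈ F, bary K w y)) x‖ ≤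
      (d + 1) * (d / bubbleConst d * (A * G * (2 * t))) := by
    refine (norm_sum_le _ _).trans ((Finset.sum_le_sum hbub).trans ?_)
    rw [← Finset.sum_filter, Finset.sum_const, nsmul_eq_mul]
    gcongr
  refine (norm_add_le _ _).trans ((add_le_add havg hsum).trans (le_of_eq ?_))
  rw [gradConst]
  ring

theorem measureReal_le_of_linked (hd : 2 ≤ d) {t : ℝ} (ht0 : 1 / 2 ≤ t)
    (ht : ∀ K ∈ M.elems, Metric.diam (hull K) ≤ t * inDiam K) {K K' : Finset (Pt d)}
    (h : M.Linked K K') : volume.real (hull K) ≤ volConst d t * volume.real (hull K') := by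
  obtain ⟨z, hK, hK', hr⟩ := h
  refine (M.isSimplex hK.1).measureReal_le (M.isSimplex hK'.1) (by omega) ?_
  refine (M.diam_le_of_reachable hd ht0 ht hr.symm).trans ?_
  rw [mul_assoc]
  gcongr
  exact ht K' hK'.1

/-- Cauchy-Schwarz in each patch costs the size of the patch, and linked elements have comparable
volumes. Being linked is symmetric, so after exchanging the sums each element is counted at most as
often as its own patch is large. -/
theorem sum_mul_sq_sum_patch_le (hd : 2 ≤ d) {t : ℝ} (ht0 : 1 / 2 ≤ t)
    (ht : ∀ K ∈ M.elems, Metric.diam (hull K) ≤ t * inDiam K) (a : Finset (Pt d) → ℝ) :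
    ∑ K ∈ M.elems, volume.real (hull K) * (∑ K' ∈ M.patch K, a K') ^ 2 ≤
      ((d + 1) * starBound d t) ^ 2 * volConst d t *
        ∑ K ∈ M.elems, volume.real (hull K) * a K ^ 2 := by
  classical
  set n : ℝ := (d + 1) * starBound d t with hn
  have hn0 : 0 ≤ n := by positivity
  have ht' : 0 < t := by linarith
  have hR : 0 ≤ volConst d t := by rw [volConst]; positivity
  have hcard : ∀ K ∈ M.elems, ((M.patch K).card : ℝ) ≤ n := fun K hK => by
    rw [hn]
    exact_mod_cast M.card_patch_le (by omega) ht' ht hK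
  have h1 : ∀ K ∈ M.elems, volume.real (hull K) * (∑ K' ∈ M.patch K, a K') ^ 2 ≤
      n * volConst d t * ∑ K' ∈ M.patch K, volume.real (hull K') * a K' ^ 2 := by
    intro K hK
    calc volume.real (hull K) * (∑ K' ∈ M.patch K, a K') ^ 2
        ≤ volume.real (hull K) * (n * ∑ K' ∈ M.patch K, a K' ^ 2) := by
          gcongr
          refine sq_sum_le_card_mul_sum_sq.trans ?_
          gcongr
          exact hcard K hK
      _ = n * ∑ K' ∈ M.patch K, volume.real (hull K) * a K' ^ 2 := by
          rw [← Finset.mul_sum]; ring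
      _ ≤ n * ∑ K' ∈ M.patch K, volConst d t * volume.real (hull K') * a K' ^ 2 := by
          gcongr with K' hK'
          exact M.measureReal_le_of_linked hd ht0 ht (M.mem_patch.1 hK').2
      _ = _ := by simp only [mul_assoc, ← Finset.mul_sum]
  refine (Finset.sum_le_sum h1).trans ?_
  rw [← Finset.mul_sum]
  have h2 : ∑ K ∈ M.elems, ∑ K' ∈ M.patch K, volume.real (hull K') * a K' ^ 2 ≤
      n * ∑ K ∈ M.elems, volume.real (hull K) * a K ^ 2 := by
    have e : ∑ K ∈ M.elems, ∑ K' ∈ M.patch K, volume.real (hull K') * a K' ^ 2 =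
        ∑ K' ∈ M.elems, ∑ _K ∈ M.patch K', volume.real (hull K') * a K' ^ 2 :=
      Finset.sum_comm' fun K K' => by
        rw [M.mem_patch, M.mem_patch]
        exact ⟨fun h => ⟨⟨h.1, h.2.2.symm⟩, h.2.1⟩, fun h => ⟨h.1.1, h.2, h.1.2.symm⟩⟩
    rw [e, Finset.mul_sum]
    refine Finset.sum_le_sum fun K hK => ?_
    rw [Finset.sum_const, nsmul_eq_mul]
    gcongr
    exact hcard K hK
  calc _ ≤ n * volConst d t * (n * ∑ K ∈ M.elems, volume.real (hull K) * a K ^ 2) := by gcongr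
    _ = _ := by ring

/-- The smoothing operator is bounded in the broken energy norm. -/
theorem norm_brokenGrad_smoothing_le (hΩ : IsLipschitzDomain Ω) (hd : 2 ≤ d)
    (hd1 : 1 ≤ d) (hKz : M.IsNodeChoice Kz) {t : ℝ} (ht0 : 1 / 2 ≤ t)
    (ht : ∀ K ∈ M.elems, Metric.diam (hull K) ≤ t * inDiam K) (σ : M.S) :
    ‖M.brokenGrad (M.smoothing hΩ hd1 hKz σ)‖ ≤ smoothConst d t * ‖M.brokenGrad σ‖ := by
  set p := M.piece ((σ : M.brokenH1) : L2 Ω) with hp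
  have hj : M.JumpsVanish p := M.jumpsVanish_piece (s := ((σ : M.brokenH1) : L2 Ω)) hΩ σ.2
  have hB : 0 ≤ gradConst d t := by
    have := bubbleConst_pos hd1
    rw [gradConst, nodeConst]
    positivity
  have hR : 1 ≤ volConst d t := by
    refine one_le_pow₀ ?_
    have : 1 ≤ (2 * t) ^ starBound d t := one_le_pow₀ (by linarith)
    nlinarith
  have h1 : ‖M.brokenGrad σ‖ ^ 2 =
      ∑ K ∈ M.elems, volume.real (hull K) * ‖affGrad (p K)‖ ^ 2 := by
    rw [← real_inner_self_eq_norm_sq,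
      M.inner_eq_sum hΩ (M.brokenGrad_ae_of_mem_S hΩ σ) (M.brokenGrad_ae_of_mem_S hΩ σ)]
    refine Finset.sum_congr rfl fun K _ => ?_
    rw [setIntegral_const, smul_eq_mul, real_inner_self_eq_norm_sq]
  have h2 : ‖M.brokenGrad (M.smoothing hΩ hd1 hKz σ)‖ ^ 2 ≤ ∑ K ∈ M.elems, gradConst d t ^ 2 *
      (volume.real (hull K) * (∑ K' ∈ M.patch K, ‖affGrad (p K')‖) ^ 2) := by
    rw [← real_inner_self_eq_norm_sq,
      M.inner_eq_sum hΩ (M.brokenGrad_smoothing_ae hΩ hd1 hKz σ)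
        (M.brokenGrad_smoothing_ae hΩ hd1 hKz σ)]
    refine Finset.sum_le_sum fun K hK => ?_
    -- The sum over the patch bounds every gradient in it; unlike the maximum it can be treated by
    -- Cauchy-Schwarz.
    set G := ∑ K' ∈ M.patch K, ‖affGrad (p K')‖ with hG
    have hGle : ∀ K', M.Linked K K' → ‖affGrad (p K')‖ ≤ G := fun K' h =>
      Finset.single_le_sum (f := fun K' => ‖affGrad (p K')‖) (fun _ _ => norm_nonneg _)
        (M.mem_patch.2 ⟨by obtain ⟨_, _, h', _⟩ := h; exact h'.1, h⟩)
    have e : gradConst d t ^ 2 * (volume.real (hull K) * G ^ 2) =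
        (gradConst d t * G) ^ 2 * volume.real (hull K) := by ring
    rw [e]
    refine (le_abs_self _).trans ?_
    rw [← Real.norm_eq_abs]
    refine norm_setIntegral_le_of_norm_le_const (isCompact_hull K).measure_lt_top fun x hx => ?_
    rw [real_inner_self_eq_norm_sq, norm_pow, norm_norm, norm_gradient]
    gcongr
    exact M.norm_fderiv_smoothPiece_le hΩ hd hKz ht0 ht hj hK hGle hx
  have h3 := M.sum_mul_sq_sum_patch_le hd ht0 ht fun K => ‖affGrad (p K)‖
  rw [← Finset.mul_sum] at h2
  rw [← h1] at h3
  have hS : 0 ≤ smoothConst d t := by rw [smoothConst]; positivity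
  rw [← pow_le_pow_iff_left₀ (norm_nonneg _) (by positivity) two_ne_zero]
  calc _ ≤ gradConst d t ^ 2 * (((d + 1) * starBound d t) ^ 2 * volConst d t *
        ‖M.brokenGrad σ‖ ^ 2) := h2.trans (by gcongr)
    -- Since `1 ≤ volConst d t`, squaring this factor is harmless and avoids a square root in the
    -- constant.
    _ ≤ gradConst d t ^ 2 * (((d + 1) * starBound d t) ^ 2 * volConst d t ^ 2 *
        ‖M.brokenGrad σ‖ ^ 2) := by
      gcongr
      exact le_self_pow₀ hR two_ne_zero
    _ = _ := by rw [smoothConst]; ring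

end Mesh

theorem smoothConst_nonneg {t : ℝ} (ht : 0 ≤ t) : 0 ≤ smoothConst d t := by
  rw [smoothConst, gradConst, nodeConst, volConst, bubbleConst]
  positivity

/-- In powers of `2 * t` the exponent grows with `t` too, so monotonicity is derived for bases at
least 1, that is from `1 / 2` onwards. -/
theorem smoothConst_mono {s t : ℝ} (hs : 1 / 2 ≤ s) (hst : s ≤ t) :
    smoothConst d s ≤ smoothConst d t := by
  have hs0 : 0 ≤ s := by linarith
  have ht0 : 0 ≤ t := by linarith
  have hn : starBound d s ≤ starBound d t := Nat.floor_mono (by gcongr)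
  have hpow : (2 * s) ^ starBound d s ≤ (2 * t) ^ starBound d t :=
    (pow_le_pow_left₀ (by linarith) (by linarith) _).trans
      (pow_le_pow_right₀ (by linarith) hn)
  have hA : nodeConst d s ≤ nodeConst d t := by
    rw [nodeConst, nodeConst]
    gcongr
  have hA0 : 0 ≤ nodeConst d t := by rw [nodeConst]; positivity
  have hA0' : 0 ≤ nodeConst d s := by rw [nodeConst]; positivity
  have hc0 : 0 ≤ bubbleConst d := by rw [bubbleConst]; positivity
  have hB : gradConst d s ≤ gradConst d t := by
    rw [gradConst, gradConst]
    gcongr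
  have hB0 : 0 ≤ gradConst d t := by rw [gradConst]; positivity
  have hR : volConst d s ≤ volConst d t := by
    rw [volConst, volConst]
    gcongr
  have hR0 : 0 ≤ volConst d s := by rw [volConst]; positivity
  rw [smoothConst, smoothConst]
  gcongr

end

end CRMethod

/-! ### The quasi-optimality theorem -/

theorem theoremT :
    ∃ C : ℕ → ℝ → ℝ, (∀ d, Monotone (C d)) ∧
      ∀ (d : ℕ), 2 ≤ d → ∀ (Ω : Set (Pt d)), IsLipschitzDomain Ω →
      ∀ (M : Mesh Ω), 1 < M.elems.card →
      ∀ (Kz : Pt d → Finset (Pt d)), M.IsNodeChoice Kz →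
        H10 Ω ⊔ M.crSpace ≤ M.brokenH1 ∧
        IsScalarProductOn M.form (M.V ⊔ M.S) ∧
        ∃ N : NonconformingMethod M.V M.S,
          M.IsNewCRMethod Kz N ∧
          N.IsGalerkin M.form ∧
          N.IsQuasiOptimal M.form ∧
          N.Cqopt M.form ≤ C d M.shape := by
  -- Cutting off at `1 / 2` makes the constant monotone on all of the real line and supplies `1 / 2
  -- ≤ t`, while diameters remain bounded by `t` times inscribed diameters.
  refine ⟨fun d γ => 1 + smoothConst d (max γ (1 / 2)), fun d γ γ' h => ?_,
    fun d hd Ω hΩ M _ Kz hKz => ?_⟩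
  · have := smoothConst_mono (d := d) (le_max_right γ (1 / 2)) (max_le_max_right (1 / 2) h)
    simpa using this
  have hd1 : 1 ≤ d := by omega
  have ht0 : (1 / 2 : ℝ) ≤ max M.shape (1 / 2) := le_max_right _ _
  have ht : ∀ K ∈ M.elems, Metric.diam (hull K) ≤ max M.shape (1 / 2) * inDiam K :=
    fun K hK => (M.diam_le_shape_mul hd1 hK).trans
      (mul_le_mul_of_nonneg_right (le_max_left _ _) ((M.isSimplex hK).inDiam_pos hd1).le)
  obtain ⟨hq, hC⟩ := M.isQuasiOptimal_of_bound hΩ hd1 hKz (smoothConst_nonneg (by linarith))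
    (M.norm_brokenGrad_smoothing_le hΩ hd hd1 hKz ht0 ht)
  exact ⟨M.H10_sup_crSpace_le hΩ, M.isScalarProductOn hΩ hd1, M.crMethod hΩ hd1 hKz,
    M.isNewCRMethod_crMethod hΩ hd1 hKz, M.isGalerkin_crMethod hΩ hd1 hKz, hq, hC⟩
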